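/- The parameterized \textsc{ord-mc-dag} problem (ordered multicut in a directed acyclic graph) is the following. The input consists of a directed acyclic graph $G$ with $n$ vertices, two disjoint sequences $X=(x_1,\dots,x_l)$ and $Y=(y_1,\dots,y_l)$ of pairwise distinct vertices of $G$ (the terminals), and an integer $k\ge 0$. A set $R$ of non-terminal vertices of $G$ \emph{orderly separates} $X$ from $Y$ if, for all $i,j\in\{1,\dots,l\}$ with $i\ge j$, the graph $G\setminus R$ contains no directed path from $x_i$ to $y_j$. The task is to output a set $R$ with $|R|\le k$ that orderly separates $X$ from $Y$, or to answer 'NO' if there is no such set. Theorem. There is an FPT-algorithm that solves the parameterized \textsc{ord-mc-dag} problem in time $O(4^k\cdot\mathrm{poly}(n))$: there are one algorithm and one polynomial $p$, independent of the input and in particular of $k$, such that on every input as above the algorithm halts after at most $4^k\cdot p(n)$ steps with a correct output. (Algorithms are programs in a first-order recursive language on binary trees with unit cost per evaluation step, a model polynomially equivalent to Turing machines; $G$ is given by its adjacency matrix, and vertex names and $k$ are given in unary.) -/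

import Mathlib

namespace OrdMC

/-! ## The machine model: a first-order LISP over binary trees, one time unit per evaluation step

Data are binary trees. A program is a finite list of (mutually recursive) unary functions, and
evaluation is call by value. Every evaluation step reads, allocates or passes on a bounded number of
pointers, so a run of `t` steps takes `O(t)` operations on a random access or pointer machine, and
the model is polynomially related to Turing machines. There is no arithmetic and no comparison of
whole trees among the primitives. -/

/-- Binary trees, the data that programs work on. -/
inductive Data : Type
  | nil : Data
  | cons (a b : Data) : Data

/-- Expressions; `var i` is the `i`-th entry of the environment (counted from the most recent
binding). -/
inductive Expr : Type
  | var (i : ℕ) : Expr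
  | nil : Expr
  | cons (e₁ e₂ : Expr) : Expr
  /-- Evaluate `e`; if the value is `nil`, go on with `e₁`; if it is `cons a b`, bind `a` to variable
  `0` and `b` to variable `1` (older variables are shifted by two) and go on with `e₂`. -/
  | caseOf (e e₁ e₂ : Expr) : Expr
  /-- Bind the value of `e` to variable `0` (older variables are shifted by one) in `e'`. -/
  | letIn (e e' : Expr) : Expr
  /-- Call the `f`-th function of the program on the value of `e`. -/
  | call (f : ℕ) (e : Expr) : Expr

/-- A program is the list of the bodies of its functions. The body of a function sees its argument
as variable `0` and nothing else. -/
abbrev Program : Type := List Expr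

/-- `Eval P env e v t`: in the environment `env`, the expression `e` evaluates to `v` in exactly `t`
steps, where the functions are those of `P`. -/
inductive Eval (P : Program) : List Data → Expr → Data → ℕ → Prop
  | var {env : List Data} {i : ℕ} {v : Data} (h : env[i]? = some v) :
      Eval P env (.var i) v 1
  | nil {env : List Data} : Eval P env .nil .nil 1
  | cons {env : List Data} {e₁ e₂ : Expr} {a b : Data} {s t : ℕ}
      (h₁ : Eval P env e₁ a s) (h₂ : Eval P env e₂ b t) :
      Eval P env (.cons e₁ e₂) (.cons a b) (s + t + 1)
  | caseNil {env : List Data} {e e₁ e₂ : Expr} {v : Data} {s t : ℕ}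
      (h : Eval P env e .nil s) (h₁ : Eval P env e₁ v t) :
      Eval P env (.caseOf e e₁ e₂) v (s + t + 1)
  | caseCons {env : List Data} {e e₁ e₂ : Expr} {a b v : Data} {s t : ℕ}
      (h : Eval P env e (.cons a b) s) (h₂ : Eval P (a :: b :: env) e₂ v t) :
      Eval P env (.caseOf e e₁ e₂) v (s + t + 1)
  | letIn {env : List Data} {e e' : Expr} {a v : Data} {s t : ℕ}
      (h : Eval P env e a s) (h' : Eval P (a :: env) e' v t) :
      Eval P env (.letIn e e') v (s + t + 1)
  | call {env : List Data} {f : ℕ} {e body : Expr} {a v : Data} {s t : ℕ}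
      (hf : P[f]? = some body) (h : Eval P env e a s) (h' : Eval P [a] body v t) :
      Eval P env (.call f e) v (s + t + 1)

/-- `HaltsWith P input output t`: started on `input`, the program `P` (that is, its function number
`0`) halts with the given output after exactly `t` steps. -/
def HaltsWith (P : Program) (input output : Data) (t : ℕ) : Prop :=
  ∃ body, P[0]? = some body ∧ Eval P [input] body output t

/-- Evaluation is deterministic, in its result and in its number of steps. -/
theorem Eval.unique {P : Program} {env : List Data} {e : Expr} {v : Data} {t : ℕ}
    (h : Eval P env e v t) : ∀ {v' : Data} {t' : ℕ}, Eval P env e v' t' → v = v' ∧ t = t' := by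
  induction h with
  | var h =>
    intro v' t' h'
    cases h' with
    | var h' => rw [h] at h'; exact ⟨Option.some.inj h', rfl⟩
  | nil => intro v' t' h'; cases h'; exact ⟨rfl, rfl⟩
  | cons _ _ ih₁ ih₂ =>
    intro v' t' h'
    cases h' with
    | cons g₁ g₂ =>
      obtain ⟨rfl, rfl⟩ := ih₁ g₁
      obtain ⟨rfl, rfl⟩ := ih₂ g₂
      exact ⟨rfl, rfl⟩
  | caseNil _ _ ih ih₁ =>
    intro v' t' h'
    cases h' with
    | caseNil g g₁ =>
      obtain ⟨-, rfl⟩ := ih g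
      obtain ⟨rfl, rfl⟩ := ih₁ g₁
      exact ⟨rfl, rfl⟩
    | caseCons g g₂ => exact absurd (ih g).1 (by simp)
  | caseCons _ _ ih ih₂ =>
    intro v' t' h'
    cases h' with
    | caseNil g g₁ => exact absurd (ih g).1 (by simp)
    | caseCons g g₂ =>
      obtain ⟨hab, rfl⟩ := ih g
      cases hab
      obtain ⟨rfl, rfl⟩ := ih₂ g₂
      exact ⟨rfl, rfl⟩
  | letIn _ _ ih ih' =>
    intro v' t' h'
    cases h' with
    | letIn g g' =>
      obtain ⟨rfl, rfl⟩ := ih g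
      obtain ⟨rfl, rfl⟩ := ih' g'
      exact ⟨rfl, rfl⟩
  | call hf _ _ ih ih' =>
    intro v' t' h'
    cases h' with
    | call gf g g' =>
      rw [hf] at gf
      cases gf
      obtain ⟨rfl, rfl⟩ := ih g
      obtain ⟨rfl, rfl⟩ := ih' g'
      exact ⟨rfl, rfl⟩

/-- A program has at most one output and one running time on each input. -/
theorem HaltsWith.unique {P : Program} {input v v' : Data} {t t' : ℕ}
    (h : HaltsWith P input v t) (h' : HaltsWith P input v' t') : v = v' ∧ t = t' := by
  obtain ⟨b, hb, h⟩ := h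
  obtain ⟨b', hb', h'⟩ := h'
  rw [hb] at hb'
  cases hb'
  exact h.unique h'

/-! ## Encodings -/

/-- Natural numbers (vertex names and the parameter) in unary. -/
def Data.ofNat : ℕ → Data
  | 0 => .nil
  | m + 1 => .cons .nil (Data.ofNat m)

/-- Truth values. -/
def Data.ofBool : Bool → Data
  | false => .nil
  | true => .cons .nil .nil

/-- Lists of trees as trees. -/
def Data.ofList : List Data → Data
  | [] => .nil
  | a :: as => .cons a (Data.ofList as)

/-- A list of vertices. -/
def Data.ofVertices {n : ℕ} (L : List (Fin n)) : Data :=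
  Data.ofList (L.map fun v => Data.ofNat v)

open Classical in
/-- A digraph on `n` vertices as its adjacency matrix, row by row. -/
noncomputable def Data.ofDigraph {n : ℕ} (G : Digraph (Fin n)) : Data :=
  Data.ofList (List.ofFn fun u : Fin n =>
    Data.ofList (List.ofFn fun v : Fin n => Data.ofBool (decide (G.Adj u v))))

/-- The input `(G, (x_1, …, x_l), (y_1, …, y_l), k)`. -/
noncomputable def encodeInput {n l : ℕ} (G : Digraph (Fin n)) (X Y : Fin l → Fin n) (k : ℕ) :
    Data :=
  .cons (Data.ofDigraph G)
    (.cons (Data.ofVertices (List.ofFn X)) (.cons (Data.ofVertices (List.ofFn Y)) (Data.ofNat k)))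

/-- Outputs: `none` is the answer 'NO', `some L` is the vertex set listed by `L`. -/
def encodeOutput {n : ℕ} : Option (List (Fin n)) → Data
  | none => .nil
  | some L => .cons .nil (Data.ofVertices L)

/-! ## The parameterized ordered multicut problem in a DAG -/

/-- `G` has no directed cycle (in particular no loop). -/
def IsDAG {V : Type*} (G : Digraph V) : Prop :=
  ∀ v, ¬ Relation.TransGen G.Adj v v

/-- The graph `G ∖ R` has a directed path from `a` to `b`. -/
def HasPathAvoiding {V : Type*} (G : Digraph V) (R : Finset V) (a b : V) : Prop :=
  a ∉ R ∧ Relation.ReflTransGen (fun u v => G.Adj u v ∧ u ∉ R ∧ v ∉ R) a b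

/-- `R` is a set of non-terminal vertices that orderly separates `X` from `Y` in `G`. -/
def OrderlySeparates {V : Type*} {l : ℕ} (G : Digraph V) (X Y : Fin l → V) (R : Finset V) : Prop :=
  (∀ i, X i ∉ R ∧ Y i ∉ R) ∧ ∀ i j, j ≤ i → ¬ HasPathAvoiding G R (X i) (Y j)

/-- The correct answers to the instance `(G, X, Y, k)`: a repetition-free list of the elements of an
orderly separating set of size at most `k`, or 'NO' if there is no such set. -/
def IsCorrectAnswer {n l : ℕ} (G : Digraph (Fin n)) (X Y : Fin l → Fin n) (k : ℕ) :
    Option (List (Fin n)) → Prop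
  | some L => L.Nodup ∧ L.length ≤ k ∧ OrderlySeparates G X Y L.toFinset
  | none => ¬ ∃ R : Finset (Fin n), R.card ≤ k ∧ OrderlySeparates G X Y R

end OrdMC

namespace OrdMC

/-! ## Polynomial bounds -/

/-! The last source has to be cut off from all sinks, and once this is settled the same problem
remains for the other pairs. So a search treats the pairs from the last to the first. Its state
records the deletable vertices `D`, the undeletable vertices `U`, the budget k and the remaining
pairs. Let x be the current source, Y the set of remaining sinks and m the minimum size of a subset
of `D` that cuts x from Y; if there is no such set or m > k, the answer is NO. Otherwise take a
deletable vertex u that x reaches through `U`.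

If m stays the same when u becomes undeletable, then every solution can be replaced by one that is
no larger and avoids u (`exists_solution_avoiding`): by submodularity of vertex boundaries, the part
of the solution around the region reachable from x can be pushed towards the sinks, past u. Since Y
contains the sinks of all remaining pairs, this also keeps the other pairs separated. So u is made
undeletable without branching. If m would change, the search branches: deleting u lowers k by 1 and
m by at most 1, and forbidding u raises m by at least 1. Either way 2k - m drops. If x reaches no
deletable vertex through `U`, then m = 0 and x is separated whatever else is deleted, so the search
may pass to the next pair without increasing the measure. Hence at most 2^(2k) = 4^k times a
polynomial number of states are visited (`State.Valid.exists_search`).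

The number m comes from a bipartite matching. Let A be the deletable vertices that x reaches through
`U`, R the other deletable vertices, and L the deletable vertices that reach no sink through `U`. If
M is a maximum matching between L and R for the relation `Via`, then m = |A| + |M| - |L|
(`exists_isCut_of_matching`, `IsCut.card_ge_of_matching`). The matching is found with augmenting
paths, and these by breadth first search.

For the running time, `PolyTime` is closed under composition, case distinction and folds with
results of polynomial size, so one step of the search is in `PolyTime`; depth first search then
costs a polynomial per visited state (`PolyTime.exists_search`). The budget is capped at n, so the
size of states is polynomial in n alone. Only the initialization takes time polynomial in k, and the
factor 4^k absorbs it (`exists_polynomial_four_pow`). -/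

theorem polyEval_mono (p : Polynomial ℕ) {a b : ℕ} (h : a ≤ b) : p.eval a ≤ p.eval b := by
  rw [Polynomial.eval_eq_sum, Polynomial.eval_eq_sum]
  exact Finset.sum_le_sum fun i _ => Nat.mul_le_mul_left _ (Nat.pow_le_pow_left h i)

/-- The number of nodes of a tree. -/
def Data.size : Data → ℕ
  | .nil => 1
  | .cons a b => a.size + b.size + 1

theorem Data.size_pos (d : Data) : 0 < d.size := by cases d <;> simp [Data.size]

/-! ### Representation of types by trees, and sizes -/

/-- Types whose elements are represented by trees. -/
class Enc (α : Type) where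
  enc : α → Data

/-- The size of the representation. -/
def sz {α : Type} [Enc α] (a : α) : ℕ := (Enc.enc a).size

/-- The representations are chosen to coincide with the prescribed encodings of inputs and outputs.
Moreover a number, a list of units and (if positive) an optional value share the shape of a `cons`
with left entry `nil`, so that many conversions cost nothing. -/
instance : Enc Unit := ⟨fun _ => .nil⟩
instance : Enc ℕ := ⟨Data.ofNat⟩
instance : Enc Bool := ⟨Data.ofBool⟩
instance {α β : Type} [Enc α] [Enc β] : Enc (α × β) := ⟨fun x => .cons (Enc.enc x.1) (Enc.enc x.2)⟩
instance {α : Type} [Enc α] : Enc (List α) := ⟨fun l => Data.ofList (l.map Enc.enc)⟩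
instance {α : Type} [Enc α] : Enc (Option α) :=
  ⟨fun o => o.elim .nil fun a => .cons .nil (Enc.enc a)⟩

theorem sz_pos {α : Type} [Enc α] (a : α) : 0 < sz a := Data.size_pos _

@[simp] theorem sz_prod {α β : Type} [Enc α] [Enc β] (x : α × β) : sz x = sz x.1 + sz x.2 + 1 := rfl
@[simp] theorem sz_nil {α : Type} [Enc α] : sz ([] : List α) = 1 := rfl
@[simp] theorem sz_cons {α : Type} [Enc α] (a : α) (l : List α) : sz (a :: l) = sz a + sz l + 1 := rfl
@[simp] theorem sz_none {α : Type} [Enc α] : sz (none : Option α) = 1 := rfl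
@[simp] theorem sz_some {α : Type} [Enc α] (a : α) : sz (some a) = sz a + 2 := by
  change 1 + _ + 1 = _
  rw [sz]
  omega
@[simp] theorem sz_nat (m : ℕ) : sz m = 2 * m + 1 := by
  induction m with
  | zero => rfl
  | succ m ih =>
    change 1 + sz m + 1 = _
    rw [ih]
    omega
theorem sz_bool (b : Bool) : sz b ≤ 3 := by cases b <;> decide

theorem sz_le_of_mem {α : Type} [Enc α] {a : α} {l : List α} (h : a ∈ l) : sz a ≤ sz l := by
  induction l with
  | nil => simp at h
  | cons b l ih =>
    rw [sz_cons]
    rcases List.mem_cons.1 h with rfl | h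
    · omega
    · have := ih h
      omega

theorem length_lt_sz {α : Type} [Enc α] (l : List α) : l.length < sz l := by
  induction l with
  | nil => simp
  | cons b l ih =>
    rw [sz_cons, List.length_cons]
    have := sz_pos b
    omega

theorem sz_list_le {α : Type} [Enc α] {l : List α} {s : ℕ} (h : ∀ a ∈ l, sz a ≤ s) :
    sz l ≤ l.length * (s + 1) + 1 := by
  induction l with
  | nil => simp
  | cons b l ih =>
    rw [sz_cons, List.length_cons]
    have h₁ := ih fun a ha => h a (List.mem_cons_of_mem _ ha)
    have h₂ := h b List.mem_cons_self
    linarith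

theorem sz_append {α : Type} [Enc α] (l l' : List α) : sz (l ++ l') + 1 = sz l + sz l' := by
  induction l with
  | nil => simp [Nat.add_comm]
  | cons b l ih =>
    rw [List.cons_append, sz_cons, sz_cons]
    omega

/-- The quantity `s a` is at most polynomial in the size of `a`. -/
def PolyBounded {α : Type} [Enc α] (s : α → ℕ) : Prop :=
  ∃ p : Polynomial ℕ, ∀ a, s a ≤ p.eval (sz a)

namespace PolyBounded

variable {α β γ : Type} [Enc α] [Enc β] [Enc γ]

theorem mono {s s' : α → ℕ} (h : PolyBounded s') (hs : ∀ a, s a ≤ s' a) : PolyBounded s := by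
  obtain ⟨p, hp⟩ := h
  exact ⟨p, fun a => (hs a).trans (hp a)⟩

theorem const (c : ℕ) : PolyBounded fun _ : α => c := ⟨Polynomial.C c, fun a => by simp⟩

theorem sz_self : PolyBounded fun a : α => sz a := ⟨Polynomial.X, fun a => by simp⟩

theorem add {s s' : α → ℕ} (h : PolyBounded s) (h' : PolyBounded s') :
    PolyBounded fun a => s a + s' a := by
  obtain ⟨p, hp⟩ := h
  obtain ⟨q, hq⟩ := h'
  exact ⟨p + q, fun a => by rw [Polynomial.eval_add]; exact Nat.add_le_add (hp a) (hq a)⟩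

theorem mul {s s' : α → ℕ} (h : PolyBounded s) (h' : PolyBounded s') :
    PolyBounded fun a => s a * s' a := by
  obtain ⟨p, hp⟩ := h
  obtain ⟨q, hq⟩ := h'
  exact ⟨p * q, fun a => by rw [Polynomial.eval_mul]; exact Nat.mul_le_mul (hp a) (hq a)⟩

theorem comp {s : β → ℕ} (h : PolyBounded s) {f : α → β} (hf : PolyBounded fun a => sz (f a)) :
    PolyBounded fun a => s (f a) := by
  obtain ⟨p, hp⟩ := h
  obtain ⟨q, hq⟩ := hf
  refine ⟨p.comp q, fun a => ?_⟩
  rw [Polynomial.eval_comp]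
  exact (hp _).trans (polyEval_mono _ (hq a))

end PolyBounded

/-! ## Linking of programs -/

/-- Add `k` to the indices of all functions that are called. -/
def Expr.shift (k : ℕ) : Expr → Expr
  | .var i => .var i
  | .nil => .nil
  | .cons e₁ e₂ => .cons (e₁.shift k) (e₂.shift k)
  | .caseOf e e₁ e₂ => .caseOf (e.shift k) (e₁.shift k) (e₂.shift k)
  | .letIn e e' => .letIn (e.shift k) (e'.shift k)
  | .call f e => .call (k + f) (e.shift k)

/-- The code of `P` is placed behind `Q`, and all calls are shifted by the length of `Q`, so each
call still finds its body. The number of steps does not change, hence linking is free. -/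
theorem Eval.link {P : Program} {env : List Data} {e : Expr} {v : Data} {t : ℕ}
    (h : Eval P env e v t) (Q Q' : Program) :
    Eval (Q ++ P.map (Expr.shift Q.length) ++ Q') env (e.shift Q.length) v t := by
  induction h with
  | var h => exact .var h
  | nil => exact .nil
  | cons _ _ ih₁ ih₂ => exact .cons ih₁ ih₂
  | caseNil _ _ ih ih₁ => exact .caseNil ih ih₁
  | caseCons _ _ ih ih₁ => exact .caseCons ih ih₁
  | letIn _ _ ih ih₁ => exact .letIn ih ih₁
  | @call env f e body a v s t hf _ _ ih ih₁ =>
    refine .call ?_ ih ih₁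
    rw [List.append_assoc, List.getElem?_append_right (Nat.le_add_right _ _),
      List.getElem?_append_left]
    · simp [hf]
    · have := (List.getElem?_eq_some_iff.1 hf).1
      simpa using this

theorem Eval.append_right {P : Program} {env : List Data} {e : Expr} {v : Data} {t : ℕ}
    (h : Eval P env e v t) (Q : Program) : Eval (P ++ Q) env e v t := by
  induction h with
  | var h => exact .var h
  | nil => exact .nil
  | cons _ _ ih₁ ih₂ => exact .cons ih₁ ih₂
  | caseNil _ _ ih ih₁ => exact .caseNil ih ih₁
  | caseCons _ _ ih ih₁ => exact .caseCons ih ih₁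
  | letIn _ _ ih ih₁ => exact .letIn ih ih₁
  | call hf _ _ ih ih₁ =>
    refine .call ?_ ih ih₁
    rw [List.getElem?_append_left (List.getElem?_eq_some_iff.1 hf).1]
    exact hf

/-- Variables are counted from the front and a called body sees only its own argument, so entries at
the back of the environment are invisible. This allows an expression written for a single argument
to run below further local bindings. -/
theorem Eval.weaken {P : Program} {env : List Data} {e : Expr} {v : Data} {t : ℕ}
    (h : Eval P env e v t) (env' : List Data) : Eval P (env ++ env') e v t := by
  induction h with
  | var h =>
    refine .var ?_
    rw [List.getElem?_append_left (List.getElem?_eq_some_iff.1 h).1]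
    exact h
  | nil => exact .nil
  | cons _ _ ih₁ ih₂ => exact .cons ih₁ ih₂
  | caseNil _ _ ih ih₁ => exact .caseNil ih ih₁
  | caseCons _ _ ih ih₁ => exact .caseCons ih ih₁
  | letIn _ _ ih ih₁ => exact .letIn ih ih₁
  | call hf h _ ih _ => exact .call hf ih ‹_›

/-! ## Functions computable in polynomial time -/

/-- With the functions of `P`, the expression `e` computes `f` within time `p`, and `p` also bounds
the size of the value. -/
def Computes {α β : Type} [Enc α] [Enc β] (P : Program) (e : Expr) (p : Polynomial ℕ)
    (f : α → β) : Prop :=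
  ∀ a, sz (f a) ≤ p.eval (sz a) ∧
    ∃ t, t ≤ p.eval (sz a) ∧ Eval P [Enc.enc a] e (Enc.enc (f a)) t

/-- Computable in polynomial time with output of polynomial size. -/
def PolyTime {α β : Type} [Enc α] [Enc β] (f : α → β) : Prop :=
  ∃ P e p, Computes P e p f

section

variable {α β γ δ ε : Type} [Enc α] [Enc β] [Enc γ] [Enc δ] [Enc ε]

theorem Computes.append_right {P : Program} {e : Expr} {p : Polynomial ℕ} {f : α → β}
    (h : Computes P e p f) (Q : Program) : Computes (P ++ Q) e p f := fun a => by
  obtain ⟨h₁, t, ht, h⟩ := h a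
  exact ⟨h₁, t, ht, h.append_right Q⟩

theorem Computes.link {P : Program} {e : Expr} {p : Polynomial ℕ} {f : α → β}
    (h : Computes P e p f) (Q : Program) :
    Computes (Q ++ P.map (Expr.shift Q.length)) (e.shift Q.length) p f := fun a => by
  obtain ⟨h₁, t, ht, h⟩ := h a
  refine ⟨h₁, t, ht, ?_⟩
  simpa using h.link Q []

theorem Computes.mono {P : Program} {e : Expr} {p q : Polynomial ℕ} {f : α → β}
    (h : Computes P e p f) (hq : ∀ n, p.eval n ≤ q.eval n) : Computes P e q f := fun a => by
  obtain ⟨h₁, t, ht, h⟩ := h a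
  exact ⟨h₁.trans (hq _), t, ht.trans (hq _), h⟩

theorem PolyTime.merge {f : α → β} {g : γ → δ} (hf : PolyTime f) (hg : PolyTime g) :
    ∃ P e e' p, Computes P e p f ∧ Computes P e' p g := by
  obtain ⟨P, e, p, hf⟩ := hf
  obtain ⟨Q, e', q, hg⟩ := hg
  refine ⟨_, e, _, p + q, (hf.append_right _).mono fun n => ?_, (hg.link P).mono fun n => ?_⟩ <;>
    simp

theorem PolyTime.polyBounded {f : α → β} (hf : PolyTime f) : PolyBounded fun a => sz (f a) := by
  obtain ⟨P, e, p, hf⟩ := hf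
  exact ⟨p, fun a => (hf a).1⟩

theorem PolyTime.of_eval {f : α → β} (e : Expr) (c : ℕ)
    (he : ∀ a, ∃ t, t ≤ c ∧ Eval [] [Enc.enc a] e (Enc.enc (f a)) t)
    (hs : PolyBounded fun a => sz (f a)) : PolyTime f := by
  obtain ⟨p, hp⟩ := hs
  refine ⟨[], e, p + Polynomial.C c, fun a => ?_⟩
  obtain ⟨t, ht, h⟩ := he a
  have : sz (f a) ≤ _ := hp a
  simp only [Polynomial.eval_add, Polynomial.eval_C]
  exact ⟨by omega, t, by omega, h⟩

/-- A function that leaves the representation unchanged. -/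
theorem PolyTime.of_enc_eq {f : α → β} (h : ∀ a, Enc.enc (f a) = Enc.enc a) : PolyTime f :=
  .of_eval (.var 0) 1 (fun a => ⟨1, le_rfl, .var (by simp [h])⟩)
    (PolyBounded.sz_self.mono fun a => by rw [sz, sz, h])

theorem PolyTime.id : PolyTime fun a : α => a := .of_enc_eq fun _ => rfl

theorem PolyTime.fst : PolyTime (Prod.fst : α × β → α) :=
  .of_eval (.caseOf (.var 0) .nil (.var 0)) 3
    (fun a => ⟨_, le_rfl, .caseCons (.var rfl) (.var rfl)⟩)
    (PolyBounded.sz_self.mono fun a => by rw [sz_prod]; omega)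

theorem PolyTime.snd : PolyTime (Prod.snd : α × β → β) :=
  .of_eval (.caseOf (.var 0) .nil (.var 1)) 3
    (fun a => ⟨_, le_rfl, .caseCons (.var rfl) (.var rfl)⟩)
    (PolyBounded.sz_self.mono fun a => by rw [sz_prod]; omega)

/-- An expression for a given tree. -/
def Data.quote : Data → Expr
  | .nil => .nil
  | .cons a b => .cons a.quote b.quote

theorem Data.eval_quote (P : Program) (env : List Data) (d : Data) :
    Eval P env d.quote d d.size := by
  induction d with
  | nil => exact .nil
  | cons a b iha ihb => exact .cons iha ihb

theorem PolyTime.const (b : β) : PolyTime fun _ : α => b :=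
  .of_eval (Enc.enc b).quote (sz b) (fun _ => ⟨_, le_rfl, Data.eval_quote _ _ _⟩) (.const _)

theorem PolyTime.comp {f : β → γ} {g : α → β} (hf : PolyTime f) (hg : PolyTime g) :
    PolyTime fun a => f (g a) := by
  obtain ⟨P, e, e', p, hf, hg⟩ := hf.merge hg
  refine ⟨P, .letIn e' e, p.comp p + p + 1, fun a => ?_⟩
  obtain ⟨h₁, t, ht, h⟩ := hg a
  obtain ⟨h₁', t', ht', h'⟩ := hf (g a)
  have := polyEval_mono p h₁
  simp only [Polynomial.eval_add, Polynomial.eval_comp, Polynomial.eval_one]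
  exact ⟨by omega, t + t' + 1, by omega, .letIn h (h'.weaken [Enc.enc a])⟩

theorem PolyTime.pair {f : α → β} {g : α → γ} (hf : PolyTime f) (hg : PolyTime g) :
    PolyTime fun a => (f a, g a) := by
  obtain ⟨P, e, e', p, hf, hg⟩ := hf.merge hg
  refine ⟨P, .cons e e', p + p + 1, fun a => ?_⟩
  obtain ⟨h₁, t, ht, h⟩ := hf a
  obtain ⟨h₁', t', ht', h'⟩ := hg a
  simp only [Polynomial.eval_add, Polynomial.eval_one, sz_prod]
  exact ⟨by omega, t + t' + 1, by omega, .cons h h'⟩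

/-- Computability depends on the representing trees only, so a result passes between types and
between different descriptions of the same function. -/
theorem PolyTime.congr_enc {f : α → γ} {g : α → δ} (hf : PolyTime f)
    (h : ∀ x, Enc.enc (g x) = Enc.enc (f x)) : PolyTime g := by
  obtain ⟨P, e, p, hf⟩ := hf
  refine ⟨P, e, p, fun a => ?_⟩
  rw [sz, h]
  exact hf a

/-- Case distinction on whether `o c` is represented by `nil` or by a pair. -/
theorem PolyTime.branch {o : γ → δ} {f : γ → β} {g : γ × ε → β} {F : γ → β} (ho : PolyTime o)
    (hf : PolyTime f) (hg : PolyTime g)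
    (h : ∀ c, (Enc.enc (o c) = .nil ∧ F c = f c) ∨
      ∃ (x : ε) (a b : Data), Enc.enc (o c) = .cons a b ∧ Enc.enc x = .cons a b ∧ F c = g (c, x)) :
    PolyTime F := by
  obtain ⟨P, e₀, e₁, q, ho, hf⟩ := ho.merge hf
  obtain ⟨Q, e', r, hg⟩ := hg
  have ho' := ho.append_right (Q.map (Expr.shift P.length))
  have hf' := hf.append_right (Q.map (Expr.shift P.length))
  have hg' := hg.link P
  -- After the case distinction variable 2 is the input `c`, while variables 0 and 1 are the two
  -- halves of the value of `o c`. The pair `(c, x)` is rebuilt from these and handed to the code of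
  -- `g`.
  refine ⟨P ++ Q.map (Expr.shift P.length), .caseOf e₀ e₁ (.letIn (.cons (.var 2) (.cons (.var 0) (.var 1)))
    (e'.shift P.length)), q + q + r.comp (Polynomial.X + q + 1) + 7, fun c => ?_⟩
  simp only [Polynomial.eval_add, Polynomial.eval_one, Polynomial.eval_comp, Polynomial.eval_X,
    Polynomial.eval_ofNat]
  obtain ⟨h₁, t, ht, hev⟩ := ho' c
  rcases h c with ⟨hn, hF⟩ | ⟨x, a, b, hn, hx, hF⟩
  · obtain ⟨h₁', t', ht', hev'⟩ := hf' c
    rw [hF]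
    rw [hn] at hev
    exact ⟨by omega, t + t' + 1, by omega, .caseNil hev hev'⟩
  · obtain ⟨h₁', t', ht', hev'⟩ := hg' (c, x)
    have hxo : sz x = sz (o c) := by rw [sz, sz, hn, hx]
    have hm : r.eval (sz (c, x)) ≤ r.eval (sz c + q.eval (sz c) + 1) := by
      apply polyEval_mono
      rw [sz_prod]
      simp only
      omega
    rw [hF]
    rw [hn] at hev
    have hx' : Enc.enc (c, x) = .cons (Enc.enc c) (.cons a b) := by rw [← hx]; rfl
    rw [hx'] at hev'
    exact ⟨by omega, t + (5 + t' + 1) + 1, by omega, .caseCons hev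
      (.letIn (.cons (.var rfl) (.cons (.var rfl) (.var rfl))) (hev'.weaken _))⟩

theorem PolyTime.cond {b : γ → Bool} {f g : γ → β} (hb : PolyTime b) (hf : PolyTime f)
    (hg : PolyTime g) : PolyTime fun c => cond (b c) (f c) (g c) := by
  refine PolyTime.branch (ε := Unit × Unit) hb hg (hf.comp .fst) fun c => ?_
  cases b c
  · exact .inl ⟨rfl, rfl⟩
  · exact .inr ⟨((), ()), _, _, rfl, rfl, rfl⟩

theorem PolyTime.optionElim {o : γ → Option α} {f : γ → β} {g : γ → α → β} (ho : PolyTime o)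
    (hf : PolyTime f) (hg : PolyTime fun x : γ × α => g x.1 x.2) :
    PolyTime fun c => (o c).elim (f c) (g c) := by
  refine PolyTime.branch (ε := Unit × α) ho hf (hg.comp (.pair .fst (.comp .snd .snd)))
    fun c => ?_
  cases o c with
  | none => exact .inl ⟨rfl, rfl⟩
  | some a => exact .inr ⟨((), a), _, _, rfl, rfl, rfl⟩

theorem PolyTime.some {f : γ → α} (hf : PolyTime f) : PolyTime fun c => some (f c) :=
  (PolyTime.pair (.const ()) hf).congr_enc fun _ => rfl

theorem PolyTime.cons {f : γ → α} {g : γ → List α} (hf : PolyTime f) (hg : PolyTime g) :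
    PolyTime fun c => f c :: g c :=
  (hf.pair hg).congr_enc fun _ => rfl

theorem PolyTime.head? {l : γ → List α} (hl : PolyTime l) : PolyTime fun c => (l c).head? := by
  refine PolyTime.branch (ε := α × List α) hl (.const none)
    (PolyTime.some (.comp .fst .snd)) fun c => ?_
  cases l c with
  | nil => exact .inl ⟨rfl, rfl⟩
  | cons a l => exact .inr ⟨(a, l), _, _, rfl, rfl, rfl⟩

theorem PolyTime.tail {l : γ → List α} (hl : PolyTime l) : PolyTime fun c => (l c).tail := by
  refine PolyTime.branch (ε := α × List α) hl (.const []) (.comp .snd .snd) fun c => ?_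
  cases l c with
  | nil => exact .inl ⟨rfl, rfl⟩
  | cons a l => exact .inr ⟨(a, l), _, _, rfl, rfl, rfl⟩

/-- The body of a function that folds a list. -/
def foldrBody (idx : ℕ) (e e' : Expr) : Expr :=
  .caseOf (.var 0) .nil (.caseOf (.var 1) (.letIn (.var 0) e')
    (.letIn (.cons (.var 2) (.cons (.var 0) (.call idx (.cons (.var 2) (.var 1))))) e))

/-- The recursion makes one call per list entry. Iterating a polynomial time step can make values
grow exponentially, hence the separate assumption `hb` on the size of the result; it is stated for
all lists, so it covers the intermediate values as well. -/
theorem PolyTime.foldr {f : γ → α → β → β} {i : γ → β} {l : γ → List α} (hl : PolyTime l)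
    (hi : PolyTime i) (hf : PolyTime fun x : γ × α × β => f x.1 x.2.1 x.2.2)
    (hb : PolyBounded fun x : γ × List α => sz (x.2.foldr (f x.1) (i x.1))) :
    PolyTime fun c => (l c).foldr (f c) (i c) := by
  suffices H : PolyTime fun x : γ × List α => x.2.foldr (f x.1) (i x.1) from
    H.comp (PolyTime.id.pair hl)
  obtain ⟨P, e, e', p, hf, hi⟩ := hf.merge hi
  obtain ⟨q, hq⟩ := hb
  set body := foldrBody P.length e e' with hbody
  have hf := hf.append_right [body]
  have hi := hi.append_right [body]
  have hP : (P ++ [body])[P.length]? = Option.some body := by simp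
  -- A bound for the cost of one call: the first summand pays for the initial value, the second for
  -- the step function, whose argument consists of the parameter, a list entry and an intermediate
  -- value of size at most that of `q`, and the constant pays for the surrounding evaluation steps.
  set K : Polynomial ℕ := p + p.comp (Polynomial.X + q + 2) + 20 with hK
  have key : ∀ (S : ℕ) (c : γ) (l : List α), sz c + sz l + 1 ≤ S →
      ∃ t, t ≤ (l.length + 1) * K.eval S ∧ Eval (P ++ [body]) [Enc.enc (c, l)] body
        (Enc.enc (l.foldr (f c) (i c))) t := by
    intro S c l
    have hKS : K.eval S = p.eval S + p.eval (S + q.eval S + 2) + 20 := by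
      simp only [hK, Polynomial.eval_add, Polynomial.eval_comp, Polynomial.eval_X,
        Polynomial.eval_ofNat]
    induction l with
    | nil =>
      intro hS
      obtain ⟨-, t, ht, h⟩ := hi c
      have := polyEval_mono p (show sz c ≤ S by omega)
      refine ⟨1 + (1 + (1 + t + 1) + 1) + 1, ?_, ?_⟩
      · rw [List.length_nil, hKS]
        omega
      · exact .caseCons (.var rfl) (.caseNil (.var rfl) (.letIn (.var rfl) (h.weaken _)))
    | cons a l ih =>
      intro hS
      rw [sz_cons] at hS
      obtain ⟨t, ht, h⟩ := ih (by omega)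
      obtain ⟨-, t', ht', h'⟩ := hf (c, a, l.foldr (f c) (i c))
      have h₁ := hq (c, l)
      have h₂ := polyEval_mono q (show sz (c, l) ≤ S by rw [sz_prod]; simp only; omega)
      have h₃ := polyEval_mono p
        (show sz (c, a, l.foldr (f c) (i c)) ≤ S + q.eval S + 2 by
          simp only at h₁
          rw [sz_prod, sz_prod]
          simp only
          omega)
      -- The environment after both case distinctions: head, tail, parameter, whole list, original
      -- argument.
      have hcall := Eval.call (env := Enc.enc a :: Enc.enc l :: Enc.enc c :: Enc.enc (a :: l) ::
        [Enc.enc (c, a :: l)]) hP (e := .cons (.var 2) (.var 1)) (.cons (.var rfl) (.var rfl)) h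
      refine ⟨_, ?_, .caseCons (.var rfl) (.caseCons (.var rfl) (.letIn
        (.cons (.var rfl) (.cons (.var rfl) hcall)) (h'.weaken _)))⟩
      rw [List.length_cons, hKS] at *
      have : (l.length + 1 + 1) * (p.eval S + p.eval (S + q.eval S + 2) + 20) =
        (l.length + 1) * (p.eval S + p.eval (S + q.eval S + 2) + 20) +
          (p.eval S + p.eval (S + q.eval S + 2) + 20) := by ring
      rw [this]
      omega
  refine ⟨P ++ [body], .call P.length (.var 0), q + (Polynomial.X * K + 2), fun x => ?_⟩
  obtain ⟨c, l⟩ := x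
  obtain ⟨t, ht, h⟩ := key (sz (c, l)) c l le_rfl
  have h₁ := hq (c, l)
  simp only [Polynomial.eval_add, Polynomial.eval_mul, Polynomial.eval_X, Polynomial.eval_ofNat]
  refine ⟨h₁.trans (Nat.le_add_right _ _), 1 + t + 1, ?_, .call hP (.var rfl) h⟩
  have h₂ : (l.length + 1) * K.eval (sz (c, l)) ≤ sz (c, l) * K.eval (sz (c, l)) := by
    apply Nat.mul_le_mul_right
    have := length_lt_sz l
    rw [sz_prod]
    simp only
    omega
  omega

end

/-! ## Basic functions on lists, truth values and numbers -/

section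

variable {α β : Type}

theorem foldr_append_singleton (l : List α) :
    l.foldr (fun a acc => acc ++ [a]) [] = l.reverse := by
  induction l with
  | nil => rfl
  | cons a l ih => rw [List.foldr_cons, ih, List.reverse_cons]

theorem foldr_find (p : α → Bool) (l : List α) :
    l.foldr (fun a acc => cond (p a) (Option.some a) acc) none = l.find? p := by
  induction l with
  | nil => rfl
  | cons a l ih => rw [List.foldr_cons, ih, List.find?_cons]; cases p a <;> rfl

theorem foldr_filter_eq (p : α → Bool) (l : List α) :
    l.foldr (fun a acc => cond (p a) (a :: acc) acc) [] = l.filter p := by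
  induction l with
  | nil => rfl
  | cons a l ih => rw [List.foldr_cons, ih, List.filter_cons]; cases p a <;> rfl

theorem foldr_pred {l : List α} (m : ℕ) : l.foldr (fun _ m => m - 1) m = m - l.length := by
  induction l with
  | nil => rfl
  | cons a l ih => rw [List.foldr_cons, ih, List.length_cons]; omega

theorem foldr_tail (u : List β) (l : List α) :
    u.foldr (fun _ l => l.tail) l = l.drop u.length := by
  induction u with
  | nil => rfl
  | cons a u ih => rw [List.foldr_cons, ih, List.length_cons, List.tail_drop]

theorem any_eq_foldr (p : α → Bool) (l : List α) :
    l.any p = l.foldr (fun a b => p a || b) false := by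
  induction l with
  | nil => rfl
  | cons a l ih => rw [List.foldr_cons, ← ih, List.any_cons]

end

section

variable {α β γ δ ε : Type} [Enc α] [Enc β] [Enc γ] [Enc δ] [Enc ε]

theorem PolyTime.append {f g : γ → List α} (hf : PolyTime f) (hg : PolyTime g) :
    PolyTime fun c => f c ++ g c := by
  have : PolyTime fun x : List α × List α => x.1.foldr (fun a l => a :: l) x.2 := by
    refine PolyTime.foldr .fst .snd (.cons (.comp .fst .snd) (.comp .snd .snd)) ?_
    refine PolyBounded.sz_self.mono fun x => ?_
    have := sz_append x.2 x.1.2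
    rw [List.foldr_cons_eq_append', sz_prod, sz_prod]
    omega
  refine (this.comp (hf.pair hg)).congr_enc fun c => ?_
  rw [List.foldr_cons_eq_append']

theorem sz_reverse (l : List α) : sz l.reverse = sz l := by
  induction l with
  | nil => rfl
  | cons a l ih =>
    have := sz_append l.reverse [a]
    rw [List.reverse_cons, sz_cons]
    rw [sz_cons, sz_nil] at this
    omega

theorem PolyTime.reverse {l : γ → List α} (hl : PolyTime l) :
    PolyTime fun c => (l c).reverse := by
  have : PolyTime fun c => (l c).foldr (fun a acc => acc ++ [a]) [] := by
    refine PolyTime.foldr hl (.const [])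
      (.append (.comp .snd .snd) (.cons (.comp .fst .snd) (.const []))) ?_
    refine PolyBounded.sz_self.mono fun x => ?_
    rw [foldr_append_singleton, sz_reverse, sz_prod]
    omega
  exact this.congr_enc fun c => by rw [foldr_append_singleton]

theorem PolyTime.foldl {f : γ → β → α → β} {i : γ → β} {l : γ → List α} (hl : PolyTime l)
    (hi : PolyTime i) (hf : PolyTime fun x : γ × β × α => f x.1 x.2.1 x.2.2)
    (hb : PolyBounded fun x : γ × List α => sz (x.2.foldl (f x.1) (i x.1))) :
    PolyTime fun c => (l c).foldl (f c) (i c) := by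
  have : PolyTime fun c => (l c).reverse.foldr (fun a b => f c b a) (i c) := by
    refine PolyTime.foldr hl.reverse hi
      (hf.comp (.pair .fst (.pair (.comp .snd .snd) (.comp .fst .snd)))) ?_
    refine (hb.comp (f := fun x => (x.1, x.2.reverse))
      ((PolyTime.pair .fst (.reverse .snd)).polyBounded)).mono fun x => ?_
    rw [List.foldl_reverse]
  exact this.congr_enc fun c => by rw [List.foldr_reverse]

theorem PolyTime.bool_bounded (f : γ → Bool) : PolyBounded fun c => sz (f c) :=
  (PolyBounded.const 3).mono fun _ => sz_bool _

theorem PolyTime.and {f g : γ → Bool} (hf : PolyTime f) (hg : PolyTime g) :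
    PolyTime fun c => f c && g c :=
  (hf.cond hg (.const false)).congr_enc fun c => by cases f c <;> rfl

theorem PolyTime.or {f g : γ → Bool} (hf : PolyTime f) (hg : PolyTime g) :
    PolyTime fun c => f c || g c :=
  (hf.cond (.const true) hg).congr_enc fun c => by cases f c <;> rfl

theorem PolyTime.not {f : γ → Bool} (hf : PolyTime f) : PolyTime fun c => !f c :=
  (hf.cond (.const false) (.const true)).congr_enc fun c => by cases f c <;> rfl

theorem PolyTime.any {l : γ → List α} {p : γ → α → Bool} (hl : PolyTime l)
    (hp : PolyTime fun x : γ × α => p x.1 x.2) : PolyTime fun c => (l c).any (p c) := by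
  have : PolyTime fun c => (l c).foldr (fun a b => p c a || b) false :=
    PolyTime.foldr hl (.const false)
      (.or (hp.comp (.pair .fst (.comp .fst .snd))) (.comp .snd .snd)) (bool_bounded _)
  exact this.congr_enc fun c => by rw [any_eq_foldr]

theorem PolyTime.find? {l : γ → List α} {p : γ → α → Bool} (hl : PolyTime l)
    (hp : PolyTime fun x : γ × α => p x.1 x.2) : PolyTime fun c => (l c).find? (p c) := by
  have : PolyTime fun c => (l c).foldr (fun a acc => bif p c a then Option.some a else acc) none := by
    refine PolyTime.foldr hl (.const none)
      (.cond (hp.comp (.pair .fst (.comp .fst .snd))) (.some (.comp .fst .snd))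
        (.comp .snd .snd)) ?_
    refine (PolyBounded.sz_self.add (.const 2)).mono fun x => ?_
    rw [foldr_find, sz_prod]
    cases h : x.2.find? (p x.1) with
    | none => rw [sz_none]; omega
    | some a =>
      have := sz_le_of_mem (List.mem_of_find?_eq_some h)
      rw [sz_some]
      omega
  exact this.congr_enc fun c => by rw [foldr_find]

theorem sz_filter_le (p : α → Bool) (l : List α) : sz (l.filter p) ≤ sz l := by
  induction l with
  | nil => rfl
  | cons a l ih =>
    rw [List.filter_cons]
    split
    · rw [sz_cons, sz_cons]
      omega
    · rw [sz_cons]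
      omega

theorem PolyTime.filter {l : γ → List α} {p : γ → α → Bool} (hl : PolyTime l)
    (hp : PolyTime fun x : γ × α => p x.1 x.2) : PolyTime fun c => (l c).filter (p c) := by
  have : PolyTime fun c => (l c).foldr (fun a acc => bif p c a then a :: acc else acc) [] := by
    refine PolyTime.foldr hl (.const [])
      (.cond (hp.comp (.pair .fst (.comp .fst .snd))) (.cons (.comp .fst .snd) (.comp .snd .snd))
        (.comp .snd .snd)) ?_
    refine PolyBounded.sz_self.mono fun x => ?_
    have := sz_filter_le (p x.1) x.2
    rw [foldr_filter_eq, sz_prod]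
    omega
  exact this.congr_enc fun c => by rw [foldr_filter_eq]

/-- A list of polynomial length whose entries have polynomial size has polynomial size. -/
theorem PolyBounded.list {F : γ → List α} {s t : γ → ℕ} (hs : PolyBounded s) (ht : PolyBounded t)
    (hl : ∀ c, (F c).length ≤ s c) (hF : ∀ c, ∀ a ∈ F c, sz a ≤ t c) :
    PolyBounded fun c => sz (F c) :=
  ((hs.mul (ht.add (.const 1))).add (.const 1)).mono fun c =>
    (sz_list_le (hF c)).trans (Nat.add_le_add_right (Nat.mul_le_mul_right _ (hl c)) 1)

theorem PolyTime.map {l : γ → List α} {f : γ → α → β} (hl : PolyTime l)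
    (hf : PolyTime fun x : γ × α => f x.1 x.2) : PolyTime fun c => (l c).map (f c) := by
  have : PolyTime fun c => (l c).foldr (fun a acc => f c a :: acc) [] := by
    refine PolyTime.foldr hl (.const [])
      (.cons (hf.comp (.pair .fst (.comp .fst .snd))) (.comp .snd .snd)) ?_
    obtain ⟨p, hp⟩ := hf.polyBounded
    refine PolyBounded.list (s := fun x => sz x) (t := fun x => p.eval (sz x)) .sz_self
      ⟨p, fun _ => le_rfl⟩ (fun x => ?_) fun x b hb => ?_
    · have := length_lt_sz x.2
      rw [← List.map_eq_foldr, List.length_map, sz_prod]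
      omega
    · rw [← List.map_eq_foldr] at hb
      obtain ⟨a, ha, rfl⟩ := List.mem_map.1 hb
      refine (hp (x.1, a)).trans (polyEval_mono p ?_)
      have := sz_le_of_mem ha
      rw [sz_prod, sz_prod]
      simp only
      omega
  exact this.congr_enc fun c => by rw [List.map_eq_foldr]

/-- A unary number and the list of that many units are the same tree, so arithmetic reduces to list
operations. -/
theorem PolyTime.toUnits {f : γ → ℕ} (hf : PolyTime f) :
    PolyTime fun c => List.replicate (f c) () :=
  hf.congr_enc fun c => by
    induction f c with
    | zero => rfl
    | succ m ih =>
      change Data.cons .nil (Enc.enc (List.replicate m ())) = .cons .nil (Enc.enc m)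
      rw [ih]

theorem enc_replicate (m : ℕ) : Enc.enc m = Enc.enc (List.replicate m ()) := by
  induction m with
  | zero => rfl
  | succ m ih =>
    change Data.cons .nil (Enc.enc m) = .cons .nil (Enc.enc (List.replicate m ()))
    rw [ih]

theorem PolyTime.succ {f : γ → ℕ} (hf : PolyTime f) : PolyTime fun c => f c + 1 :=
  (PolyTime.pair (.const ()) hf).congr_enc fun _ => rfl

theorem PolyTime.pred {f : γ → ℕ} (hf : PolyTime f) : PolyTime fun c => f c - 1 :=
  hf.toUnits.tail.congr_enc fun c => by rw [enc_replicate, List.tail_replicate]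

theorem PolyTime.add {f g : γ → ℕ} (hf : PolyTime f) (hg : PolyTime g) :
    PolyTime fun c => f c + g c :=
  (hf.toUnits.append hg.toUnits).congr_enc fun c => by
    rw [enc_replicate, List.replicate_append_replicate]

theorem PolyTime.sub {f g : γ → ℕ} (hf : PolyTime f) (hg : PolyTime g) :
    PolyTime fun c => f c - g c := by
  have : PolyTime fun c => (List.replicate (g c) ()).foldr (fun _ m => m - 1) (f c) := by
    refine PolyTime.foldr hg.toUnits hf (.pred (.comp .snd .snd)) ?_
    refine (hf.polyBounded.comp (f := Prod.fst) (PolyTime.fst.polyBounded)).mono fun x => ?_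
    rw [foldr_pred, sz_nat, sz_nat]
    omega
  exact this.congr_enc fun c => by rw [foldr_pred, List.length_replicate]

theorem PolyTime.leNat {f g : γ → ℕ} (hf : PolyTime f) (hg : PolyTime g) :
    PolyTime fun c => decide (f c ≤ g c) := by
  -- The comparison tests whether the truncated difference vanishes.
  have : PolyTime fun c => (List.replicate (f c - g c) ()).head?.elim true fun _ => false :=
    (hf.sub hg).toUnits.head?.optionElim (.const true) (.const false)
  refine this.congr_enc fun c => congrArg Enc.enc ?_
  rcases Nat.lt_or_ge (g c) (f c) with h | h
  · obtain ⟨m, hm⟩ : ∃ m, f c - g c = m + 1 := ⟨f c - g c - 1, by omega⟩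
    rw [hm, decide_eq_false (Nat.not_le.2 h)]
    rfl
  · rw [Nat.sub_eq_zero_of_le h]
    simpa using h

theorem PolyTime.beqNat {f g : γ → ℕ} (hf : PolyTime f) (hg : PolyTime g) :
    PolyTime fun c => f c == g c :=
  ((hf.leNat hg).and (hg.leNat hf)).congr_enc fun c => congrArg Enc.enc <| by
    rw [Bool.eq_iff_iff]
    simp only [beq_iff_eq, Bool.and_eq_true, decide_eq_true_eq]
    omega

theorem PolyTime.elem {f : γ → ℕ} {l : γ → List ℕ} (hf : PolyTime f) (hl : PolyTime l) :
    PolyTime fun c => (l c).any (· == f c) :=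
  hl.any (.beqNat .snd (hf.comp .fst))

theorem PolyTime.length {l : γ → List α} (hl : PolyTime l) : PolyTime fun c => (l c).length := by
  have h : ∀ l : List α, l.foldr (fun _ m => m + 1) 0 = l.length := fun l => by
    induction l with
    | nil => rfl
    | cons a l ih => rw [List.foldr_cons, ih, List.length_cons]
  have : PolyTime fun c => (l c).foldr (fun _ m => m + 1) 0 := by
    refine PolyTime.foldr hl (.const 0) (.succ (.comp .snd .snd)) ?_
    refine ((PolyBounded.const 2).mul .sz_self).mono fun x => ?_
    have := length_lt_sz x.2
    rw [h, sz_nat, sz_prod]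
    omega
  exact this.congr_enc fun c => by rw [h]

theorem sz_tail_le (l : List α) : sz l.tail ≤ sz l := by
  cases l with
  | nil => exact le_rfl
  | cons a l => rw [sz_cons, List.tail_cons]; omega

theorem PolyTime.getElem? {l : γ → List α} {f : γ → ℕ} (hl : PolyTime l) (hf : PolyTime f) :
    PolyTime fun c => (l c)[f c]? := by
  have : PolyTime fun c => (List.replicate (f c) ()).foldr (fun _ l => l.tail) (l c) := by
    refine PolyTime.foldr hf.toUnits hl (.tail (.comp .snd .snd)) ?_
    refine (hl.polyBounded.comp (f := Prod.fst) (PolyTime.fst.polyBounded)).mono fun x => ?_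
    induction x.2 with
    | nil => exact le_rfl
    | cons a u ih => exact (sz_tail_le _).trans ih
  exact this.head?.congr_enc fun c => by
    rw [foldr_tail, List.length_replicate, List.head?_drop]

end

/-! ## Search trees -/

/-- `Search step S s r N`: the depth first search for a solution from the state `s` returns `r`
after having visited `N` states, all of size at most `S`. Here `step s` is either `(none, r)`, if
the answer for `s` is `r`, or `(some (s₁, o), _)`, if one has to search from `s₁` and, should that
fail, from the state in `o`. -/
inductive Search {σ β : Type} [Enc σ] (step : σ → Option (σ × Option σ) × Option β) (S : ℕ) :
    σ → Option β → ℕ → Prop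
  | leaf {s : σ} {r : Option β} (hs : sz s ≤ S) (h : step s = (none, r)) : Search step S s r 1
  | left {s s₁ : σ} {o : Option σ} {r : Option β} {b : β} {N : ℕ} (hs : sz s ≤ S)
      (h : step s = (some (s₁, o), r)) (h₁ : Search step S s₁ (some b) N) :
      Search step S s (some b) (N + 1)
  | fail {s s₁ : σ} {r : Option β} {N : ℕ} (hs : sz s ≤ S)
      (h : step s = (some (s₁, none), r)) (h₁ : Search step S s₁ none N) :
      Search step S s none (N + 1)
  | right {s s₁ s₂ : σ} {r r' : Option β} {N N' : ℕ} (hs : sz s ≤ S)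
      (h : step s = (some (s₁, some s₂), r)) (h₁ : Search step S s₁ none N)
      (h₂ : Search step S s₂ r' N') : Search step S s r' (N + N' + 1)

/-- The body of a function that performs a depth first search. -/
def searchBody (idx : ℕ) (e : Expr) : Expr :=
  .letIn e (.caseOf (.var 0) .nil (.caseOf (.var 0) (.var 1) (.caseOf (.var 1) .nil
    (.letIn (.call idx (.var 0)) (.caseOf (.var 0)
      (.caseOf (.var 2) .nil (.call idx (.var 1))) (.var 2))))))

/-- Depth first search takes polynomial time per visited state. -/
theorem PolyTime.exists_search {σ β : Type} [Enc σ] [Enc β]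
    {step : σ → Option (σ × Option σ) × Option β} (h : PolyTime step) :
    ∃ (P : Program) (e : Expr) (p : Polynomial ℕ), ∀ (S : ℕ) (s : σ) (r : Option β) (N : ℕ),
      Search step S s r N → ∃ t, t ≤ N * p.eval S ∧ Eval P [Enc.enc s] e (Enc.enc r) t := by
  obtain ⟨P, e, p, hstep⟩ := h
  set body := searchBody P.length e with hbody
  have hstep := hstep.append_right [body]
  have hP : (P ++ [body])[P.length]? = Option.some body := by simp
  -- Each visited state is charged with one evaluation of `step` and at most 30 steps for taking its
  -- value apart and making the recursive calls.
  refine ⟨P ++ [body], body, p + 30, fun S s r N hr => ?_⟩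
  have key : ∀ {s : σ}, sz s ≤ S → ∃ t, t ≤ p.eval S ∧
      Eval (P ++ [body]) [Enc.enc s] e (Enc.enc (step s)) t := fun {s} hs => by
    obtain ⟨-, t, ht, h⟩ := hstep s
    exact ⟨t, ht.trans (polyEval_mono p hs), h⟩
  rw [Polynomial.eval_add, Polynomial.eval_ofNat]
  induction hr with
  | leaf hs h =>
    obtain ⟨t, ht, hev⟩ := key hs
    rw [h] at hev
    exact ⟨t + (1 + (1 + 1 + 1) + 1) + 1, by omega,
      .letIn hev (.caseCons (.var rfl) (.caseNil (.var rfl) (.var rfl)))⟩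
  | @left s s₁ o r b N hs h _ ih =>
    obtain ⟨t, ht, hev⟩ := key hs
    obtain ⟨t', ht', hev'⟩ := ih
    rw [h] at hev
    refine ⟨_, ?_, .letIn hev (.caseCons (.var rfl) (.caseCons (.var rfl) (.caseCons (.var rfl)
      (.letIn (.call hP (.var rfl) hev') (.caseCons (.var rfl) (.var rfl))))))⟩
    rw [Nat.add_mul]
    omega
  | @fail s s₁ r N hs h _ ih =>
    obtain ⟨t, ht, hev⟩ := key hs
    obtain ⟨t', ht', hev'⟩ := ih
    rw [h] at hev
    refine ⟨_, ?_, .letIn hev (.caseCons (.var rfl) (.caseCons (.var rfl) (.caseCons (.var rfl)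
      (.letIn (.call hP (.var rfl) hev') (.caseNil (.var rfl) (.caseNil (.var rfl) .nil))))))⟩
    rw [Nat.add_mul]
    omega
  | @right s s₁ s₂ r r' N N' hs h _ _ ih ih₂ =>
    obtain ⟨t, ht, hev⟩ := key hs
    obtain ⟨t', ht', hev'⟩ := ih
    obtain ⟨t₂, ht₂, hev₂⟩ := ih₂
    rw [h] at hev
    refine ⟨_, ?_, .letIn hev (.caseCons (.var rfl) (.caseCons (.var rfl) (.caseCons (.var rfl)
      (.letIn (.call hP (.var rfl) hev') (.caseNil (.var rfl) (.caseCons (.var rfl)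
        (.call hP (.var rfl) hev₂)))))))⟩
    rw [Nat.add_mul, Nat.add_mul]
    omega

/-- Run a polynomial time function first and another expression on its value. -/
theorem exists_program {α β : Type} [Enc α] [Enc β] {f : α → β} (hf : PolyTime f) (P : Program)
    (e : Expr) : ∃ (Q : Program) (p : Polynomial ℕ), ∀ (a : α) (v : Data) (t : ℕ),
      Eval P [Enc.enc (f a)] e v t → ∃ t', t' ≤ p.eval (sz a) + t ∧
        HaltsWith Q (Enc.enc a) v t' := by
  obtain ⟨P', e', p, hf⟩ := hf
  set R := P' ++ P.map (Expr.shift P'.length) with hR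
  set main : Expr := .letIn e' (e.shift P'.length) with hmain
  -- A program starts with function 0, so the main expression goes there and all other functions
  -- move up by one.
  refine ⟨main.shift 1 :: R.map (Expr.shift 1), p + 1, fun a v t h => ?_⟩
  obtain ⟨-, s, hs, hev⟩ := hf a
  have h₁ : Eval R [Enc.enc a] main v (s + t + 1) := by
    refine .letIn (hev.append_right _) ?_
    have := h.link P' []
    rw [List.append_nil] at this
    exact this.weaken [Enc.enc a]
  refine ⟨s + t + 1, by rw [Polynomial.eval_add, Polynomial.eval_one]; omega, main.shift 1, rfl, ?_⟩
  have := h₁.link [main.shift 1] []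
  simpa using this

/-! ## Breadth first search -/

section

variable (start : ℕ → Bool) (edge : ℕ → ℕ → Bool) (cand : List ℕ)

/-- Add a path to `v` to the list `ps` of paths (written backwards) if there is none yet but `v` is
a start vertex or the head of an edge from the end of a path in `ps`. -/
def bfsAdd (v : ℕ) (ps : List (List ℕ)) : List (List ℕ) :=
  bif ps.any fun p => p.headD 0 == v then ps
  else bif start v then [v] :: ps
  else (ps.find? fun p => edge (p.headD 0) v).elim ps fun p => (v :: p) :: ps

/-- Paths to all reachable vertices. -/
def bfs : List (List ℕ) :=
  cand.foldr (fun _ ps => cand.foldr (bfsAdd start edge) ps) []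

/-- Simple paths, written backwards, from a start vertex. -/
inductive IsTrail : List ℕ → Prop
  | single {v : ℕ} (hv : v ∈ cand) (hs : start v = true) : IsTrail [v]
  | cons {v u : ℕ} {q : List ℕ} (hv : v ∈ cand) (he : edge u v = true) (hn : v ∉ u :: q)
      (hq : IsTrail (u :: q)) : IsTrail (v :: u :: q)

variable {start edge cand}

theorem IsTrail.mem {p : List ℕ} (h : IsTrail start edge cand p) : ∀ v ∈ p, v ∈ cand := by
  induction h with
  | single hv _ => simpa using hv
  | cons hv _ _ _ ih =>
    intro w hw
    rcases List.mem_cons.1 hw with rfl | hw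
    · exact hv
    · exact ih w hw

theorem IsTrail.nodup {p : List ℕ} (h : IsTrail start edge cand p) : p.Nodup := by
  induction h with
  | single hv _ => simp
  | cons _ _ hn _ ih => exact List.nodup_cons.2 ⟨hn, ih⟩

theorem IsTrail.ne_nil {p : List ℕ} (h : IsTrail start edge cand p) : p ≠ [] := by
  cases h <;> simp

theorem IsTrail.imp {p : List ℕ} (h : IsTrail start edge cand p) {start' : ℕ → Bool}
    {edge' : ℕ → ℕ → Bool} (hs : ∀ v ∈ p, start v = true → start' v = true)
    (he : ∀ u ∈ p, ∀ v ∈ p, edge u v = true → edge' u v = true) :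
    IsTrail start' edge' cand p := by
  induction h with
  | single hv h => exact .single hv (hs _ (by simp) h)
  | cons hv h hn _ ih =>
    refine .cons hv (he _ (by simp) _ (by simp) h) hn (ih (fun v hv => hs v ?_)
      fun u hu v hv => he u ?_ v ?_)
    all_goals exact List.mem_cons_of_mem _ ‹_›

theorem bfsAdd_cases (v : ℕ) (ps : List (List ℕ)) :
    (bfsAdd start edge v ps = ps ∧ (v ∈ ps.map (·.headD 0) ∨
      start v = false ∧ ∀ p ∈ ps, edge (p.headD 0) v = false)) ∨
    v ∉ ps.map (·.headD 0) ∧ (start v = true ∧ bfsAdd start edge v ps = [v] :: ps ∨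
      ∃ p ∈ ps, edge (p.headD 0) v = true ∧ bfsAdd start edge v ps = (v :: p) :: ps) := by
  unfold bfsAdd
  have hmem : (ps.any fun p => p.headD 0 == v) = true ↔ v ∈ ps.map (·.headD 0) := by
    simp
  cases h : ps.any fun p => p.headD 0 == v with
  | true => exact .inl ⟨rfl, .inl (hmem.1 h)⟩
  | false =>
    have hn : v ∉ ps.map (·.headD 0) := fun h' => by rw [hmem.2 h'] at h; simp at h
    cases hs : start v with
    | true => exact .inr ⟨hn, .inl ⟨rfl, rfl⟩⟩
    | false =>
      cases hf : ps.find? fun p => edge (p.headD 0) v with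
      | none => exact .inl ⟨rfl, .inr ⟨rfl, by simpa using List.find?_eq_none.1 hf⟩⟩
      | some p =>
        exact .inr ⟨hn, .inr ⟨p, List.mem_of_find?_eq_some hf, List.find?_some (p := fun p : List ℕ => edge (p.headD 0) v) hf, rfl⟩⟩

theorem bfsAdd_suffix (v : ℕ) (ps : List (List ℕ)) : ps <:+ bfsAdd start edge v ps := by
  rcases bfsAdd_cases (start := start) (edge := edge) v ps with
    ⟨h, -⟩ | ⟨-, ⟨-, h⟩ | ⟨p, -, -, h⟩⟩ <;> rw [h]
  all_goals exact List.suffix_cons _ _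

theorem foldr_bfsAdd_suffix (l : List ℕ) (ps : List (List ℕ)) :
    ps <:+ l.foldr (bfsAdd start edge) ps := by
  induction l with
  | nil => exact List.suffix_refl _
  | cons v l ih => exact ih.trans (bfsAdd_suffix _ _)

/-- The invariant of breadth first search. -/
structure BfsInv (start : ℕ → Bool) (edge : ℕ → ℕ → Bool) (cand : List ℕ)
    (ps : List (List ℕ)) : Prop where
  trail : ∀ p ∈ ps, IsTrail start edge cand p
  mem : ∀ p ∈ ps, ∀ v ∈ p, v ∈ ps.map (·.headD 0)
  nodup : (ps.map (·.headD 0)).Nodup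

theorem BfsInv.add {ps : List (List ℕ)} (h : BfsInv start edge cand ps) {v : ℕ} (hv : v ∈ cand) :
    BfsInv start edge cand (bfsAdd start edge v ps) := by
  rcases bfsAdd_cases (start := start) (edge := edge) v ps with
    ⟨h', -⟩ | ⟨hn, ⟨hs, h'⟩ | ⟨p, hp, he, h'⟩⟩ <;> rw [h']
  · exact h
  · refine ⟨?_, ?_, List.nodup_cons.2 ⟨hn, h.nodup⟩⟩
    · intro p hp
      rcases List.mem_cons.1 hp with rfl | hp
      · exact .single hv hs
      · exact h.trail p hp
    · intro p hp w hw
      rcases List.mem_cons.1 hp with rfl | hp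
      · simp at hw
        simp [hw]
      · exact List.mem_cons_of_mem _ (h.mem p hp w hw)
  · refine ⟨?_, ?_, List.nodup_cons.2 ⟨hn, h.nodup⟩⟩
    · intro q hq
      rcases List.mem_cons.1 hq with rfl | hq
      -- All vertices of old paths are ends of old paths by the invariant, and `v` is not. Hence the
      -- prolonged path is again simple.
      · have hvp : v ∉ p := fun hvp => hn (h.mem p hp v hvp)
        have ht := h.trail p hp
        cases p with
        | nil => exact absurd rfl ht.ne_nil
        | cons u q => exact .cons hv he hvp ht
      · exact h.trail q hq
    · intro q hq w hw
      rcases List.mem_cons.1 hq with rfl | hq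
      · rcases List.mem_cons.1 hw with rfl | hw
        · simp
        · exact List.mem_cons_of_mem _ (h.mem p hp w hw)
      · exact List.mem_cons_of_mem _ (h.mem q hq w hw)

theorem BfsInv.foldr {ps : List (List ℕ)} (h : BfsInv start edge cand ps) {l : List ℕ}
    (hl : ∀ v ∈ l, v ∈ cand) : BfsInv start edge cand (l.foldr (bfsAdd start edge) ps) := by
  induction l with
  | nil => exact h
  | cons v l ih =>
    exact (ih fun v hv => hl v (List.mem_cons_of_mem _ hv)).add (hl v List.mem_cons_self)

/-- Paths are only ever added in front, so a round that ends with the same list never changed it in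
between. -/
theorem bfsAdd_eq_of_foldr_eq {ps : List (List ℕ)} {l : List ℕ}
    (h : l.foldr (bfsAdd start edge) ps = ps) : ∀ v ∈ l, bfsAdd start edge v ps = ps := by
  induction l with
  | nil => simp
  | cons v l ih =>
    have h₁ := foldr_bfsAdd_suffix (start := start) (edge := edge) l ps
    have h₂ := bfsAdd_suffix (start := start) (edge := edge) v (l.foldr (bfsAdd start edge) ps)
    rw [List.foldr_cons] at h
    rw [h] at h₂
    have h₃ : l.foldr (bfsAdd start edge) ps = ps :=
      (h₁.eq_of_length (le_antisymm h₁.length_le h₂.length_le)).symm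
    intro w hw
    rcases List.mem_cons.1 hw with rfl | hw
    · rwa [h₃] at h
    · exact ih h₃ w hw

/-- A round either finds a new path or has reached a fixed point, which all further rounds keep. So
without a fixed point there are at least as many paths as rounds. -/
theorem bfs_rounds (l : List ℕ) :
    BfsInv start edge cand (l.foldr (fun _ ps => cand.foldr (bfsAdd start edge) ps) []) ∧
    (l.length ≤ (l.foldr (fun _ ps => cand.foldr (bfsAdd start edge) ps) []).length ∨
      ∀ v ∈ cand, bfsAdd start edge v
        (l.foldr (fun _ ps => cand.foldr (bfsAdd start edge) ps) []) =
          l.foldr (fun _ ps => cand.foldr (bfsAdd start edge) ps) []) := by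
  induction l with
  | nil => exact ⟨⟨by simp, by simp, by simp⟩, .inl le_rfl⟩
  | cons a l ih =>
    obtain ⟨h₁, h₂⟩ := ih
    rw [List.foldr_cons]
    set ps := l.foldr (fun _ ps => cand.foldr (bfsAdd start edge) ps) []
    refine ⟨h₁.foldr fun _ h => h, ?_⟩
    have hs := foldr_bfsAdd_suffix (start := start) (edge := edge) cand ps
    rcases hs.length_le.eq_or_lt with he | he
    · rw [← hs.eq_of_length he]
      exact .inr (bfsAdd_eq_of_foldr_eq (hs.eq_of_length he).symm)
    · rcases h₂ with h₂ | h₂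
      · left
        rw [List.length_cons]
        omega
      · have : ∀ l' : List ℕ, (∀ v ∈ l', v ∈ cand) → l'.foldr (bfsAdd start edge) ps = ps := by
          intro l' hl'
          induction l' with
          | nil => rfl
          | cons v l' ih' =>
            rw [List.foldr_cons, ih' fun v hv => hl' v (List.mem_cons_of_mem _ hv)]
            exact h₂ v (hl' v List.mem_cons_self)
        rw [this cand fun _ h => h] at he
        omega

theorem bfs_trail {p : List ℕ} (hp : p ∈ bfs start edge cand) : IsTrail start edge cand p :=
  (bfs_rounds cand).1.trail p hp

/-- There are as many rounds as candidates. If no fixed point is certified, there are at least that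
many paths; their ends are distinct candidates, so every candidate is reached. At a fixed point
closedness is what it means that nothing can be added. -/
theorem bfs_closed :
    (∀ v ∈ cand, start v = true → v ∈ (bfs start edge cand).map (·.headD 0)) ∧
    ∀ u ∈ (bfs start edge cand).map (·.headD 0), ∀ v ∈ cand, edge u v = true →
      v ∈ (bfs start edge cand).map (·.headD 0) := by
  obtain ⟨h₁, h₂⟩ := bfs_rounds (start := start) (edge := edge) (cand := cand) cand
  change BfsInv start edge cand (bfs start edge cand) at h₁
  change cand.length ≤ (bfs start edge cand).length ∨
    ∀ v ∈ cand, bfsAdd start edge v (bfs start edge cand) = bfs start edge cand at h₂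
  rcases h₂ with h₂ | h₂
  · suffices H : ∀ v ∈ cand, v ∈ (bfs start edge cand).map (·.headD 0) from
      ⟨fun v hv _ => H v hv, fun _ _ v hv _ => H v hv⟩
    have hsub : ((bfs start edge cand).map (·.headD 0)).toFinset ⊆ cand.toFinset := by
      intro v hv
      rw [List.mem_toFinset] at hv ⊢
      obtain ⟨p, hp, rfl⟩ := List.mem_map.1 hv
      have ht := h₁.trail p hp
      cases p with
      | nil => exact absurd rfl ht.ne_nil
      | cons u q => exact ht.mem u List.mem_cons_self
    have hcard : cand.toFinset.card ≤ ((bfs start edge cand).map (·.headD 0)).toFinset.card := by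
      rw [List.toFinset_card_of_nodup h₁.nodup, List.length_map]
      exact (List.toFinset_card_le _).trans h₂
    intro v hv
    have := Finset.eq_of_subset_of_card_le hsub hcard
    rw [← List.mem_toFinset, this, List.mem_toFinset]
    exact hv
  · have key : ∀ v ∈ cand, v ∈ (bfs start edge cand).map (·.headD 0) ∨ start v = false ∧
        ∀ p ∈ bfs start edge cand, edge (p.headD 0) v = false := by
      intro v hv
      rcases bfsAdd_cases (start := start) (edge := edge) v (bfs start edge cand) with
        ⟨-, h⟩ | ⟨-, ⟨-, h⟩ | ⟨p, -, -, h⟩⟩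
      · exact h
      all_goals
        rw [h₂ v hv] at h
        have := congrArg List.length h
        simp at this
    refine ⟨fun v hv hs => ?_, fun u hu v hv he => ?_⟩
    · rcases key v hv with h | ⟨h, -⟩
      · exact h
      · rw [h] at hs
        simp at hs
    · rcases key v hv with h | ⟨-, h⟩
      · exact h
      · obtain ⟨p, hp, rfl⟩ := List.mem_map.1 hu
        rw [h p hp] at he
        simp at he

/-! ### Size bounds for breadth first search -/

theorem length_foldr_bfsAdd_le (l : List ℕ) (ps : List (List ℕ)) :
    (l.foldr (bfsAdd start edge) ps).length ≤ ps.length + l.length := by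
  induction l with
  | nil => simp
  | cons v l ih =>
    rw [List.foldr_cons, List.length_cons]
    set qs := l.foldr (bfsAdd start edge) ps
    rcases bfsAdd_cases (start := start) (edge := edge) v qs with
      ⟨h', -⟩ | ⟨-, ⟨-, h'⟩ | ⟨p, -, -, h'⟩⟩ <;> rw [h']
    · omega
    all_goals
      rw [List.length_cons]
      omega

/-- A new path is an old one with one vertex of `l` in front, so during a round the size of a path
grows by at most the total size of `l`. -/
theorem sz_foldr_bfsAdd_le (l : List ℕ) {ps : List (List ℕ)} {B : ℕ} (hB : ∀ p ∈ ps, sz p ≤ B) :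
    ∀ p ∈ l.foldr (bfsAdd start edge) ps, sz p ≤ B + sz l := by
  induction l with
  | nil => exact fun p hp => (hB p hp).trans (Nat.le_add_right _ _)
  | cons v l ih =>
    rw [List.foldr_cons, sz_cons]
    set qs := l.foldr (bfsAdd start edge) ps
    have hl := sz_pos l
    have hq : ∀ p ∈ qs, sz p ≤ B + (sz v + sz l + 1) := fun p hp => (ih p hp).trans (by omega)
    rcases bfsAdd_cases (start := start) (edge := edge) v qs with
      ⟨h', -⟩ | ⟨-, ⟨-, h'⟩ | ⟨p, hp, -, h'⟩⟩ <;> rw [h']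
    · exact hq
    · refine List.forall_mem_cons.2 ⟨?_, hq⟩
      rw [sz_cons, sz_nil]
      omega
    · refine List.forall_mem_cons.2 ⟨?_, hq⟩
      have := ih p hp
      rw [sz_cons]
      omega

theorem bfs_rounds_bound (l : List ℕ) :
    (l.foldr (fun _ ps => cand.foldr (bfsAdd start edge) ps) []).length ≤
      l.length * cand.length ∧
    ∀ p ∈ l.foldr (fun _ ps => cand.foldr (bfsAdd start edge) ps) [], sz p ≤
      l.length * sz cand := by
  induction l with
  | nil => simp
  | cons a l ih =>
    rw [List.foldr_cons, List.length_cons, Nat.succ_mul, Nat.succ_mul]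
    exact ⟨(length_foldr_bfsAdd_le _ _).trans (Nat.add_le_add_right ih.1 _),
      sz_foldr_bfsAdd_le _ ih.2⟩

end

theorem PolyTime.headD {γ : Type} [Enc γ] {l : γ → List ℕ} (hl : PolyTime l) :
    PolyTime fun c => (l c).headD 0 :=
  (hl.head?.optionElim (.const 0) .snd).congr_enc fun c => by cases l c <;> rfl

theorem PolyTime.bfs {γ : Type} [Enc γ] {start : γ → ℕ → Bool} {edge : γ → ℕ → ℕ → Bool}
    {cand : γ → List ℕ} (hs : PolyTime fun x : γ × ℕ => start x.1 x.2)
    (he : PolyTime fun x : γ × ℕ × ℕ => edge x.1 x.2.1 x.2.2) (hc : PolyTime cand) :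
    PolyTime fun c => bfs (start c) (edge c) (cand c) := by
  have hadd : PolyTime fun x : (γ × List (List ℕ)) × ℕ × List (List ℕ) =>
      bfsAdd (start x.1.1) (edge x.1.1) x.2.1 x.2.2 := by
    have hv : PolyTime fun x : (γ × List (List ℕ)) × ℕ × List (List ℕ) => x.2.1 :=
      .comp .fst .snd
    have hps : PolyTime fun x : (γ × List (List ℕ)) × ℕ × List (List ℕ) => x.2.2 :=
      .comp .snd .snd
    have hg : PolyTime fun x : (γ × List (List ℕ)) × ℕ × List (List ℕ) => x.1.1 :=
      .comp .fst .fst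
    exact .cond (.any hps (.beqNat (.headD .snd) (hv.comp .fst))) hps
      (.cond (hs.comp (hg.pair hv)) (.cons (.cons hv (.const [])) hps)
        (.optionElim
          (.find? hps (he.comp (.pair (hg.comp .fst) (.pair (.headD .snd) (hv.comp .fst))))) hps
          (.cons (.cons (hv.comp .fst) .snd) (hps.comp .fst))))
  have hround : PolyTime fun x : γ × List (List ℕ) =>
      (cand x.1).foldr (bfsAdd (start x.1) (edge x.1)) x.2 := by
    refine PolyTime.foldr (f := fun x => bfsAdd (start x.1) (edge x.1)) (hc.comp .fst) .snd hadd ?_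
    refine PolyBounded.list (s := sz) (t := sz) .sz_self .sz_self (fun x => ?_) fun x p hp => ?_
    · refine (length_foldr_bfsAdd_le _ _).trans ?_
      have h₁ := length_lt_sz x.1.2
      have h₂ := length_lt_sz x.2
      rw [sz_prod, sz_prod]
      omega
    · refine (sz_foldr_bfsAdd_le _ (fun p hp => sz_le_of_mem hp) p hp).trans ?_
      rw [sz_prod, sz_prod]
      omega
  refine PolyTime.foldr (f := fun c _ ps => (cand c).foldr (bfsAdd (start c) (edge c)) ps) hc
    (.const []) (hround.comp (.pair .fst (.comp .snd .snd))) ?_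
  have hcb := hc.polyBounded.comp (f := Prod.fst) (α := γ × List ℕ) PolyTime.fst.polyBounded
  refine PolyBounded.list (s := fun x => sz x * sz (cand x.1)) (t := fun x => sz x * sz (cand x.1))
    (.mul .sz_self hcb) (.mul .sz_self hcb) (fun x => ?_) fun x p hp => ?_
  · refine (bfs_rounds_bound _).1.trans ?_
    have h₁ := length_lt_sz x.2
    have h₂ := length_lt_sz (cand x.1)
    refine Nat.mul_le_mul ?_ h₂.le
    rw [sz_prod]
    omega
  · refine ((bfs_rounds_bound _).2 p hp).trans ?_
    have h₁ := length_lt_sz x.2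
    refine Nat.mul_le_mul_right _ ?_
    rw [sz_prod]
    omega

/-! ## Maximum matchings in bipartite graphs -/

section

variable (nb : ℕ → ℕ → Bool) (L R : List ℕ) (M : List (ℕ × ℕ))

/-- `u` is not matched on the left. -/
def unmatched (u : ℕ) : Bool := !M.any fun e => e.1 == u

/-- `v` is not matched on the right. -/
def isFree (v : ℕ) : Bool := !M.any fun e => e.2 == v

/-- `u` is adjacent to the partner of `u'`. -/
def altEdge (u u' : ℕ) : Bool := M.any fun e => e.1 == u' && nb u e.2

/-- The alternating path `p` can be continued to the free vertex `v`. -/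
def canEnd (p : List ℕ) (v : ℕ) : Bool := nb (p.headD 0) v && isFree M v

/-- Match `u` with the vertex that has become free, and free the old partner of `u`. -/
def reassign (x : List (ℕ × ℕ) × Option ℕ) (u : ℕ) : List (ℕ × ℕ) × Option ℕ :=
  x.2.elim x fun v => ((u, v) :: x.1.filter fun e => !(e.1 == u),
    (x.1.find? fun e => e.1 == u).elim none fun e => some e.2)

/-- The alternating paths from unmatched vertices. -/
def altPaths : List (List ℕ) := bfs (unmatched M) (altEdge nb M) L

/-- Increase a matching by means of an augmenting path, if there is one. -/
def augment : List (ℕ × ℕ) :=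
  ((altPaths nb L M).find? fun p => R.any (canEnd nb M p)).elim M fun p =>
    (p.foldl reassign (M, R.find? (canEnd nb M p))).1

/-- A matching of maximum size. -/
def maxMatching : List (ℕ × ℕ) := L.foldr (fun _ M => augment nb L R M) []

/-- `M` is a matching between `L` and `R`. -/
structure IsMatching : Prop where
  nodup_fst : (M.map Prod.fst).Nodup
  nodup_snd : (M.map Prod.snd).Nodup
  mem_left : ∀ e ∈ M, e.1 ∈ L
  mem_right : ∀ e ∈ M, e.2 ∈ R
  adj : ∀ e ∈ M, nb e.1 e.2 = true

variable {nb L R M}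

theorem unmatched_iff {u : ℕ} : unmatched M u = true ↔ ∀ v, (u, v) ∉ M := by
  simp only [unmatched, Bool.not_eq_true', List.any_eq_false, beq_iff_eq]
  exact ⟨fun h v hv => h _ hv rfl, fun h e he h' => h e.2 (by rw [← h']; exact he)⟩

theorem isFree_iff {v : ℕ} : isFree M v = true ↔ ∀ u, (u, v) ∉ M := by
  simp only [isFree, Bool.not_eq_true', List.any_eq_false, beq_iff_eq]
  exact ⟨fun h u hu => h _ hu rfl, fun h e he h' => h e.1 (by rw [← h']; exact he)⟩

theorem altEdge_iff {u u' : ℕ} : altEdge nb M u u' = true ↔ ∃ v, (u', v) ∈ M ∧ nb u v = true := by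
  simp only [altEdge, List.any_eq_true, Bool.and_eq_true, beq_iff_eq]
  constructor
  · rintro ⟨⟨a, b⟩, he, rfl, h⟩
    exact ⟨b, he, h⟩
  · rintro ⟨v, he, h⟩
    exact ⟨(u', v), he, rfl, h⟩

theorem IsMatching.eq_of_fst (h : IsMatching nb L R M) {u v v' : ℕ} (h₁ : (u, v) ∈ M)
    (h₂ : (u, v') ∈ M) : v = v' :=
  congrArg Prod.snd (List.inj_on_of_nodup_map h.nodup_fst h₁ h₂ rfl)

theorem IsMatching.eq_of_snd (h : IsMatching nb L R M) {u u' v : ℕ} (h₁ : (u, v) ∈ M)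
    (h₂ : (u', v) ∈ M) : u = u' :=
  congrArg Prod.fst (List.inj_on_of_nodup_map h.nodup_snd h₁ h₂ rfl)

theorem length_filter_fst (hM : (M.map Prod.fst).Nodup) {u v : ℕ} (h : (u, v) ∈ M) :
    (M.filter fun e => !(e.1 == u)).length + 1 = M.length := by
  induction M with
  | nil => simp at h
  | cons e M ih =>
    rw [List.map_cons, List.nodup_cons] at hM
    rcases List.mem_cons.1 h with rfl | h
    · have : (M.filter fun e => !(e.1 == u)) = M := by
        rw [List.filter_eq_self]
        intro e he
        have : e.1 ≠ u := fun h =>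
          hM.1 (List.mem_map.2 ⟨e, he, h⟩)
        simpa using this
      rw [List.filter_cons_of_neg (by simp), this, List.length_cons]
    · have hne : e.1 ≠ u := fun h' => hM.1 (h' ▸ List.mem_map_of_mem (f := Prod.fst) h)
      rw [List.filter_cons_of_pos (by simpa using hne), List.length_cons, ih hM.2 h,
        List.length_cons]

theorem IsMatching.reassign (h : IsMatching nb L R M) {u v : ℕ} (hu : u ∈ L) (hv : v ∈ R)
    (hf : ∀ w, (w, v) ∉ M) (ha : nb u v = true) :
    IsMatching nb L R ((u, v) :: M.filter fun e => !(e.1 == u)) := by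
  have hsub : (M.filter fun e => !(e.1 == u)).Sublist M := List.filter_sublist
  refine ⟨List.nodup_cons.2 ⟨?_, (hsub.map _).nodup h.nodup_fst⟩,
    List.nodup_cons.2 ⟨?_, (hsub.map _).nodup h.nodup_snd⟩,
    List.forall_mem_cons.2 ⟨hu, fun e he => h.mem_left e (hsub.subset he)⟩,
    List.forall_mem_cons.2 ⟨hv, fun e he => h.mem_right e (hsub.subset he)⟩,
    List.forall_mem_cons.2 ⟨ha, fun e he => h.adj e (hsub.subset he)⟩⟩
  · intro h'
    obtain ⟨e, he, he'⟩ := List.mem_map.1 h'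
    have := (List.mem_filter.1 he).2
    simp [he'] at this
  · intro h'
    obtain ⟨⟨a, b⟩, he, he'⟩ := List.mem_map.1 h'
    change b = v at he'
    subst he'
    exact hf a (hsub.subset he)

theorem mem_reassign {u v a b : ℕ} (ha : a ≠ u) :
    (a, b) ∈ (u, v) :: M.filter (fun e => !(e.1 == u)) ↔ (a, b) ∈ M := by
  simp [ha]

/-- Augmenting along an alternating path that ends in a free vertex. -/
theorem IsMatching.foldl_reassign {p : List ℕ} :
    ∀ {M : List (ℕ × ℕ)} {v : ℕ}, IsMatching nb L R M →
      IsTrail (unmatched M) (altEdge nb M) L p → v ∈ R → (∀ w, (w, v) ∉ M) →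
      nb (p.headD 0) v = true →
      IsMatching nb L R (p.foldl OrdMC.reassign (M, some v)).1 ∧
        (p.foldl OrdMC.reassign (M, some v)).1.length = M.length + 1 := by
  induction p with
  | nil => exact fun _ h => absurd rfl h.ne_nil
  | cons u q ih =>
    intro M v hM hp hv hf ha
    have hu : u ∈ L := hp.mem u List.mem_cons_self
    have hM' := hM.reassign hu hv hf ha
    set M' := (u, v) :: M.filter fun e => !(e.1 == u) with hM'_def
    rw [List.foldl_cons]
    cases hp with
    | single _ hs =>
      have hs := unmatched_iff.1 hs
      have hn : (M.find? fun e => e.1 == u) = none := by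
        rw [List.find?_eq_none]
        intro e he h
        exact hs e.2 (by rw [← beq_iff_eq.1 h]; exact he)
      have hr : OrdMC.reassign (M, some v) u = (M', none) := by
        simp [OrdMC.reassign, hn, hM'_def]
      rw [hr]
      refine ⟨hM', ?_⟩
      change M'.length = _
      rw [hM'_def, List.length_cons, List.filter_eq_self.2]
      intro e he
      have : e.1 ≠ u := fun h => hs e.2 (by rw [← h]; exact he)
      simpa using this
    | @cons _ u' q _ he hn hq =>
      obtain ⟨w, hw, hw'⟩ := altEdge_iff.1 he
      have hfind : (M.find? fun e => e.1 == u) = some (u, w) := by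
        cases h : M.find? fun e => e.1 == u with
        | none => exact absurd (beq_self_eq_true u) (List.find?_eq_none.1 h (u, w) hw)
        | some e =>
          have h₁ := List.mem_of_find?_eq_some h
          have h₂ : e.1 = u := by simpa using List.find?_some h
          obtain ⟨a, b⟩ := e
          change a = u at h₂
          subst h₂
          rw [hM.eq_of_fst h₁ hw]
      have hr : OrdMC.reassign (M, some v) u = (M', some w) := by
        simp [OrdMC.reassign, hfind, hM'_def]
      rw [hr]
      -- The trail is simple, so the remaining vertices differ from `u`. Their matching edges are
      -- the same in `M'` as in `M`, and the rest of the trail stays alternating for `M'`.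
      have hne : ∀ a ∈ u' :: q, a ≠ u := fun a ha h => hn (h ▸ ha)
      have hlen : M'.length = M.length := by
        rw [hM'_def, List.length_cons, length_filter_fst hM.nodup_fst hw]
      rw [← hlen]
      refine ih hM' (hq.imp (fun a ha h => ?_) fun a ha b hb h => ?_) (hM.mem_right _ hw) ?_ hw'
      · rw [unmatched_iff] at h ⊢
        exact fun b hb => h b ((mem_reassign (hne a ha)).1 hb)
      · rw [altEdge_iff] at h ⊢
        obtain ⟨c, hc, hc'⟩ := h
        exact ⟨c, (mem_reassign (hne b hb)).2 hc, hc'⟩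
      -- The released vertex `w` is free in `M'`: its only edge in `M` came from `u`, and `u` is now
      -- matched with `v`, which differs from `w` because `v` was free.
      · intro a ha
        by_cases hau : a = u
        · subst hau
          rw [hM'.eq_of_fst ha List.mem_cons_self] at hw
          exact hf _ hw
        · exact hau (hM.eq_of_snd ((mem_reassign hau).1 ha) hw)

theorem augment_cases (h : IsMatching nb L R M) :
    (IsMatching nb L R (augment nb L R M) ∧ (augment nb L R M).length = M.length + 1) ∨
    augment nb L R M = M ∧ ∀ p ∈ altPaths nb L M, ∀ v ∈ R, nb (p.headD 0) v = true →
      ∃ u, (u, v) ∈ M := by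
  unfold augment
  cases hp : (altPaths nb L M).find? fun p => R.any (canEnd nb M p) with
  | none =>
    refine .inr ⟨rfl, fun p hp' v hv ha => ?_⟩
    have h₁ := List.find?_eq_none.1 hp p hp'
    by_contra! h₂
    exact h₁ (List.any_eq_true.2 ⟨v, hv, by rw [canEnd, ha, isFree_iff.2 h₂]; rfl⟩)
  | some p =>
    refine .inl ?_
    have h₁ := List.mem_of_find?_eq_some hp
    have h₂ := List.find?_some hp
    cases hv : R.find? (canEnd nb M p) with
    | none =>
      obtain ⟨v, hv', hv''⟩ := List.any_eq_true.1 h₂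
      exact absurd hv'' (List.find?_eq_none.1 hv v hv')
    | some v =>
      have h₃ := List.find?_some hv
      rw [canEnd, Bool.and_eq_true, isFree_iff] at h₃
      rw [Option.elim_some, hv]
      exact h.foldl_reassign (bfs_trail h₁) (List.mem_of_find?_eq_some hv) h₃.2 h₃.1

/-- The same dichotomy as in breadth first search: each round enlarges the matching by one edge,
unless there is no augmenting path and the matching stays as it is from then on. -/
theorem maxMatching_rounds (l : List ℕ) :
    IsMatching nb L R (l.foldr (fun _ M => augment nb L R M) []) ∧
    (l.length ≤ (l.foldr (fun _ M => augment nb L R M) []).length ∨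
      ∀ p ∈ altPaths nb L (l.foldr (fun _ M => augment nb L R M) []), ∀ v ∈ R,
        nb (p.headD 0) v = true → ∃ u, (u, v) ∈ l.foldr (fun _ M => augment nb L R M) []) := by
  induction l with
  | nil => exact ⟨⟨by simp, by simp, by simp, by simp, by simp⟩, .inl le_rfl⟩
  | cons a l ih =>
    obtain ⟨h₁, h₂⟩ := ih
    rw [List.foldr_cons]
    set M := l.foldr (fun _ M => augment nb L R M) [] with hM
    rcases augment_cases h₁ with ⟨h₃, h₄⟩ | ⟨h₃, h₄⟩
    · refine ⟨h₃, ?_⟩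
      rcases h₂ with h₂ | h₂
      · left
        rw [h₄, List.length_cons]
        omega
      · have : augment nb L R M = M := by
          unfold augment
          rw [List.find?_eq_none.2]
          · rfl
          · intro p hp h
            obtain ⟨v, hv, hv'⟩ := List.any_eq_true.1 h
            rw [canEnd, Bool.and_eq_true, isFree_iff] at hv'
            obtain ⟨u, hu⟩ := h₂ p hp v hv hv'.1
            exact hv'.2 u hu
        rw [this] at h₄
        omega
    · rw [h₃]
      exact ⟨h₁, .inr h₄⟩

/-- The matching is maximum: the set `S` witnesses this. -/
theorem maxMatching_spec (nb : ℕ → ℕ → Bool) (L R : List ℕ) :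
    IsMatching nb L R (maxMatching nb L R) ∧ ∃ S : Finset ℕ, (∀ u ∈ S, u ∈ L) ∧
      (∀ u ∈ L, (∀ v, (u, v) ∉ maxMatching nb L R) → u ∈ S) ∧
      ∀ u ∈ S, ∀ v ∈ R, nb u v = true → ∃ u' ∈ S, (u', v) ∈ maxMatching nb L R := by
  obtain ⟨h₁, h₂⟩ := maxMatching_rounds (nb := nb) (L := L) (R := R) L
  change IsMatching nb L R (maxMatching nb L R) at h₁
  change L.length ≤ (maxMatching nb L R).length ∨
    ∀ p ∈ altPaths nb L (maxMatching nb L R), ∀ v ∈ R,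
      nb (p.headD 0) v = true → ∃ u, (u, v) ∈ maxMatching nb L R at h₂
  set M := maxMatching nb L R
  refine ⟨h₁, ?_⟩
  rcases h₂ with h₂ | h₂
  -- At least as many edges as entries of `L`: every vertex of `L` is matched, and the empty set is
  -- a witness.
  · refine ⟨∅, by simp, fun u hu hu' => ?_, by simp⟩
    have hsub : (M.map Prod.fst).toFinset ⊆ L.toFinset := fun u hu => by
      rw [List.mem_toFinset] at hu ⊢
      obtain ⟨e, he, rfl⟩ := List.mem_map.1 hu
      exact h₁.mem_left e he
    have := Finset.eq_of_subset_of_card_le hsub (by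
      rw [List.toFinset_card_of_nodup h₁.nodup_fst, List.length_map]
      exact (List.toFinset_card_le _).trans h₂)
    rw [← List.mem_toFinset, ← this, List.mem_toFinset] at hu
    obtain ⟨e, he, rfl⟩ := List.mem_map.1 hu
    exact absurd he (hu' e.2)
  · have hb := bfs_closed (start := unmatched M) (edge := altEdge nb M) (cand := L)
    -- The witness consists of the vertices on the left that alternating paths reach from unmatched
    -- ones. As no path ends next to a free vertex, every neighbour is matched, and its partner is
    -- reached as well.
    refine ⟨((altPaths nb L M).map (·.headD 0)).toFinset, fun u hu => ?_, fun u hu hu' => ?_,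
      fun u hu v hv ha => ?_⟩
    · obtain ⟨p, hp, rfl⟩ := List.mem_map.1 (List.mem_toFinset.1 hu)
      have ht := bfs_trail hp
      cases p with
      | nil => exact absurd rfl ht.ne_nil
      | cons u q => exact ht.mem u List.mem_cons_self
    · exact List.mem_toFinset.2 (hb.1 u hu (unmatched_iff.2 hu'))
    · rw [List.mem_toFinset] at hu
      obtain ⟨p, hp, rfl⟩ := List.mem_map.1 hu
      obtain ⟨u', hu'⟩ := h₂ p hp v hv ha
      exact ⟨u', List.mem_toFinset.2 (hb.2 _ hu u' (h₁.mem_left _ hu')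
        (altEdge_iff.2 ⟨v, hu', ha⟩)), hu'⟩

/-- Reassignment only recombines numbers that are already present, and each vertex of the path adds
at most one edge. -/
theorem foldl_reassign_bound {B : ℕ} (p : List ℕ) : ∀ (M : List (ℕ × ℕ)) (o : Option ℕ),
    (∀ e ∈ M, sz e.1 ≤ B ∧ sz e.2 ≤ B) → (∀ v ∈ o, sz v ≤ B) → (∀ u ∈ p, sz u ≤ B) →
    (∀ e ∈ (p.foldl reassign (M, o)).1, sz e.1 ≤ B ∧ sz e.2 ≤ B) ∧
    (∀ v ∈ (p.foldl reassign (M, o)).2, sz v ≤ B) ∧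
    (p.foldl reassign (M, o)).1.length ≤ M.length + p.length := by
  induction p with
  | nil => exact fun M o h₁ h₂ _ => ⟨h₁, h₂, by simp⟩
  | cons u p ih =>
    intro M o h₁ h₂ h₃
    rw [List.foldl_cons, List.length_cons]
    have h₄ : ∀ u ∈ p, sz u ≤ B := fun w hw => h₃ w (List.mem_cons_of_mem _ hw)
    cases o with
    | none =>
      obtain ⟨h₅, h₆, h₇⟩ := ih M none h₁ h₂ h₄
      exact ⟨h₅, h₆, h₇.trans (by omega)⟩
    | some v =>
      obtain ⟨h₅, h₆, h₇⟩ := ih ((u, v) :: M.filter fun e => !(e.1 == u))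
        ((M.find? fun e => e.1 == u).elim none fun e => some e.2)
        (List.forall_mem_cons.2 ⟨⟨h₃ u List.mem_cons_self, h₂ v rfl⟩,
          fun e he => h₁ e (List.mem_filter.1 he).1⟩) (fun w hw => by
            cases h : M.find? fun e => e.1 == u with
            | none => rw [h] at hw; simp at hw
            | some e =>
              rw [h] at hw
              simp only [Option.elim_some, Option.mem_def, Option.some.injEq] at hw
              rw [← hw]
              exact (h₁ e (List.mem_of_find?_eq_some h)).2) h₄
      refine ⟨h₅, h₆, h₇.trans ?_⟩
      have := List.length_filter_le (fun e : ℕ × ℕ => !(e.1 == u)) M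
      rw [List.length_cons]
      omega

theorem maxMatching_rounds_bound (l : List ℕ) :
    (l.foldr (fun _ M => augment nb L R M) []).length ≤ l.length * L.length ∧
    ∀ e ∈ l.foldr (fun _ M => augment nb L R M) [], sz e.1 ≤ sz L + sz R ∧
      sz e.2 ≤ sz L + sz R := by
  induction l with
  | nil => simp
  | cons a l ih =>
    rw [List.foldr_cons, List.length_cons, Nat.succ_mul]
    set M := l.foldr (fun _ M => augment nb L R M) []
    unfold augment
    cases hp : (altPaths nb L M).find? fun p => R.any (canEnd nb M p) with
    | none => exact ⟨ih.1.trans (Nat.le_add_right _ _), ih.2⟩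
    | some p =>
      have ht := bfs_trail (List.mem_of_find?_eq_some hp)
      obtain ⟨h₁, -, h₂⟩ := foldl_reassign_bound (B := sz L + sz R) p M
        (R.find? (canEnd nb M p)) ih.2
        (fun v hv => (sz_le_of_mem (List.mem_of_find?_eq_some hv)).trans (Nat.le_add_left _ _))
        (fun u hu => (sz_le_of_mem (ht.mem u hu)).trans (Nat.le_add_right _ _))
      refine ⟨h₂.trans (Nat.add_le_add ih.1 ?_), h₁⟩
      rw [← List.toFinset_card_of_nodup ht.nodup]
      refine (Finset.card_le_card fun u hu => ?_).trans (List.toFinset_card_le L)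
      rw [List.mem_toFinset] at hu ⊢
      exact ht.mem u hu

end

theorem PolyTime.foldl_reassign {γ : Type} [Enc γ] {p : γ → List ℕ} {M : γ → List (ℕ × ℕ)}
    {o : γ → Option ℕ} (hp : PolyTime p) (hM : PolyTime M) (ho : PolyTime o) :
    PolyTime fun c => (p c).foldl reassign (M c, o c) := by
  refine PolyTime.foldl (f := fun _ => reassign) hp (hM.pair ho) ?_ ?_
  · have hu : PolyTime fun x : (γ × (List (ℕ × ℕ) × Option ℕ) × ℕ) × ℕ × ℕ =>
        x.2.1 == x.1.2.2 := .beqNat (.comp .fst .snd) (.comp .snd (.comp .snd .fst))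
    exact .optionElim (.comp .snd (.comp .fst .snd)) (.comp .fst .snd)
      (.pair (.cons (.pair (.comp .snd (.comp .snd .fst)) .snd)
        (.filter (.comp .fst (.comp .fst (.comp .snd .fst)))
          (.not (hu.comp (.pair (.comp .fst .fst) .snd)))))
        (.optionElim (.find? (.comp .fst (.comp .fst (.comp .snd .fst)))
          (hu.comp (.pair (.comp .fst .fst) .snd))) (.const none) (.some (.comp .snd .snd))))
  · have h₁ := hM.polyBounded.comp (f := Prod.fst) (α := γ × List ℕ) PolyTime.fst.polyBounded
    have h₂ := ho.polyBounded.comp (f := Prod.fst) (α := γ × List ℕ) PolyTime.fst.polyBounded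
    have hB : PolyBounded fun x : γ × List ℕ => sz (M x.1) + sz (o x.1) + sz x :=
      (h₁.add h₂).add .sz_self
    have key := fun x : γ × List ℕ =>
      foldl_reassign_bound (B := sz (M x.1) + sz (o x.1) + sz x) x.2 (M x.1) (o x.1)
        (fun e he => by
          have := sz_le_of_mem he
          rw [sz_prod] at this
          omega)
        (fun v hv => by
          rw [Option.mem_def.1 hv, sz_some]
          omega)
        (fun u hu => by
          have := sz_le_of_mem hu
          rw [sz_prod x]
          omega)
    refine (((PolyBounded.list (F := fun x : γ × List ℕ => (x.2.foldl reassign (M x.1, o x.1)).1)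
      (s := fun x => sz (M x.1) + sz x)
      (t := fun x => (sz (M x.1) + sz (o x.1) + sz x) + (sz (M x.1) + sz (o x.1) + sz x) + 1)
      (h₁.add .sz_self) ((hB.add hB).add (.const 1))
      (fun x => ?_) fun x e he => ?_).add (hB.add (.const 2))).add (.const 1)).mono fun x => ?_
    · refine (key x).2.2.trans ?_
      have := length_lt_sz x.2
      have := length_lt_sz (M x.1)
      rw [sz_prod]
      omega
    · have := (key x).1 e he
      rw [sz_prod e]
      omega
    · rw [sz_prod (x.2.foldl reassign (M x.1, o x.1))]
      refine Nat.add_le_add_right (Nat.add_le_add_left ?_ _) 1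
      cases h : (x.2.foldl reassign (M x.1, o x.1)).2 with
      | none => rw [sz_none]; omega
      | some v =>
        have := (key x).2.1 v h
        rw [sz_some]
        omega

theorem PolyTime.maxMatching {γ : Type} [Enc γ] {nb : γ → ℕ → ℕ → Bool} {L R : γ → List ℕ}
    (hn : PolyTime fun x : γ × ℕ × ℕ => nb x.1 x.2.1 x.2.2) (hL : PolyTime L) (hR : PolyTime R) :
    PolyTime fun c => maxMatching (nb c) (L c) (R c) := by
  have hpaths : PolyTime fun x : γ × List (ℕ × ℕ) => altPaths (nb x.1) (L x.1) x.2 := by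
    refine PolyTime.bfs (start := fun x : γ × List (ℕ × ℕ) => unmatched x.2)
      (edge := fun x : γ × List (ℕ × ℕ) => altEdge (nb x.1) x.2) ?_ ?_ (hL.comp .fst)
    · exact .not (.any (.comp .snd .fst) (.beqNat (.comp .fst .snd) (.comp .snd .fst)))
    · exact .any (.comp .snd .fst) (.and
        (.beqNat (.comp .fst .snd) (.comp .snd (.comp .snd .fst)))
        (hn.comp (.pair (.comp .fst (.comp .fst .fst))
          (.pair (.comp .fst (.comp .snd .fst)) (.comp .snd .snd)))))
  have hend : PolyTime fun x : (γ × List (ℕ × ℕ)) × List ℕ × ℕ =>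
      canEnd (nb x.1.1) x.1.2 x.2.1 x.2.2 :=
    .and (hn.comp (.pair (.comp .fst .fst) (.pair (.headD (.comp .fst .snd)) (.comp .snd .snd))))
      (.not (.any (.comp .snd .fst) (.beqNat (.comp .snd .snd)
        (.comp .snd (.comp .snd .fst)))))
  have haug : PolyTime fun x : γ × List (ℕ × ℕ) => augment (nb x.1) (L x.1) (R x.1) x.2 :=
    .optionElim
      (.find? hpaths (.any ((hR.comp .fst).comp .fst)
        (hend.comp (.pair (.comp .fst .fst) (.pair (.comp .snd .fst) .snd))))) .snd
      (.comp .fst (.foldl_reassign .snd (.comp .snd .fst)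
        (.find? ((hR.comp .fst).comp .fst)
          (hend.comp (.pair (.comp .fst .fst) (.pair (.comp .snd .fst) .snd))))))
  refine PolyTime.foldr (f := fun c _ M => augment (nb c) (L c) (R c) M) hL (.const [])
    (haug.comp (.pair .fst (.comp .snd .snd))) ?_
  have h₁ := hL.polyBounded.comp (f := Prod.fst) (α := γ × List ℕ) PolyTime.fst.polyBounded
  have h₂ := hR.polyBounded.comp (f := Prod.fst) (α := γ × List ℕ) PolyTime.fst.polyBounded
  refine PolyBounded.list (s := fun x => sz x * sz (L x.1))
    (t := fun x => (sz (L x.1) + sz (R x.1)) + (sz (L x.1) + sz (R x.1)) + 1)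
    (.mul .sz_self h₁) (((h₁.add h₂).add (h₁.add h₂)).add (.const 1))
    (fun x => ?_) fun x e he => ?_
  · refine (maxMatching_rounds_bound _).1.trans (Nat.mul_le_mul ?_ (length_lt_sz _).le)
    have := length_lt_sz x.2
    rw [sz_prod]
    omega
  · have := (maxMatching_rounds_bound _).2 e he
    rw [sz_prod e]
    omega

/-! ## Cuts in digraphs with deletable and undeletable vertices -/

section

variable (E : ℕ → ℕ → Prop) (D U : Finset ℕ)

/-- There is a path within `W`. -/
def Path (W : Finset ℕ) (a b : ℕ) : Prop :=
  Relation.ReflTransGen (fun u v => E u v ∧ u ∈ W ∧ v ∈ W) a b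

/-- There is a path in `D ∪ U` whose inner vertices are in `U`. -/
def Via (a b : ℕ) : Prop :=
  Relation.ReflTransGen (fun u v => E u v ∧ (u ∈ U ∨ u = a) ∧ v ∈ D ∪ U) a b

/-- `Z` is a set of deletable vertices that separates `x` from `Y`. -/
def IsCut (x : ℕ) (Y Z : Finset ℕ) : Prop :=
  Z ⊆ D ∧ ∀ y ∈ Y, ¬ Path E (U ∪ (D \ Z)) x y

open Classical in
/-- The out-neighbours of `X` outside `X`. -/
noncomputable def boundary (X : Finset ℕ) : Finset ℕ :=
  {v ∈ D ∪ U | v ∉ X ∧ ∃ u ∈ X, E u v}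

open Classical in
/-- The vertices that can be reached from `x` when `Z` is deleted. -/
noncomputable def reach (x : ℕ) (Z : Finset ℕ) : Finset ℕ :=
  {v ∈ D ∪ U | Path E (U ∪ (D \ Z)) x v}

/-- No start vertex of a pair in the list reaches the end vertex of the same or a later pair. -/
def OrdSep (W : Finset ℕ) : List (ℕ × ℕ) → Prop
  | [] => True
  | e :: l => (∀ f ∈ e :: l, ¬ Path E W e.1 f.2) ∧ OrdSep W l

variable {E D U}

theorem Path.mem {W : Finset ℕ} {a b : ℕ} (h : Path E W a b) (ha : a ∈ W) : b ∈ W := by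
  induction h with
  | refl => exact ha
  | tail _ h _ => exact h.2.2

/-- The inner vertices are undeletable, so the path survives every deletion that spares its two
ends. -/
theorem Via.path {W : Finset ℕ} {a b : ℕ} (h : Via E D U a b) (hU : U ⊆ W) (ha : a ∈ W)
    (hb : b ∈ W) : Path E W a b := by
  induction h with
  | refl => exact .refl
  | @tail p b _ h ih =>
    have hp : p ∈ W := by
      rcases h.2.1 with h | rfl
      · exact hU h
      · exact ha
    exact (ih hp).tail ⟨h.1, hp, hb⟩

/-- Only paths into sinks are compared, because exchanging one part of a solution for another may
create new paths to other vertices. -/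
theorem OrdSep.mono {W W' : Finset ℕ} {l : List (ℕ × ℕ)} (h : OrdSep E W l)
    (hW : ∀ a, ∀ f ∈ l, Path E W' a f.2 → Path E W a f.2) : OrdSep E W' l := by
  induction l with
  | nil => trivial
  | cons e l ih =>
    exact ⟨fun f hf h' => h.1 f hf (hW _ f hf h'),
      ih h.2 fun a f hf => hW a f (List.mem_cons_of_mem _ hf)⟩

/-! ### Minimum cuts and matchings -/

section

variable {x : ℕ} {Y A L R S : Finset ℕ} {M : Finset (ℕ × ℕ)}

/-- Let N be the set of neighbours of `S` in `R`. Vertices of N are matched into `S`, while the |L|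
- |M| unmatched vertices of `L` also lie in `S`; so |N| + |L| - |M| ≤ |S|. Take Z = (A \ S) ∪ (N \
S). A path from `x` that avoids Z can meet `D` only in `S`, and `S` lies in `L`, from which no sink
is reached directly. Since S \ A ⊆ N, the size of Z is at most |A| + |N| - |S| ≤ |A| + |M| - |L|. -/
theorem exists_isCut_of_matching (hDU : Disjoint D U) (hx : x ∈ U) (hY : Y ⊆ U)
    (hmeet : ∀ y ∈ Y, ¬ Via E D U x y) (hA : ∀ v, v ∈ A ↔ v ∈ D ∧ Via E D U x v)
    (hR : ∀ v, v ∈ R ↔ v ∈ D ∧ ¬ Via E D U x v)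
    (hL : ∀ v, v ∈ L ↔ v ∈ D ∧ ∀ y ∈ Y, ¬ Via E D U v y)
    (h₁ : Set.InjOn Prod.fst (M : Set (ℕ × ℕ))) (h₃ : ∀ e ∈ M, e.1 ∈ L)
    (hSL : S ⊆ L) (hS : ∀ u ∈ L, (∀ v, (u, v) ∉ M) → u ∈ S)
    (hS' : ∀ u ∈ S, ∀ v ∈ R, Via E D U u v → ∃ u' ∈ S, (u', v) ∈ M) :
    ∃ Z, IsCut E D U x Y Z ∧ Z.card + L.card ≤ A.card + M.card := by
  classical
  set un := L \ M.image Prod.fst with hun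
  have hML : M.image Prod.fst ⊆ L := by
    intro u hu
    obtain ⟨e, he, rfl⟩ := Finset.mem_image.1 hu
    exact h₃ e he
  have hunc : un.card + M.card = L.card := by
    rw [← Finset.card_image_of_injOn h₁]
    exact Finset.card_sdiff_add_card_eq_card hML
  have hunS : un ⊆ S := fun u hu => by
    rw [hun, Finset.mem_sdiff] at hu
    exact hS u hu.1 fun v hv => hu.2 (Finset.mem_image.2 ⟨_, hv, rfl⟩)
  set N : Finset ℕ := {v ∈ R | ∃ u ∈ S, Via E D U u v} with hN
  have hNc : N.card + un.card ≤ S.card := by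
    have h₅ : N ⊆ ({e ∈ M | e.1 ∈ S} : Finset (ℕ × ℕ)).image Prod.snd := fun v hv => by
      rw [hN, Finset.mem_filter] at hv
      obtain ⟨hv, u, hu, huv⟩ := hv
      obtain ⟨u', hu', h⟩ := hS' u hu v hv huv
      exact Finset.mem_image.2 ⟨(u', v), Finset.mem_filter.2 ⟨h, hu'⟩, rfl⟩
    have h₆ : ({e ∈ M | e.1 ∈ S} : Finset (ℕ × ℕ)).image Prod.fst ⊆ S \ un := fun u hu => by
      obtain ⟨e, he, rfl⟩ := Finset.mem_image.1 hu
      rw [Finset.mem_filter] at he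
      refine Finset.mem_sdiff.2 ⟨he.2, fun h => ?_⟩
      rw [hun, Finset.mem_sdiff] at h
      exact h.2 (Finset.mem_image_of_mem _ he.1)
    have h₇ := (Finset.card_le_card h₅).trans Finset.card_image_le
    have h₈ := Finset.card_le_card h₆
    rw [Finset.card_image_of_injOn (h₁.mono fun e he => (Finset.mem_filter.1 he).1)] at h₈
    have h₉ := Finset.card_sdiff_add_card_eq_card hunS
    omega
  -- `Via` is reflexive, so a vertex of `S` outside `A` is its own neighbour in `R`.
  have hSA : S \ A ⊆ N := fun s hs => by
    rw [Finset.mem_sdiff] at hs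
    have hsD := ((hL s).1 (hSL hs.1)).1
    rw [hN, Finset.mem_filter, hR]
    exact ⟨⟨hsD, fun h => hs.2 ((hA s).2 ⟨hsD, h⟩)⟩, s, hs.1, .refl⟩
  refine ⟨(A \ S) ∪ (N \ S), ⟨?_, fun y hy hp => ?_⟩, ?_⟩
  · intro v hv
    rcases Finset.mem_union.1 hv with hv | hv
    · exact ((hA v).1 (Finset.mem_sdiff.1 hv).1).1
    · exact ((hR v).1 (Finset.mem_filter.1 (Finset.mem_sdiff.1 hv).1).1).1
  -- Along the path the last deletable vertex, if there is one, is in `S`; the next deletable vertex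
  -- lies in `A` or in N, and being outside Z it is in `S` too.
  · have key : ∀ w, Path E (U ∪ (D \ ((A \ S) ∪ (N \ S)))) x w →
        (w ∈ D → w ∈ S) ∧ (w ∈ U → Via E D U x w ∨ ∃ s ∈ S, Via E D U s w) := by
      intro w hw
      induction hw with
      | refl => exact ⟨fun h => absurd hx (Finset.disjoint_left.1 hDU h), fun _ => .inl .refl⟩
      | @tail w w' _ h ih =>
        obtain ⟨hE, hw, hw'⟩ := h
        have hDU' : w' ∈ D ∪ U := by
          rw [Finset.mem_union, Finset.mem_sdiff] at hw'
          rw [Finset.mem_union]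
          tauto
        have hr : Via E D U x w' ∨ ∃ s ∈ S, Via E D U s w' := by
          rcases Finset.mem_union.1 hw with h | h
          · rcases ih.2 h with h' | ⟨s, hs, h'⟩
            · exact .inl (h'.tail ⟨hE, .inl h, hDU'⟩)
            · exact .inr ⟨s, hs, h'.tail ⟨hE, .inl h, hDU'⟩⟩
          · exact .inr ⟨w, ih.1 (Finset.mem_sdiff.1 h).1, .single ⟨hE, .inr rfl, hDU'⟩⟩
        refine ⟨fun hD => ?_, fun _ => hr⟩
        have hZ : w' ∉ (A \ S) ∪ (N \ S) := by
          rcases Finset.mem_union.1 hw' with h | h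
          · exact absurd h (Finset.disjoint_left.1 hDU hD)
          · exact (Finset.mem_sdiff.1 h).2
        by_contra hS₁
        apply hZ
        rw [Finset.mem_union, Finset.mem_sdiff, Finset.mem_sdiff, hN, Finset.mem_filter, hA, hR]
        by_cases hxw : Via E D U x w'
        · exact .inl ⟨⟨hD, hxw⟩, hS₁⟩
        · exact .inr ⟨⟨⟨hD, hxw⟩, hr.resolve_left hxw⟩, hS₁⟩
    rcases (key y hp).2 (hY hy) with h | ⟨s, hs, h⟩
    · exact hmeet y hy h
    · exact ((hL s).1 (hSL hs)).2 y hy h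
  · have c₁ := Finset.card_union_le (A \ S) (N \ S)
    have c₂ := Finset.card_sdiff_add_card_inter A S
    have c₃ := Finset.card_sdiff_add_card_inter S A
    have c₄ := Finset.card_sdiff_add_card_inter N S
    have c₅ : (S \ A).card ≤ (N ∩ S).card :=
      Finset.card_le_card (Finset.subset_inter hSA Finset.sdiff_subset)
    rw [Finset.inter_comm] at c₃
    omega

/-- Let S be the set of deletable vertices that `x` reaches after the deletion of `Z`. Then S ⊆ L. A
matched vertex of S has its partner in (S \ A) ∪ (Z \ A), whence |S| ≤ |L| - |M| + |S \ A| + |Z \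
A|. On the other hand A \ Z ⊆ S ∩ A. Subtracting |S \ A| yields |A| ≤ |L| - |M| + |Z|. -/
theorem IsCut.card_ge_of_matching (hx : x ∈ U) (hY : Y ⊆ U)
    (hA : ∀ v, v ∈ A ↔ v ∈ D ∧ Via E D U x v)
    (hR : ∀ v, v ∈ R ↔ v ∈ D ∧ ¬ Via E D U x v)
    (hL : ∀ v, v ∈ L ↔ v ∈ D ∧ ∀ y ∈ Y, ¬ Via E D U v y)
    (h₁ : Set.InjOn Prod.fst (M : Set (ℕ × ℕ))) (h₂ : Set.InjOn Prod.snd (M : Set (ℕ × ℕ)))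
    (h₃ : ∀ e ∈ M, e.1 ∈ L) (h₄ : ∀ e ∈ M, e.2 ∈ R) (h₅ : ∀ e ∈ M, Via E D U e.1 e.2)
    {Z : Finset ℕ} (hZ : IsCut E D U x Y Z) : A.card + M.card ≤ Z.card + L.card := by
  classical
  set W := U ∪ (D \ Z) with hW
  have hUW : U ⊆ W := Finset.subset_union_left
  set un := L \ M.image Prod.fst with hun
  have hML : M.image Prod.fst ⊆ L := by
    intro u hu
    obtain ⟨e, he, rfl⟩ := Finset.mem_image.1 hu
    exact h₃ e he
  have hunc : un.card + M.card = L.card := by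
    rw [← Finset.card_image_of_injOn h₁]
    exact Finset.card_sdiff_add_card_eq_card hML
  set S : Finset ℕ := {w ∈ D \ Z | Path E W x w} with hS
  have hSmem : ∀ w, w ∈ S ↔ (w ∈ D ∧ w ∉ Z) ∧ Path E W x w := fun w => by
    rw [hS, Finset.mem_filter, Finset.mem_sdiff]
  have hSW : ∀ w ∈ S, w ∈ W := fun w hw => ((hSmem w).1 hw).2.mem (hUW hx)
  have hSL : S ⊆ L := fun u hu => by
    have hu' := (hSmem u).1 hu
    exact (hL u).2 ⟨hu'.1.1, fun y hy h =>
      hZ.2 y hy (hu'.2.trans (h.path hUW (hSW u hu) (hUW (hY hy))))⟩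
  set M' : Finset (ℕ × ℕ) := {e ∈ M | e.1 ∈ S} with hM'
  have hM'M : M' ⊆ M := Finset.filter_subset _ _
  have c₁ : S.card ≤ un.card + M'.card := by
    have : S ⊆ un ∪ M'.image Prod.fst := fun u hu => by
      by_cases h : u ∈ M.image Prod.fst
      · obtain ⟨e, he, rfl⟩ := Finset.mem_image.1 h
        exact Finset.mem_union_right _
          (Finset.mem_image_of_mem _ (Finset.mem_filter.2 ⟨he, hu⟩))
      · exact Finset.mem_union_left _ (Finset.mem_sdiff.2 ⟨hSL hu, h⟩)
    have h₆ := (Finset.card_le_card this).trans (Finset.card_union_le _ _)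
    have h₇ : (M'.image Prod.fst).card ≤ M'.card := Finset.card_image_le
    omega
  have c₂ : M'.card ≤ (S \ A).card + (Z \ A).card := by
    have : M'.image Prod.snd ⊆ (S \ A) ∪ (Z \ A) := fun v hv => by
      obtain ⟨e, he, rfl⟩ := Finset.mem_image.1 hv
      obtain ⟨heM, heS⟩ := Finset.mem_filter.1 he
      have hv' := (hR e.2).1 (h₄ e heM)
      have hvA : e.2 ∉ A := fun h => hv'.2 ((hA _).1 h).2
      by_cases h : e.2 ∈ Z
      · exact Finset.mem_union_right _ (Finset.mem_sdiff.2 ⟨h, hvA⟩)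
      · have hvW : e.2 ∈ W := Finset.mem_union_right _ (Finset.mem_sdiff.2 ⟨hv'.1, h⟩)
        refine Finset.mem_union_left _ (Finset.mem_sdiff.2 ⟨(hSmem _).2 ⟨⟨hv'.1, h⟩, ?_⟩, hvA⟩)
        exact ((hSmem _).1 heS).2.trans ((h₅ e heM).path hUW (hSW _ heS) hvW)
    have h₆ := (Finset.card_le_card this).trans (Finset.card_union_le _ _)
    rwa [Finset.card_image_of_injOn (h₂.mono (Finset.coe_subset.2 hM'M))] at h₆
  have c₃ : (A \ Z).card ≤ (S ∩ A).card := by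
    refine Finset.card_le_card fun v hv => ?_
    rw [Finset.mem_sdiff] at hv
    have hv' := (hA v).1 hv.1
    refine Finset.mem_inter.2 ⟨(hSmem v).2 ⟨⟨hv'.1, hv.2⟩, hv'.2.path hUW (hUW hx) ?_⟩, hv.1⟩
    exact Finset.mem_union_right _ (Finset.mem_sdiff.2 ⟨hv'.1, hv.2⟩)
  have c₄ := Finset.card_sdiff_add_card_inter A Z
  have c₅ := Finset.card_sdiff_add_card_inter S A
  have c₆ := Finset.card_sdiff_add_card_inter Z A
  rw [Finset.inter_comm] at c₆
  omega

end

/-! ### Pushing a vertex to the source side -/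

theorem mem_boundary {X : Finset ℕ} {v : ℕ} :
    v ∈ boundary E D U X ↔ v ∈ D ∪ U ∧ v ∉ X ∧ ∃ u ∈ X, E u v := by
  simp only [boundary, Finset.mem_filter]

theorem mem_reach {x v : ℕ} {Z : Finset ℕ} :
    v ∈ reach E D U x Z ↔ v ∈ D ∪ U ∧ Path E (U ∪ (D \ Z)) x v := by
  simp only [reach, Finset.mem_filter]

/-- It suffices to compare how often each vertex is counted: a vertex counted on the left is counted
by the union of the two boundaries, and if it is counted twice, by their intersection. -/
theorem boundary_submodular (X X' : Finset ℕ) :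
    (boundary E D U (X ∪ X')).card + (boundary E D U (X ∩ X')).card ≤
      (boundary E D U X).card + (boundary E D U X').card := by
  rw [← Finset.card_union_add_card_inter, ← Finset.card_union_add_card_inter (boundary E D U X)]
  refine Nat.add_le_add (Finset.card_le_card fun v hv => ?_) (Finset.card_le_card fun v hv => ?_)
  · simp only [Finset.mem_union, Finset.mem_inter, mem_boundary] at hv ⊢
    rcases hv with ⟨h, h', u, hu, hE⟩ | ⟨h, h', u, hu, hE⟩
    · rcases hu with hu | hu
      · exact .inl ⟨h, fun hv => h' (.inl hv), u, hu, hE⟩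
      · exact .inr ⟨h, fun hv => h' (.inr hv), u, hu, hE⟩
    · by_cases hv : v ∈ X
      · exact .inr ⟨h, fun hv' => h' ⟨hv, hv'⟩, u, hu.2, hE⟩
      · exact .inl ⟨h, hv, u, hu.1, hE⟩
  · simp only [Finset.mem_union, Finset.mem_inter, mem_boundary] at hv ⊢
    obtain ⟨⟨h, h', -⟩, -, -, u, hu, hE⟩ := hv
    exact ⟨⟨h, fun hv => h' (.inl hv), u, hu.1, hE⟩, h, fun hv => h' (.inr hv), u, hu.2, hE⟩

theorem boundary_reach_subset {x : ℕ} (hx : x ∈ U) (Z : Finset ℕ) :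
    boundary E D U (reach E D U x Z) ⊆ Z := by
  intro v hv
  obtain ⟨h, h', u, hu, hE⟩ := mem_boundary.1 hv
  by_contra hZ
  have hp := (mem_reach.1 hu).2
  have hvW : v ∈ U ∪ (D \ Z) := by
    rw [Finset.mem_union] at h ⊢
    rw [Finset.mem_sdiff]
    tauto
  exact h' (mem_reach.2 ⟨h, hp.tail ⟨hE, hp.mem (Finset.mem_union_left _ hx), hvW⟩⟩)

theorem not_mem_of_mem_alive (hDU : Disjoint D U) {Z : Finset ℕ} (hZ : Z ⊆ D) {v : ℕ}
    (hv : v ∈ U ∪ (D \ Z)) : v ∉ Z := by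
  rcases Finset.mem_union.1 hv with h | h
  · exact fun h' => Finset.disjoint_left.1 hDU (hZ h') h
  · exact (Finset.mem_sdiff.1 h).2

theorem alive_subset (Z : Finset ℕ) : U ∪ (D \ Z) ⊆ D ∪ U := by
  intro v hv
  rw [Finset.mem_union, Finset.mem_sdiff] at hv
  rw [Finset.mem_union]
  tauto

/-- A path that leaves `X` has to enter the boundary, which is deleted. -/
theorem isCut_boundary (hDU : Disjoint D U) {x : ℕ} {Y X : Finset ℕ} (hx : x ∈ X)
    (hX : boundary E D U X ⊆ D) (hY : ∀ y ∈ Y, y ∉ X) :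
    IsCut E D U x Y (boundary E D U X) := by
  refine ⟨hX, fun y hy hp => hY y hy ?_⟩
  clear hy
  induction hp with
  | refl => exact hx
  | @tail v w _ h ih =>
    by_contra hw
    exact not_mem_of_mem_alive hDU hX h.2.2
      (mem_boundary.2 ⟨alive_subset _ h.2.2, hw, v, ih, h.1⟩)

/-- Making `u` undeletable does not change which vertices survive the deletion of a set that avoids
`u`. Hence cuts and solutions after pushing `u` are those before it that avoid `u`. -/
theorem alive_erase_eq {u : ℕ} (hu : u ∈ D) {Z : Finset ℕ} (hZ : u ∉ Z) :
    insert u U ∪ (D.erase u \ Z) = U ∪ (D \ Z) := by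
  ext v
  simp only [Finset.mem_union, Finset.mem_insert, Finset.mem_sdiff, Finset.mem_erase]
  constructor
  · rintro ((rfl | h) | h)
    · exact .inr ⟨hu, hZ⟩
    · exact .inl h
    · exact .inr ⟨h.1.2, h.2⟩
  · rintro (h | h)
    · exact .inl (.inr h)
    · by_cases hv : v = u
      · exact .inl (.inl hv)
      · exact .inr ⟨⟨hv, h.1⟩, h.2⟩

/-- If the minimum size of a cut does not increase when the vertex `u` next to the source becomes
undeletable, then some best solution avoids `u`. -/
theorem exists_solution_avoiding (hDU : Disjoint D U) {e : ℕ × ℕ} {l : List (ℕ × ℕ)}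
    {Y : Finset ℕ} (hx : e.1 ∈ U) (hYl : ∀ y, y ∈ Y ↔ ∃ f ∈ e :: l, f.2 = y) (hY : Y ⊆ U) {u : ℕ}
    (hu : u ∈ D) (hvia : Via E D U e.1 u) {C : Finset ℕ}
    (hC : IsCut E (D.erase u) (insert u U) e.1 Y C)
    (hmin : ∀ Z, IsCut E D U e.1 Y Z → C.card ≤ Z.card) {R : Finset ℕ} (hR : R ⊆ D)
    (hsep : OrdSep E (U ∪ (D \ R)) (e :: l)) :
    ∃ R' ⊆ D.erase u, R'.card ≤ R.card ∧
      OrdSep E (insert u U ∪ (D.erase u \ R')) (e :: l) := by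
  classical
  have huC : u ∉ C := fun h => (Finset.mem_erase.1 (hC.1 h)).1 rfl
  have huU : u ∉ U := Finset.disjoint_left.1 hDU hu
  have hCD : C ⊆ D := hC.1.trans (Finset.erase_subset _ _)
  have hC' : ∀ y ∈ Y, ¬ Path E (U ∪ (D \ C)) e.1 y := by
    rw [← alive_erase_eq hu huC]
    exact hC.2
  have hR' : ∀ y ∈ Y, ¬ Path E (U ∪ (D \ R)) e.1 y := fun y hy => by
    obtain ⟨f, hf, rfl⟩ := (hYl y).1 hy
    exact hsep.1 f hf
  set P := reach E D U e.1 R with hP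
  set Q := reach E D U e.1 C with hQ
  have hxP : e.1 ∈ P := mem_reach.2 ⟨Finset.mem_union_right _ hx, .refl⟩
  have hxQ : e.1 ∈ Q := mem_reach.2 ⟨Finset.mem_union_right _ hx, .refl⟩
  have hYP : ∀ y ∈ Y, y ∉ P := fun y hy h => hR' y hy (mem_reach.1 h).2
  have hYQ : ∀ y ∈ Y, y ∉ Q := fun y hy h => hC' y hy (mem_reach.1 h).2
  have hNP : boundary E D U P ⊆ R := boundary_reach_subset hx R
  have hNQ : boundary E D U Q ⊆ C := boundary_reach_subset hx C
  have hNPQ : boundary E D U (P ∪ Q) ⊆ D := fun v hv => by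
    obtain ⟨h, h', w, hw, hE⟩ := mem_boundary.1 hv
    rw [Finset.mem_union, not_or] at h'
    rcases Finset.mem_union.1 hw with hw | hw
    · exact hR (hNP (mem_boundary.2 ⟨h, h'.1, w, hw, hE⟩))
    · exact hCD (hNQ (mem_boundary.2 ⟨h, h'.2, w, hw, hE⟩))
  have hNPQ' : boundary E D U (P ∩ Q) ⊆ D := fun v hv => by
    obtain ⟨h, h', w, hw, hE⟩ := mem_boundary.1 hv
    rw [Finset.mem_inter] at hw
    by_cases hv : v ∈ P
    · exact hCD (hNQ (mem_boundary.2 ⟨h, fun h'' => h' (Finset.mem_inter.2 ⟨hv, h''⟩), w, hw.2, hE⟩))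
    · exact hR (hNP (mem_boundary.2 ⟨h, hv, w, hw.1, hE⟩))
  -- The boundary of `P ∩ Q` is a cut, so it has at least as many elements as `C`, which contains
  -- the boundary of `Q`. Submodularity then turns this into a comparison for `P ∪ Q` and `P`.
  have hcard : (boundary E D U (P ∪ Q)).card ≤ (boundary E D U P).card := by
    have h₁ := boundary_submodular (E := E) (D := D) (U := U) P Q
    have h₂ := hmin _ (isCut_boundary hDU (Finset.mem_inter.2 ⟨hxP, hxQ⟩) hNPQ'
      fun y hy h => hYP y hy (Finset.mem_inter.1 h).1)
    have h₃ := Finset.card_le_card hNQ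
    omega
  have huWC : u ∈ U ∪ (D \ C) := Finset.mem_union_right _ (Finset.mem_sdiff.2 ⟨hu, huC⟩)
  have huQ : u ∈ Q := mem_reach.2 ⟨Finset.mem_union_left _ hu,
    hvia.path Finset.subset_union_left (Finset.mem_union_left _ hx) huWC⟩
  -- The predecessor of `u` on the path from the source is undeletable and lies in `P`; so if `u` is
  -- deleted, it is on the boundary of `P` and leaves the solution in the exchange.
  have huNP : u ∈ R → u ∈ boundary E D U P := fun huR => by
    have huP : u ∉ P := fun h =>
      not_mem_of_mem_alive hDU hR ((mem_reach.1 h).2.mem (Finset.mem_union_left _ hx)) huR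
    cases hvia with
    | refl => exact absurd hx huU
    | @tail p _ hp h =>
      have hpU : p ∈ U := by
        rcases h.2.1 with h | rfl
        · exact h
        · exact hx
      refine mem_boundary.2 ⟨Finset.mem_union_left _ hu, huP, p, mem_reach.2
        ⟨Finset.mem_union_right _ hpU, ?_⟩, h.1⟩
      exact Via.path hp Finset.subset_union_left (Finset.mem_union_left _ hx)
        (Finset.mem_union_left _ hpU)
  -- The part of `R` around the region `P` is pushed outwards to the boundary of `P ∪ Q`. The vertex
  -- `u` is in `Q` and thus not on the new boundary.
  set R' := (R \ boundary E D U P) ∪ boundary E D U (P ∪ Q) with hR'_def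
  have hR'D : R' ⊆ D := Finset.union_subset (Finset.sdiff_subset.trans hR) hNPQ
  have huR' : u ∉ R' := fun h => by
    rcases Finset.mem_union.1 h with h | h
    · rw [Finset.mem_sdiff] at h
      exact h.2 (huNP h.1)
    · exact (mem_boundary.1 h).2.1 (Finset.mem_union_right _ huQ)
  refine ⟨R', fun v hv => Finset.mem_erase.2 ⟨fun h => huR' (h ▸ hv), hR'D hv⟩, ?_, ?_⟩
  · have h₁ := Finset.card_union_le (R \ boundary E D U P) (boundary E D U (P ∪ Q))
    have h₂ := Finset.card_sdiff_add_card_eq_card hNP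
    rw [hR'_def]
    omega
  · rw [alive_erase_eq hu huR']
    refine hsep.mono fun a f hf hp => ?_
    have hfY : f.2 ∈ Y := (hYl _).2 ⟨f, hf, rfl⟩
    -- Follow a path that avoids `R'` backwards from a sink. It starts outside `P ∪ Q` and cannot
    -- enter this set without crossing its boundary. Outside `P ∪ Q` the set `R'` contains `R`,
    -- because a vertex there on the boundary of `P` is also on that of `P ∪ Q`. So the path avoids
    -- `R`.
    suffices H : a ∉ P ∪ Q ∧ a ∈ D ∪ U ∧ (a ∈ U ∪ (D \ R) ∨ a = f.2) ∧
        Path E (U ∪ (D \ R)) a f.2 from H.2.2.2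
    have hfW : f.2 ∈ U ∪ (D \ R) := Finset.mem_union_left _ (hY hfY)
    refine Relation.ReflTransGen.head_induction_on hp ?_ ?_
    · refine ⟨fun h => ?_, Finset.mem_union_right _ (hY hfY), .inr rfl, .refl⟩
      rcases Finset.mem_union.1 h with h | h
      · exact hYP _ hfY h
      · exact hYQ _ hfY h
    · rintro w w' ⟨hE, hw, hw'⟩ - ⟨h₁, h₂, h₃, h₄⟩
      have hwPQ : w ∉ P ∪ Q := fun h => not_mem_of_mem_alive hDU hR'D hw'
        (Finset.mem_union_right _ (mem_boundary.2 ⟨h₂, h₁, w, h, hE⟩))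
      have hwR : w ∉ R := fun h => by
        have hwR' := not_mem_of_mem_alive hDU hR'D hw
        rw [hR'_def, Finset.mem_union, Finset.mem_sdiff, not_or, not_and, not_not] at hwR'
        obtain ⟨h₅, h₆, v, hv, hE'⟩ := mem_boundary.1 (hwR'.1 h)
        exact hwR'.2 (mem_boundary.2 ⟨h₅, hwPQ, v, Finset.mem_union_left _ hv, hE'⟩)
      have hwW : w ∈ U ∪ (D \ R) := by
        rw [Finset.mem_union, Finset.mem_sdiff] at hw ⊢
        tauto
      have hw'W : w' ∈ U ∪ (D \ R) := by
        rcases h₃ with h₃ | rfl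
        · exact h₃
        · exact hfW
      exact ⟨hwPQ, alive_subset _ hw, .inl hwW, h₄.head ⟨hE, hwW, hw'W⟩⟩

end

/-! ## The algorithm -/

/-- Entry of the adjacency matrix. -/
def adj (rows : List (List Bool)) (u v : ℕ) : Bool := ((rows[u]?.getD [])[v]?).getD false

/-- Adjacency matrix, deletable vertices and undeletable vertices. -/
abbrev Net : Type := List (List Bool) × List ℕ × List ℕ

/-- Decide `Via`. -/
def via (c : Net) (a b : ℕ) : Bool :=
  ((bfs (fun v => v == a) (fun p q => adj c.1 p q && (c.2.2.any (· == p) || p == a))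
    (c.2.1 ++ c.2.2)).map (·.headD 0)).any (· == b)

/-- The deletable vertices next to the source. -/
def nearSource (c : Net) (x : ℕ) : List ℕ := c.2.1.filter (via c x)

/-- The other deletable vertices. -/
def farFromSource (c : Net) (x : ℕ) : List ℕ := c.2.1.filter fun v => !via c x v

/-- The deletable vertices that are not next to the sinks. -/
def farFromSinks (c : Net) (Y : List ℕ) : List ℕ := c.2.1.filter fun u => !Y.any (via c u)

/-- The minimum size of a cut, if there is a cut. -/
def cutSize (c : Net) (x : ℕ) (Y : List ℕ) : Option ℕ :=
  bif Y.any (via c x) then none else some ((nearSource c x).length +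
    (maxMatching (via c) (farFromSinks c Y) (farFromSource c x)).length -
      (farFromSinks c Y).length)

/-- The states of the search: a net, the vertices that have been deleted, the number of vertices
that may still be deleted, and the pairs of terminals that are left, the last one first. -/
abbrev State : Type := Net × List ℕ × ℕ × List (ℕ × ℕ)

/-- Forbid to delete `u`. -/
def State.push (s : State) (u : ℕ) : State :=
  ((s.1.1, s.1.2.1.filter fun v => !(v == u), u :: s.1.2.2), s.2)

/-- Delete `u`. -/
def State.delete (s : State) (u : ℕ) : State :=
  ((s.1.1, s.1.2.1.filter fun v => !(v == u), s.1.2.2), u :: s.2.1, s.2.2.1 - 1, s.2.2.2)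

/-- Turn to the next pair of terminals. -/
def State.next (s : State) : State := (s.1, s.2.1, s.2.2.1, s.2.2.2.tail)

/-- The sinks. -/
def State.sinks (s : State) : List ℕ := s.2.2.2.map Prod.snd

/-- One step of the search, if the source is `x` and `u` is next to it. -/
def State.expand (s : State) (x m u : ℕ) : Option (State × Option State) × Option (List ℕ) :=
  bif decide (m ≤ s.2.2.1) then
    bif (cutSize (s.push u).1 x s.sinks).elim false fun m' => m' == m
    then (some (s.push u, none), none)
    else (some (s.delete u, some (s.push u)), none)
  else (none, none)

/-- One step of the search. -/
def State.step (s : State) : Option (State × Option State) × Option (List ℕ) :=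
  s.2.2.2.head?.elim (none, some s.2.1) fun e =>
    (cutSize s.1 e.1 s.sinks).elim (none, none) fun m =>
      (s.1.2.1.find? (via s.1 e.1)).elim (some (s.next, none), none) fun u => s.expand e.1 m u

/-! ### One step of the search takes polynomial time -/

section PolyTime

variable {γ : Type} [Enc γ]

theorem PolyTime.adj {M : γ → List (List Bool)} {u v : γ → ℕ} (hM : PolyTime M) (hu : PolyTime u)
    (hv : PolyTime v) : PolyTime fun c => adj (M c) (u c) (v c) := by
  have h₁ : PolyTime fun c => ((M c)[u c]?).elim [] fun r => r :=
    (hM.getElem? hu).optionElim (.const []) .snd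
  have h₂ : PolyTime fun c => ((((M c)[u c]?).elim [] fun r => r)[v c]?).elim false fun r => r :=
    (h₁.getElem? hv).optionElim (.const false) .snd
  have h : ∀ {α : Type} (o : Option α) (d : α), o.getD d = o.elim d fun r => r := fun o d => by
    cases o <;> rfl
  exact h₂.congr_enc fun c => by rw [OrdMC.adj, h, h]

theorem PolyTime.via {c : γ → Net} {a b : γ → ℕ} (hc : PolyTime c) (ha : PolyTime a)
    (hb : PolyTime b) : PolyTime fun x => via (c x) (a x) (b x) := by
  have hbfs := PolyTime.bfs (start := fun x v => v == a x)
    (edge := fun x p q => OrdMC.adj (c x).1 p q && ((c x).2.2.any (· == p) || p == a x))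
    (cand := fun x => (c x).2.1 ++ (c x).2.2)
    (.beqNat .snd (ha.comp .fst))
    (.and (.adj (.comp .fst (hc.comp .fst)) (.comp .fst .snd) (.comp .snd .snd))
      (.or (.elem (.comp .fst .snd) (.comp .snd (.comp .snd (hc.comp .fst))))
        (.beqNat (.comp .fst .snd) (ha.comp .fst))))
    (.append (.comp .fst (.comp .snd hc)) (.comp .snd (.comp .snd hc)))
  exact .elem hb (.map hbfs (.headD .snd))

theorem PolyTime.cutSize {c : γ → Net} {x : γ → ℕ} {Y : γ → List ℕ} (hc : PolyTime c)
    (hx : PolyTime x) (hY : PolyTime Y) : PolyTime fun a => cutSize (c a) (x a) (Y a) := by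
  have hD : PolyTime fun a => (c a).2.1 := .comp .fst (.comp .snd hc)
  have hnear : PolyTime fun a => nearSource (c a) (x a) :=
    .filter hD (.via (hc.comp .fst) (hx.comp .fst) .snd)
  have hfar : PolyTime fun a => farFromSource (c a) (x a) :=
    .filter hD (.not (.via (hc.comp .fst) (hx.comp .fst) .snd))
  have hfar' : PolyTime fun a => farFromSinks (c a) (Y a) :=
    .filter hD (.not (.any (hY.comp .fst) (.via ((hc.comp .fst).comp .fst) (.comp .snd .fst) .snd)))
  have hM : PolyTime fun a =>
      OrdMC.maxMatching (OrdMC.via (c a)) (farFromSinks (c a) (Y a)) (farFromSource (c a) (x a)) :=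
    .maxMatching (.via (hc.comp .fst) (.comp .fst .snd) (.comp .snd .snd)) hfar' hfar
  exact .cond (.any hY (.via (hc.comp .fst) (hx.comp .fst) .snd)) (.const none)
    (.some (.sub (.add (.length hnear) (.length hM)) (.length hfar')))

theorem PolyTime.push {s : γ → State} {u : γ → ℕ} (hs : PolyTime s) (hu : PolyTime u) :
    PolyTime fun a => (s a).push (u a) :=
  .pair (.pair (.comp .fst (.comp .fst hs)) (.pair
    (.filter (.comp .fst (.comp .snd (.comp .fst hs))) (.not (.beqNat .snd (hu.comp .fst))))
    (.cons hu (.comp .snd (.comp .snd (.comp .fst hs)))))) (.comp .snd hs)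

theorem PolyTime.delete {s : γ → State} {u : γ → ℕ} (hs : PolyTime s) (hu : PolyTime u) :
    PolyTime fun a => (s a).delete (u a) :=
  .pair (.pair (.comp .fst (.comp .fst hs)) (.pair
    (.filter (.comp .fst (.comp .snd (.comp .fst hs))) (.not (.beqNat .snd (hu.comp .fst))))
    (.comp .snd (.comp .snd (.comp .fst hs))))) (.pair (.cons hu (.comp .fst (.comp .snd hs)))
      (.pair (.pred (.comp .fst (.comp .snd (.comp .snd hs))))
        (.comp .snd (.comp .snd (.comp .snd hs)))))

theorem PolyTime.next {s : γ → State} (hs : PolyTime s) : PolyTime fun a => (s a).next :=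
  .pair (.comp .fst hs) (.pair (.comp .fst (.comp .snd hs))
    (.pair (.comp .fst (.comp .snd (.comp .snd hs)))
      (.tail (.comp .snd (.comp .snd (.comp .snd hs))))))

theorem PolyTime.sinks {s : γ → State} (hs : PolyTime s) : PolyTime fun a => (s a).sinks :=
  .map (.comp .snd (.comp .snd (.comp .snd hs))) (.comp .snd .snd)

theorem PolyTime.expand {s : γ → State} {x m u : γ → ℕ} (hs : PolyTime s) (hx : PolyTime x)
    (hm : PolyTime m) (hu : PolyTime u) :
    PolyTime fun a => (s a).expand (x a) (m a) (u a) :=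
  .cond (.leNat hm (.comp .fst (.comp .snd (.comp .snd hs))))
    (.cond (.optionElim (.cutSize (.comp .fst (.push hs hu)) hx (.sinks hs)) (.const false)
        (.beqNat .snd (hm.comp .fst)))
      (.pair (.some (.pair (.push hs hu) (.const none))) (.const none))
      (.pair (.some (.pair (.delete hs hu) (.some (.push hs hu)))) (.const none)))
    (.const (none, none))

theorem PolyTime.step : PolyTime State.step := by
  refine .optionElim (.head? (.comp .snd (.comp .snd .snd)))
    (.pair (.const none) (.some (.comp .fst .snd))) (.optionElim ?_ (.const (none, none))
      (.optionElim ?_ ?_ ?_))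
  · exact .cutSize (.comp .fst .fst) (.comp .fst .snd) (.sinks .fst)
  · exact .find? (.comp .fst (.comp .snd (.comp .fst (.comp .fst .fst))))
      (.via (.comp .fst (.comp .fst (.comp .fst .fst)))
        (.comp .fst (.comp .snd (.comp .fst .fst))) .snd)
  · exact .pair (.some (.pair (.next (.comp .fst .fst)) (.const none))) (.const none)
  · exact .expand (.comp .fst (.comp .fst .fst)) (.comp .fst (.comp .snd (.comp .fst .fst)))
      (.comp .snd .fst) .snd

end PolyTime

/-! ## Correctness of the cut computation -/

/-- The arcs of a net. -/
def Net.Arc (c : Net) (u v : ℕ) : Prop := adj c.1 u v = true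

/-- The deletable vertices. -/
def Net.D (c : Net) : Finset ℕ := c.2.1.toFinset

/-- The undeletable vertices. -/
def Net.U (c : Net) : Finset ℕ := c.2.2.toFinset

/-- The search only visits candidates, so the start has to be a vertex of the net; otherwise even
the trivial path would be missed. -/
theorem via_iff {c : Net} {a b : ℕ} (ha : a ∈ c.2.1 ++ c.2.2) :
    via c a b = true ↔ Via c.Arc c.D c.U a b := by
  have hedge : ∀ p q, (adj c.1 p q && (c.2.2.any (· == p) || p == a)) = true ↔
      c.Arc p q ∧ (p ∈ c.U ∨ p = a) := fun p q => by
    simp [Net.Arc, Net.U]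
  have hcand : ∀ q, q ∈ c.2.1 ++ c.2.2 ↔ q ∈ c.D ∪ c.U := fun q => by
    simp [Net.D, Net.U]
  have hmem : via c a b = true ↔ b ∈ (bfs (fun v => v == a)
      (fun p q => adj c.1 p q && (c.2.2.any (· == p) || p == a))
      (c.2.1 ++ c.2.2)).map (·.headD 0) := by
    simp [via]
  rw [hmem]
  constructor
  · intro h
    obtain ⟨p, hp, rfl⟩ := List.mem_map.1 h
    have ht := bfs_trail hp
    clear hp h hmem
    induction ht with
    | single _ hs =>
      rw [List.headD_cons, beq_iff_eq.1 hs]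
      exact .refl
    | cons hv he _ _ ih =>
      have he := (hedge _ _).1 he
      exact Relation.ReflTransGen.tail ih ⟨he.1, he.2, (hcand _).1 hv⟩
  · have hb := bfs_closed (start := fun v => v == a)
      (edge := fun p q => adj c.1 p q && (c.2.2.any (· == p) || p == a))
      (cand := c.2.1 ++ c.2.2)
    intro h
    clear hmem
    induction h with
    | refl => exact hb.1 a ha (beq_self_eq_true a)
    | tail _ h ih => exact hb.2 _ ih _ ((hcand _).2 h.2.2) ((hedge _ _).2 ⟨h.1, h.2.1⟩)

section

variable {c : Net} {x : ℕ} {Y : List ℕ}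

theorem Net.disjoint (hc : (c.2.1 ++ c.2.2).Nodup) : Disjoint c.D c.U := by
  rw [Finset.disjoint_left]
  intro v hv hv'
  exact (List.nodup_append.1 hc).2.2 v (List.mem_toFinset.1 hv) v (List.mem_toFinset.1 hv') rfl

theorem any_via_iff {a : ℕ} (ha : a ∈ c.2.1 ++ c.2.2) :
    Y.any (via c a) = true ↔ ∃ y ∈ Y, Via c.Arc c.D c.U a y := by
  rw [List.any_eq_true]
  exact exists_congr fun y => and_congr_right fun _ => via_iff ha

theorem cutSize_eq_none (hx : x ∈ c.2.2) (h : cutSize c x Y = none) :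
    ∃ y ∈ Y, Via c.Arc c.D c.U x y := by
  rw [← any_via_iff (List.mem_append_right _ hx)]
  by_contra h'
  rw [Bool.not_eq_true] at h'
  simp [cutSize, h'] at h

/-- The maximum matching supplies both bounds: its witness set gives a cut of the computed size, and
the matching itself shows that no cut is smaller. -/
theorem cutSize_eq_some (hc : (c.2.1 ++ c.2.2).Nodup) (hx : x ∈ c.2.2) (hY : ∀ y ∈ Y, y ∈ c.2.2)
    {m : ℕ} (h : cutSize c x Y = some m) :
    (∀ y ∈ Y, ¬ Via c.Arc c.D c.U x y) ∧ (∃ Z, IsCut c.Arc c.D c.U x Y.toFinset Z ∧ Z.card = m) ∧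
      ∀ Z, IsCut c.Arc c.D c.U x Y.toFinset Z → m ≤ Z.card := by
  have hxc := List.mem_append_right c.2.1 hx
  have hxU : x ∈ c.U := List.mem_toFinset.2 hx
  have hYU : Y.toFinset ⊆ c.U := fun y hy => List.mem_toFinset.2 (hY y (List.mem_toFinset.1 hy))
  have hDn : c.2.1.Nodup := (List.nodup_append.1 hc).1
  unfold cutSize at h
  cases hany : Y.any (via c x) with
  | true => simp [hany] at h
  | false =>
    rw [hany, cond_false, Option.some.injEq] at h
    have hmeet : ∀ y ∈ Y, ¬ Via c.Arc c.D c.U x y := fun y hy hv => by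
      have := (any_via_iff (Y := Y) hxc).2 ⟨y, hy, hv⟩
      rw [hany] at this
      simp at this
    refine ⟨hmeet, ?_⟩
    have hDmem : ∀ v, v ∈ c.D ↔ v ∈ c.2.1 := fun v => List.mem_toFinset
    have hA : ∀ v, v ∈ (nearSource c x).toFinset ↔ v ∈ c.D ∧ Via c.Arc c.D c.U x v := fun v => by
      rw [List.mem_toFinset, nearSource, List.mem_filter, via_iff hxc, hDmem]
    have hR : ∀ v, v ∈ (farFromSource c x).toFinset ↔ v ∈ c.D ∧ ¬ Via c.Arc c.D c.U x v :=
      fun v => by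
        rw [List.mem_toFinset, farFromSource, List.mem_filter, Bool.not_eq_true',
          ← Bool.not_eq_true, via_iff hxc, hDmem]
    have hL : ∀ v, v ∈ (farFromSinks c Y).toFinset ↔
        v ∈ c.D ∧ ∀ y ∈ Y.toFinset, ¬ Via c.Arc c.D c.U v y := fun v => by
      rw [List.mem_toFinset, farFromSinks, List.mem_filter, Bool.not_eq_true',
        ← Bool.not_eq_true, hDmem]
      refine and_congr_right fun hv => ?_
      rw [any_via_iff (List.mem_append_left _ hv)]
      push Not
      exact forall_congr' fun y => by rw [List.mem_toFinset]
    obtain ⟨hM, S, hSL, hS, hS'⟩ :=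
      maxMatching_spec (via c) (farFromSinks c Y) (farFromSource c x)
    set M := maxMatching (via c) (farFromSinks c Y) (farFromSource c x)
    have hML : ∀ e ∈ M.toFinset, e.1 ∈ (farFromSinks c Y).toFinset := fun e he =>
      List.mem_toFinset.2 (hM.mem_left e (List.mem_toFinset.1 he))
    have hvia : ∀ u ∈ farFromSinks c Y, ∀ v, via c u v = true ↔ Via c.Arc c.D c.U u v :=
      fun u hu v => via_iff (List.mem_append_left _ (List.mem_filter.1 hu).1)
    have h₁ : Set.InjOn Prod.fst (M.toFinset : Set (ℕ × ℕ)) := fun e he f hf h =>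
      List.inj_on_of_nodup_map hM.nodup_fst (by simpa using he) (by simpa using hf) h
    have h₂ : Set.InjOn Prod.snd (M.toFinset : Set (ℕ × ℕ)) := fun e he f hf h =>
      List.inj_on_of_nodup_map hM.nodup_snd (by simpa using he) (by simpa using hf) h
    have hcard : M.toFinset.card = M.length :=
      List.toFinset_card_of_nodup (List.Nodup.of_map _ hM.nodup_fst)
    have hcA : (nearSource c x).toFinset.card = (nearSource c x).length :=
      List.toFinset_card_of_nodup (hDn.filter _)
    have hcL : (farFromSinks c Y).toFinset.card = (farFromSinks c Y).length :=
      List.toFinset_card_of_nodup (hDn.filter _)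
    have hge : ∀ Z, IsCut c.Arc c.D c.U x Y.toFinset Z → _ := fun Z hZ =>
      hZ.card_ge_of_matching (M := M.toFinset) hxU hYU hA hR hL h₁ h₂ hML
        (fun e he => List.mem_toFinset.2 (hM.mem_right e (List.mem_toFinset.1 he)))
        (fun e he => (hvia _ (hM.mem_left e (List.mem_toFinset.1 he)) _).1
          (hM.adj e (List.mem_toFinset.1 he)))
    obtain ⟨Z, hZ, hZc⟩ := exists_isCut_of_matching (M := M.toFinset) (S := S) (Net.disjoint hc)
      hxU hYU (fun y hy => hmeet y (List.mem_toFinset.1 hy)) hA hR hL h₁ hML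
      (fun u hu => List.mem_toFinset.2 (hSL u hu))
      (fun u hu hu' => hS u (List.mem_toFinset.1 hu) fun v hv => hu' v (List.mem_toFinset.2 hv))
      (fun u hu v hv huv => by
        obtain ⟨u', hu', h⟩ := hS' u hu v (List.mem_toFinset.1 hv) ((hvia u (hSL u hu) v).2 huv)
        exact ⟨u', hu', List.mem_toFinset.2 h⟩)
    have hge' := hge Z hZ
    rw [hcard, hcA, hcL] at hZc hge'
    -- The two inequalities for `Z` are an equality, so the truncated subtraction in `cutSize` loses
    -- nothing.
    refine ⟨⟨Z, hZ, by omega⟩, fun Z' hZ' => ?_⟩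
    have := hge Z' hZ'
    rw [hcard, hcA, hcL] at this
    omega

end

/-! ### Cuts after a vertex has been pushed or deleted -/

/-- If no deletable vertex is next to the source, then only vertices next to the source can be
reached. -/
theorem Path.via_of_forall_not {E : ℕ → ℕ → Prop} {D U Z : Finset ℕ} {x w : ℕ} (hx : x ∈ U)
    (h : ∀ v ∈ D, ¬ Via E D U x v) (hp : Path E (U ∪ (D \ Z)) x w) :
    w ∈ U ∧ Via E D U x w := by
  induction hp with
  | refl => exact ⟨hx, .refl⟩
  | @tail p w _ hpw ih =>
    have hw := alive_subset _ hpw.2.2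
    have hvia : Via E D U x w := ih.2.tail ⟨hpw.1, .inl ih.1, hw⟩
    exact ⟨(Finset.mem_union.1 hw).resolve_left fun hD => h w hD hvia, hvia⟩

theorem IsCut.of_push {E : ℕ → ℕ → Prop} {D U Y Z : Finset ℕ} {x u : ℕ} (hu : u ∈ D)
    (h : IsCut E (D.erase u) (insert u U) x Y Z) : IsCut E D U x Y Z := by
  refine ⟨h.1.trans (Finset.erase_subset _ _), ?_⟩
  rw [← alive_erase_eq hu fun h' => (Finset.mem_erase.1 (h.1 h')).1 rfl]
  exact h.2

theorem sdiff_insert_eq {D Z : Finset ℕ} {u : ℕ} : D \ insert u Z = D.erase u \ Z := by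
  ext v
  simp only [Finset.mem_sdiff, Finset.mem_insert, Finset.mem_erase, not_or]
  tauto

/-- This is why the deletion of one vertex lowers the minimum size of a cut by at most one. -/
theorem IsCut.of_delete {E : ℕ → ℕ → Prop} {D U Y Z : Finset ℕ} {x u : ℕ} (hu : u ∈ D)
    (h : IsCut E (D.erase u) U x Y Z) : IsCut E D U x Y (insert u Z) := by
  refine ⟨Finset.insert_subset hu (h.1.trans (Finset.erase_subset _ _)), ?_⟩
  rw [sdiff_insert_eq]
  exact h.2

/-! ## Analysis of the search -/

/-- The invariant of the search. -/
structure State.Valid (rows : List (List Bool)) (n : ℕ) (s : State) : Prop where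
  rows_eq : s.1.1 = rows
  nodup : (s.1.2.1 ++ s.1.2.2 ++ s.2.1).Nodup
  lt : ∀ v ∈ s.1.2.1 ++ s.1.2.2 ++ s.2.1, v < n
  budget : s.2.2.1 ≤ n
  pairs_mem : ∀ e ∈ s.2.2.2, e.1 ∈ s.1.2.2 ∧ e.2 ∈ s.1.2.2
  pairs_length : s.2.2.2.length ≤ n

/-- `Z` solves the problem that is left. -/
def State.IsSolution (s : State) (Z : Finset ℕ) : Prop :=
  Z ⊆ s.1.D ∧ Z.card ≤ s.2.2.1 ∧ OrdSep s.1.Arc (s.1.U ∪ (s.1.D \ Z)) s.2.2.2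

/-- `r` is a correct answer in the state `s`. -/
def State.Correct (s : State) : Option (List ℕ) → Prop
  | none => ∀ Z, ¬ s.IsSolution Z
  | some L => ∃ Q : List ℕ, L = Q ++ s.2.1 ∧ Q.Nodup ∧ s.IsSolution Q.toFinset

/-- Every cut for the next pair of terminals has at least `c` elements. -/
def State.LowerBound (s : State) (c : ℕ) : Prop :=
  ∀ e ∈ s.2.2.2.head?, ∀ Z, IsCut s.1.Arc s.1.D s.1.U e.1 s.sinks.toFinset Z → c ≤ Z.card

theorem sz_vertices_le {n : ℕ} {l : List ℕ} (hl : l.Nodup) (h : ∀ v ∈ l, v < n) :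
    l.length ≤ n ∧ sz l ≤ n * (2 * n + 1 + 1) + 1 := by
  have h₁ : l.length ≤ n := by
    rw [← List.toFinset_card_of_nodup hl, ← Finset.card_range n]
    exact Finset.card_le_card fun v hv => Finset.mem_range.2 (h v (List.mem_toFinset.1 hv))
  refine ⟨h₁, (sz_list_le (s := 2 * n + 1) fun v hv => ?_).trans ?_⟩
  · rw [sz_nat]
    have := h v hv
    omega
  · exact Nat.add_le_add_right (Nat.mul_le_mul_right _ h₁) 1

/-- An upper bound for the sizes of states. -/
def stateBound (r n : ℕ) : ℕ :=
  r + 3 * (n * (2 * n + 1 + 1) + 1) + (2 * n + 1) + (n * (4 * n + 3 + 1) + 1) + 5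

section

variable {rows : List (List Bool)} {n : ℕ} {s : State}

/-- The summands of the bound belong to the matrix, the three vertex lists, the budget, the list of
pairs and the five pairing nodes. The parameter does not occur, since the budget of a valid state is
at most `n`. -/
theorem State.Valid.sz_le (hs : s.Valid rows n) : sz s ≤ stateBound (sz rows) n := by
  obtain ⟨h₁, hR, -⟩ := List.nodup_append.1 hs.nodup
  obtain ⟨hD, hU, -⟩ := List.nodup_append.1 h₁
  have hlt : ∀ v, v ∈ s.1.2.1 ∨ v ∈ s.1.2.2 ∨ v ∈ s.2.1 → v < n := fun v hv =>
    hs.lt v (by rw [List.mem_append, List.mem_append]; tauto)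
  have h₂ := (sz_vertices_le hD fun v hv => hlt v (.inl hv)).2
  have h₃ := (sz_vertices_le hU fun v hv => hlt v (.inr (.inl hv))).2
  have h₄ := (sz_vertices_le hR fun v hv => hlt v (.inr (.inr hv))).2
  have h₅ := hs.budget
  have h₆ : sz s.2.2.2 ≤ n * (4 * n + 3 + 1) + 1 := by
    refine (sz_list_le (s := 4 * n + 3) fun e he => ?_).trans
      (Nat.add_le_add_right (Nat.mul_le_mul_right _ hs.pairs_length) 1)
    have h₇ := hlt _ (.inr (.inl (hs.pairs_mem e he).1))
    have h₈ := hlt _ (.inr (.inl (hs.pairs_mem e he).2))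
    rw [sz_prod, sz_nat, sz_nat]
    omega
  rw [sz_prod, sz_prod s.1, sz_prod s.1.2, sz_prod s.2, sz_prod s.2.2, hs.rows_eq, sz_nat]
  unfold stateBound
  omega

theorem perm_filter_cons {l : List ℕ} (hl : l.Nodup) {u : ℕ} (hu : u ∈ l) :
    (u :: l.filter fun v => !(v == u)).Perm l := by
  rw [List.perm_ext_iff_of_nodup (List.nodup_cons.2 ⟨by simp, hl.filter _⟩) hl]
  intro v
  simp only [List.mem_cons, List.mem_filter, Bool.not_eq_true', beq_eq_false_iff_ne]
  constructor
  · rintro (rfl | h)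
    · exact hu
    · exact h.1
  · intro h
    by_cases hv : v = u
    · exact .inl hv
    · exact .inr ⟨h, hv⟩

theorem State.Valid.nodup_D (hs : s.Valid rows n) : s.1.2.1.Nodup :=
  (List.nodup_append.1 (List.nodup_append.1 hs.nodup).1).1

theorem State.Valid.push (hs : s.Valid rows n) {u : ℕ} (hu : u ∈ s.1.2.1) :
    (s.push u).Valid rows n := by
  have hperm : ((s.push u).1.2.1 ++ (s.push u).1.2.2 ++ (s.push u).2.1).Perm
      (s.1.2.1 ++ s.1.2.2 ++ s.2.1) :=
    (List.perm_middle.trans ((perm_filter_cons hs.nodup_D hu).append_right _)).append_right _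
  exact ⟨hs.rows_eq, hperm.nodup_iff.2 hs.nodup, fun v hv => hs.lt v (hperm.mem_iff.1 hv),
    hs.budget, fun e he => ⟨List.mem_cons_of_mem _ (hs.pairs_mem e he).1,
      List.mem_cons_of_mem _ (hs.pairs_mem e he).2⟩, hs.pairs_length⟩

theorem State.Valid.delete (hs : s.Valid rows n) {u : ℕ} (hu : u ∈ s.1.2.1) :
    (s.delete u).Valid rows n := by
  have hperm : ((s.delete u).1.2.1 ++ (s.delete u).1.2.2 ++ (s.delete u).2.1).Perm
      (s.1.2.1 ++ s.1.2.2 ++ s.2.1) :=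
    List.perm_middle.trans
      (((perm_filter_cons hs.nodup_D hu).append_right _).append_right _)
  exact ⟨hs.rows_eq, hperm.nodup_iff.2 hs.nodup, fun v hv => hs.lt v (hperm.mem_iff.1 hv),
    (Nat.sub_le _ _).trans hs.budget, hs.pairs_mem, hs.pairs_length⟩

theorem State.Valid.next (hs : s.Valid rows n) : s.next.Valid rows n :=
  ⟨hs.rows_eq, hs.nodup, hs.lt, hs.budget, fun e he => hs.pairs_mem e (List.mem_of_mem_tail he),
    (by rw [State.next, List.length_tail]; exact (Nat.sub_le _ _).trans hs.pairs_length)⟩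

theorem State.D_push (u : ℕ) : (s.push u).1.D = s.1.D.erase u := by
  ext v
  simp [State.push, Net.D, and_comm]

theorem State.D_delete (u : ℕ) : (s.delete u).1.D = s.1.D.erase u := by
  ext v
  simp [State.delete, Net.D, and_comm]

theorem State.U_push (u : ℕ) : (s.push u).1.U = insert u s.1.U := List.toFinset_cons

theorem State.isSolution_push {u : ℕ} (hu : u ∈ s.1.D) {Z : Finset ℕ} :
    (s.push u).IsSolution Z ↔ u ∉ Z ∧ s.IsSolution Z := by
  unfold State.IsSolution
  rw [State.D_push, State.U_push]
  constructor
  · rintro ⟨h₁, h₂, h₃⟩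
    have huZ : u ∉ Z := fun h => (Finset.mem_erase.1 (h₁ h)).1 rfl
    rw [alive_erase_eq hu huZ] at h₃
    exact ⟨huZ, h₁.trans (Finset.erase_subset _ _), h₂, h₃⟩
  · rintro ⟨huZ, h₁, h₂, h₃⟩
    rw [alive_erase_eq hu huZ]
    exact ⟨fun v hv => Finset.mem_erase.2 ⟨fun h => huZ (h ▸ hv), h₁ hv⟩, h₂, h₃⟩

theorem State.correct_some_of_push {u : ℕ} (hu : u ∈ s.1.D) {L : List ℕ}
    (h : (s.push u).Correct (some L)) : s.Correct (some L) := by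
  obtain ⟨Q, hL, hQ, h⟩ := h
  exact ⟨Q, hL, hQ, ((State.isSolution_push hu).1 h).2⟩

theorem State.correct_some_of_delete {u : ℕ} (hu : u ∈ s.1.D) (hk : 1 ≤ s.2.2.1) {L : List ℕ}
    (h : (s.delete u).Correct (some L)) : s.Correct (some L) := by
  obtain ⟨Q, hL, hQ, h₁, h₂, h₃⟩ := h
  rw [State.D_delete] at h₁ h₃
  have huQ : u ∉ Q := fun h => (Finset.mem_erase.1 (h₁ (List.mem_toFinset.2 h))).1 rfl
  have hset : (Q ++ [u]).toFinset = insert u Q.toFinset := by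
    ext v
    simp
  refine ⟨Q ++ [u], ?_, ?_, ?_⟩
  · rw [hL, List.append_assoc]
    rfl
  · rw [List.nodup_append]
    refine ⟨hQ, List.nodup_singleton u, fun a ha b hb hab => huQ ?_⟩
    rw [List.mem_singleton] at hb
    rw [← hb, ← hab]
    exact ha
  · refine ⟨?_, ?_, ?_⟩
    · rw [hset]
      exact Finset.insert_subset hu (h₁.trans (Finset.erase_subset _ _))
    · rw [hset, Finset.card_insert_of_notMem (by simpa using huQ)]
      have : Q.toFinset.card ≤ s.2.2.1 - 1 := h₂
      omega
    · rw [hset, sdiff_insert_eq]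
      exact h₃

theorem State.isSolution_delete {u : ℕ} {Z : Finset ℕ} (h : s.IsSolution Z) (huZ : u ∈ Z) :
    (s.delete u).IsSolution (Z.erase u) := by
  obtain ⟨h₁, h₂, h₃⟩ := h
  refine ⟨?_, ?_, ?_⟩
  · rw [State.D_delete]
    exact Finset.erase_subset_erase u h₁
  · rw [Finset.card_erase_of_mem huZ]
    exact Nat.sub_le_sub_right h₂ 1
  · rw [State.D_delete, ← sdiff_insert_eq, Finset.insert_erase huZ]
    exact h₃

/-- Each step shortens the list of deletable vertices or that of pairs, which bounds the depth by
`d`. The exponent 2k - c, where c is a lower bound for the minimum cut, drops in both branches of a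
branching step and does not rise in the other steps. These add only one visited state, paid for by
the factor `d + 1`. -/
theorem State.Valid.exists_search (d : ℕ) : ∀ {s : State} {c : ℕ}, s.Valid rows n →
    s.1.2.1.length + s.2.2.2.length ≤ d → s.LowerBound c →
    ∃ r N, Search State.step (stateBound (sz rows) n) s r N ∧
      N ≤ (d + 1) * 2 ^ (2 * s.2.2.1 - c) ∧ s.Correct r := by
  induction d with
  | zero =>
    intro s c hs hd _
    have hp : s.2.2.2 = [] := List.length_eq_zero_iff.1 (by omega)
    refine ⟨some s.2.1, 1, .leaf hs.sz_le ?_, ?_, [], rfl, List.nodup_nil, ?_⟩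
    · rw [State.step, hp]
      rfl
    · rw [Nat.zero_add, Nat.one_mul]
      exact Nat.one_le_two_pow
    · refine ⟨by simp, by simp, ?_⟩
      rw [hp]
      trivial
  | succ d ih =>
    intro s c hs hd hc
    have hone : 1 ≤ (d + 1 + 1) * 2 ^ (2 * s.2.2.1 - c) :=
      Nat.mul_pos (Nat.succ_pos _) (Nat.two_pow_pos _)
    cases hp : s.2.2.2 with
    | nil =>
      refine ⟨some s.2.1, 1, .leaf hs.sz_le ?_, hone, [], rfl, List.nodup_nil, by simp, by simp, ?_⟩
      · rw [State.step, hp]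
        rfl
      · rw [hp]
        trivial
    | cons e l =>
      have hhead : s.2.2.2.head? = some e := by rw [hp, List.head?_cons]
      have hnd : (s.1.2.1 ++ s.1.2.2).Nodup := (List.nodup_append.1 hs.nodup).1
      have hDU := Net.disjoint hnd
      have hmem : ∀ f ∈ e :: l, f.1 ∈ s.1.2.2 ∧ f.2 ∈ s.1.2.2 := by
        rw [← hp]
        exact hs.pairs_mem
      have hx : e.1 ∈ s.1.2.2 := (hmem e List.mem_cons_self).1
      have hxU : e.1 ∈ s.1.U := List.mem_toFinset.2 hx
      have hsinks : ∀ y, y ∈ s.sinks ↔ ∃ f ∈ e :: l, f.2 = y := fun y => by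
        rw [State.sinks, hp, List.mem_map]
      have hY : ∀ y ∈ s.sinks, y ∈ s.1.2.2 := fun y hy => by
        obtain ⟨f, hf, rfl⟩ := (hsinks y).1 hy
        exact (hmem f hf).2
      have hYU : s.sinks.toFinset ⊆ s.1.U := fun y hy =>
        List.mem_toFinset.2 (hY y (List.mem_toFinset.1 hy))
      have hsol : ∀ Z, s.IsSolution Z →
          IsCut s.1.Arc s.1.D s.1.U e.1 s.sinks.toFinset Z := fun Z hZ => by
        refine ⟨hZ.1, fun y hy => ?_⟩
        obtain ⟨f, hf, rfl⟩ := (hsinks y).1 (List.mem_toFinset.1 hy)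
        have := hZ.2.2
        rw [hp] at this
        exact this.1 f hf
      have hstep : s.step = (cutSize s.1 e.1 s.sinks).elim (none, none) fun m =>
          (s.1.2.1.find? (via s.1 e.1)).elim (some (s.next, none), none)
            fun u => s.expand e.1 m u := by
        rw [State.step, hhead, Option.elim_some]
      cases hcut : cutSize s.1 e.1 s.sinks with
      | none =>
        rw [hcut, Option.elim_none] at hstep
        refine ⟨none, 1, .leaf hs.sz_le hstep, hone, fun Z hZ => ?_⟩
        obtain ⟨y, hy, hvia⟩ := cutSize_eq_none hx hcut
        exact (hsol Z hZ).2 y (List.mem_toFinset.2 hy)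
          (hvia.path Finset.subset_union_left (Finset.mem_union_left _ hxU)
            (Finset.mem_union_left _ (hYU (List.mem_toFinset.2 hy))))
      | some m =>
        rw [hcut, Option.elim_some] at hstep
        obtain ⟨hmeet, ⟨C, hC, hCm⟩, hmin⟩ := cutSize_eq_some hnd hx hY hcut
        have hcm : c ≤ m := hCm ▸ hc e hhead C hC
        cases hfind : s.1.2.1.find? (via s.1 e.1) with
        | none =>
          rw [hfind, Option.elim_none] at hstep
          have hnone : ∀ v ∈ s.1.D, ¬ Via s.1.Arc s.1.D s.1.U e.1 v := fun v hv h =>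
            List.find?_eq_none.1 hfind v (List.mem_toFinset.1 hv)
              ((via_iff (List.mem_append_right _ hx)).2 h)
          have hpath : ∀ Z, ∀ y ∈ s.sinks, ¬ Path s.1.Arc (s.1.U ∪ (s.1.D \ Z)) e.1 y :=
            fun Z y hy h => hmeet y hy (h.via_of_forall_not hxU hnone).2
          -- The empty set is a cut here, so the lower bound was already zero and restarting with
          -- zero for the next pair costs nothing.
          have hc₀ : c = 0 := by
            have := hc e hhead ∅ ⟨by simp, fun y hy => hpath ∅ y (List.mem_toFinset.1 hy)⟩
            simpa using this
          have hnp : s.next.2.2.2 = l := by rw [State.next, hp, List.tail_cons]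
          obtain ⟨r, N, hrun, hN, hr⟩ := ih (c := 0) hs.next
            (by rw [hnp]; rw [hp, List.length_cons] at hd; exact Nat.le_of_succ_le_succ hd)
            (fun _ _ _ _ => Nat.zero_le _)
          have hiff : ∀ Z, s.IsSolution Z ↔ s.next.IsSolution Z := fun Z => by
            refine and_congr_right fun _ => and_congr_right fun _ => ?_
            rw [hp, hnp]
            exact ⟨fun h => h.2, fun h => ⟨fun f hf =>
              hpath Z f.2 ((hsinks _).2 ⟨f, hf, rfl⟩), h⟩⟩
          have hN' : N + 1 ≤ (d + 1 + 1) * 2 ^ (2 * s.2.2.1 - c) := by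
            have h₁ : 1 ≤ 2 ^ (2 * s.2.2.1 - c) := Nat.one_le_two_pow
            rw [hc₀] at h₁ ⊢
            rw [Nat.succ_mul]
            exact Nat.add_le_add hN h₁
          cases r with
          | none =>
            exact ⟨none, N + 1, .fail hs.sz_le hstep hrun, hN', fun Z hZ => hr Z ((hiff Z).1 hZ)⟩
          | some L =>
            obtain ⟨Q, hL, hQ, hsolQ⟩ := hr
            exact ⟨some L, N + 1, .left hs.sz_le hstep hrun, hN', Q, hL, hQ, (hiff _).2 hsolQ⟩
        | some u =>
          rw [hfind, Option.elim_some, State.expand] at hstep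
          have hu : u ∈ s.1.2.1 := List.mem_of_find?_eq_some hfind
          have huD : u ∈ s.1.D := List.mem_toFinset.2 hu
          have hvia : Via s.1.Arc s.1.D s.1.U e.1 u :=
            (via_iff (List.mem_append_right _ hx)).1 (List.find?_some hfind)
          by_cases hmk : m ≤ s.2.2.1
          swap
          · rw [decide_eq_false hmk, cond_false] at hstep
            refine ⟨none, 1, .leaf hs.sz_le hstep, hone, fun Z hZ => ?_⟩
            exact hmk ((hmin Z (hsol Z hZ)).trans hZ.2.1)
          rw [decide_eq_true hmk, cond_true] at hstep
          have hps := hs.push hu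
          have hxp : e.1 ∈ (s.push u).1.2.2 := List.mem_cons_of_mem _ hx
          have hYp : ∀ y ∈ s.sinks, y ∈ (s.push u).1.2.2 :=
            fun y hy => List.mem_cons_of_mem _ (hY y hy)
          have hndp : ((s.push u).1.2.1 ++ (s.push u).1.2.2).Nodup :=
            (List.nodup_append.1 hps.nodup).1
          have hlen : (s.1.2.1.filter fun v => !(v == u)).length + 1 = s.1.2.1.length := by
            rw [← (perm_filter_cons hs.nodup_D hu).length_eq, List.length_cons]
          have hdp : (s.push u).1.2.1.length + (s.push u).2.2.2.length ≤ d := by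
            change (s.1.2.1.filter fun v => !(v == u)).length + s.2.2.2.length ≤ d
            omega
          have hof : ∀ Z, IsCut (s.push u).1.Arc (s.push u).1.D (s.push u).1.U e.1
              s.sinks.toFinset Z → IsCut s.1.Arc s.1.D s.1.U e.1 s.sinks.toFinset Z :=
            fun Z hZ => by
              rw [State.D_push, State.U_push] at hZ
              exact hZ.of_push huD
          cases heq : (cutSize (s.push u).1 e.1 s.sinks).elim false fun m' => m' == m with
          | true =>
            rw [heq, cond_true] at hstep
            obtain ⟨r, N, hrun, hN, hr⟩ := ih (c := c) hps hdp fun f hf Z hZ => by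
              have hfe : f = e := by
                have : some e = some f := hhead.symm.trans hf
                exact (Option.some.inj this).symm
              rw [hfe] at hZ
              exact hc e hhead Z (hof Z hZ)
            have hN' : N + 1 ≤ (d + 1 + 1) * 2 ^ (2 * s.2.2.1 - c) := by
              rw [Nat.succ_mul]
              exact Nat.add_le_add hN Nat.one_le_two_pow
            cases r with
            | none =>
              refine ⟨none, N + 1, .fail hs.sz_le hstep hrun, hN', fun Z hZ => ?_⟩
              cases hcut' : cutSize (s.push u).1 e.1 s.sinks with
              | none => simp [hcut'] at heq
              | some m' =>
                have hm' : m' = m := by simpa [hcut'] using heq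
                obtain ⟨-, ⟨C', hC', hCm'⟩, -⟩ := cutSize_eq_some hndp hxp hYp hcut'
                rw [State.D_push, State.U_push] at hC'
                have hord := hZ.2.2
                rw [hp] at hord
                -- A solution avoiding `u` exists as soon as there is any solution: the cut `C'`
                -- avoids `u` and is as small as the minimum without this restriction.
                obtain ⟨Z', hZ'D, hZ'c, hZ'⟩ := exists_solution_avoiding hDU hxU
                  (fun y => by rw [List.mem_toFinset, hsinks]) hYU huD hvia hC'
                  (fun Z hZ => by rw [hCm', hm']; exact hmin Z hZ) hZ.1 hord
                refine hr Z' ⟨?_, hZ'c.trans hZ.2.1, ?_⟩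
                · rw [State.D_push]
                  exact hZ'D
                · rw [State.D_push, State.U_push]
                  change OrdSep _ _ s.2.2.2
                  rw [hp]
                  exact hZ'
            | some L =>
              exact ⟨some L, N + 1, .left hs.sz_le hstep hrun, hN',
                State.correct_some_of_push huD hr⟩
          | false =>
            rw [heq, cond_false] at hstep
            -- The minimum size has changed, and a cut that avoids `u` is also a cut of the original
            -- net; so the size has increased, or there is no cut at all.
            have hlt : ∀ Z, IsCut (s.push u).1.Arc (s.push u).1.D (s.push u).1.U e.1
                s.sinks.toFinset Z → m + 1 ≤ Z.card := fun Z hZ => by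
              cases hcut' : cutSize (s.push u).1 e.1 s.sinks with
              | none =>
                obtain ⟨y, hy, hv⟩ := cutSize_eq_none hxp hcut'
                exact absurd (hv.path Finset.subset_union_left
                  (Finset.mem_union_left _ (List.mem_toFinset.2 hxp))
                  (Finset.mem_union_left _ (List.mem_toFinset.2 (hYp y hy))))
                  (hZ.2 y (List.mem_toFinset.2 hy))
              | some m' =>
                have hm' : m' ≠ m := by simpa [hcut'] using heq
                obtain ⟨-, ⟨C', hC', hCm'⟩, hmin'⟩ := cutSize_eq_some hndp hxp hYp hcut'
                have h₁ := hmin C' (hof C' hC')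
                have h₂ := hmin' Z hZ
                omega
            -- An empty cut would remain a cut after pushing `u`. Positivity of `m` makes the
            -- truncated subtractions in the exponents exact, and with `m ≤ k` it also permits the
            -- deletion.
            have hm : 1 ≤ m := by
              by_contra hm
              have hm₀ : m = 0 := by omega
              rw [hm₀, Finset.card_eq_zero] at hCm
              subst hCm
              have := hlt ∅ ⟨by simp, by
                rw [State.D_push, State.U_push, alive_erase_eq huD (by simp)]
                exact hC.2⟩
              simp at this
            have hdd : (s.delete u).1.2.1.length + (s.delete u).2.2.2.length ≤ d := hdp
            obtain ⟨r₁, N₁, hrun₁, hN₁, hr₁⟩ := ih (c := m - 1) (hs.delete hu) hdd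
              fun f hf Z hZ => by
                have hfe : f = e := by
                  have : some e = some f := hhead.symm.trans hf
                  exact (Option.some.inj this).symm
                rw [hfe, State.D_delete] at hZ
                have h₁ := hmin _ (IsCut.of_delete huD hZ)
                have h₂ := Finset.card_insert_le u Z
                omega
            obtain ⟨r₂, N₂, hrun₂, hN₂, hr₂⟩ := ih (c := m + 1) hps hdp fun f hf Z hZ => by
                have hfe : f = e := by
                  have : some e = some f := hhead.symm.trans hf
                  exact (Option.some.inj this).symm
                rw [hfe] at hZ
                exact hlt Z hZ
            have hpow : 2 ^ (2 * s.2.2.1 - m) ≤ 2 ^ (2 * s.2.2.1 - c) :=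
              Nat.pow_le_pow_right (by norm_num) (by omega)
            have he₁ : 2 * (s.delete u).2.2.1 - (m - 1) = 2 * s.2.2.1 - m - 1 := by
              change 2 * (s.2.2.1 - 1) - (m - 1) = _
              omega
            have he₂ : 2 * (s.push u).2.2.1 - (m + 1) = 2 * s.2.2.1 - m - 1 := by
              change 2 * s.2.2.1 - (m + 1) = _
              omega
            rw [he₁] at hN₁
            rw [he₂] at hN₂
            have htwo : 2 ^ (2 * s.2.2.1 - m) = 2 * 2 ^ (2 * s.2.2.1 - m - 1) := by
              rw [← pow_succ']
              congr 1
              omega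
            -- Both subtrees have exponent 2k - m - 1, so together they have at most (d + 1) * 2^(2k
            -- - m) states; the extra summand in the factor `d + 1 + 1` pays for the current state.
            have hN' : N₁ + N₂ + 1 ≤ (d + 1 + 1) * 2 ^ (2 * s.2.2.1 - c) := by
              refine le_trans ?_ (Nat.mul_le_mul_left _ hpow)
              rw [htwo]
              have := Nat.two_pow_pos (2 * s.2.2.1 - m - 1)
              nlinarith
            cases r₁ with
            | some L =>
              exact ⟨some L, N₁ + 1, .left hs.sz_le hstep hrun₁, by omega,
                State.correct_some_of_delete huD (hm.trans hmk) hr₁⟩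
            | none =>
              refine ⟨r₂, N₁ + N₂ + 1, .right hs.sz_le hstep hrun₁ hrun₂, hN', ?_⟩
              cases r₂ with
              | some L => exact State.correct_some_of_push huD hr₂
              | none =>
                intro Z hZ
                by_cases huZ : u ∈ Z
                · exact hr₁ _ (State.isSolution_delete hZ huZ)
                · exact hr₂ Z ((State.isSolution_push huD).2 ⟨huZ, hZ⟩)

end

/-! ## Initialization -/

/-- The positions in a list, the last one first. -/
def indices {α : Type} (l : List α) : List ℕ := l.foldr (fun _ acc => acc.length :: acc) []

theorem indices_eq {α : Type} (l : List α) : indices l = (List.range l.length).reverse := by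
  induction l with
  | nil => rfl
  | cons a l ih =>
    rw [List.length_cons, List.range_succ, List.reverse_append, ← ih]
    change (indices l).length :: indices l = _
    rw [ih, List.length_reverse, List.length_range]
    rfl

/-- Adjacency matrix, sources, sinks and parameter. -/
abbrev Input : Type := List (List Bool) × List ℕ × List ℕ × ℕ

/-- The start of the search. -/
def initial (a : Input) : State :=
  ((a.1, (indices a.1).filter fun v => !(a.2.1 ++ a.2.2.1).any (· == v), a.2.1 ++ a.2.2.1), [],
    -- By truncated subtraction this is the minimum of the parameter and the number of vertices. The
    -- cap keeps the size of states independent of the parameter.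
    a.2.2.2 - (a.2.2.2 - a.1.length),
    (indices a.2.1).map fun i => ((a.2.1[i]?).getD 0, (a.2.2.1[i]?).getD 0))

theorem PolyTime.indices {γ α : Type} [Enc γ] [Enc α] {l : γ → List α} (hl : PolyTime l) :
    PolyTime fun c => indices (l c) := by
  refine PolyTime.foldr hl (.const []) (.cons (.length (.comp .snd .snd)) (.comp .snd .snd)) ?_
  refine PolyBounded.list (s := sz) (t := fun x => 2 * sz x) .sz_self (.mul (.const 2) .sz_self)
    (fun x => ?_) fun x v hv => ?_
  · change (OrdMC.indices x.2).length ≤ _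
    have := length_lt_sz x.2
    rw [indices_eq, List.length_reverse, List.length_range, sz_prod]
    omega
  · change v ∈ OrdMC.indices x.2 at hv
    have := length_lt_sz x.2
    rw [indices_eq, List.mem_reverse, List.mem_range] at hv
    rw [sz_nat, sz_prod]
    omega

theorem PolyTime.getD {γ : Type} [Enc γ] {l : γ → List ℕ} {i : γ → ℕ} (hl : PolyTime l)
    (hi : PolyTime i) : PolyTime fun c => ((l c)[i c]?).getD 0 :=
  ((hl.getElem? hi).optionElim (.const 0) .snd).congr_enc fun c => by cases (l c)[i c]? <;> rfl

theorem PolyTime.initial : PolyTime initial := by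
  have hX : PolyTime fun a : Input => a.2.1 := .comp .fst .snd
  have hY : PolyTime fun a : Input => a.2.2.1 := .comp .fst (.comp .snd .snd)
  have hk : PolyTime fun a : Input => a.2.2.2 := .comp .snd (.comp .snd .snd)
  have hXY := hX.append hY
  exact .pair (.pair .fst (.pair
      (.filter (.indices .fst) (.not (.elem .snd (hXY.comp .fst)))) hXY))
    (.pair (.const []) (.pair (.sub hk (.sub hk (.length .fst)))
      (.map (.indices hX) (.pair (.getD (hX.comp .fst) .snd) (.getD (hY.comp .fst) .snd)))))

/-- The parameter is part of the input in unary, so the initialization costs a polynomial in it as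
well. The parameter is split off as a power of k + 1, which is at most a constant times 2^k. -/
theorem exists_polynomial_four_pow (p : Polynomial ℕ) :
    ∃ q : Polynomial ℕ, ∀ a k, p.eval (a + 2 * k) ≤ 4 ^ k * q.eval a := by
  induction p using Polynomial.induction_on' with
  | add p q hp hq =>
    obtain ⟨p', hp⟩ := hp
    obtain ⟨q', hq⟩ := hq
    refine ⟨p' + q', fun a k => ?_⟩
    rw [Polynomial.eval_add, Polynomial.eval_add, Nat.mul_add]
    exact Nat.add_le_add (hp a k) (hq a k)
  | monomial d c =>
    refine ⟨Polynomial.C (c * (d.factorial * 2 ^ d)) * (2 * (Polynomial.X + 1)) ^ d,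
      fun a k => ?_⟩
    -- The power is at most the rising factorial (k+1)⋯(k+d), which is d! times a binomial
    -- coefficient of k + d.
    have h₁ : (k + 1) ^ d ≤ d.factorial * 2 ^ (k + d) := by
      refine (Nat.pow_succ_le_ascFactorial (k + 1) d).trans ?_
      rw [Nat.ascFactorial_eq_factorial_mul_choose]
      exact Nat.mul_le_mul_left _ (Nat.choose_le_two_pow _ _)
    have h₂ : (2 : ℕ) ^ k ≤ 4 ^ k := Nat.pow_le_pow_left (by norm_num) k
    have h₃ : a + 2 * k ≤ 2 * (a + 1) * (k + 1) := by nlinarith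
    simp only [Polynomial.eval_monomial, Polynomial.eval_mul, Polynomial.eval_C,
      Polynomial.eval_pow, Polynomial.eval_add, Polynomial.eval_X, Polynomial.eval_one,
      Polynomial.eval_ofNat]
    calc c * (a + 2 * k) ^ d ≤ c * ((2 * (a + 1)) ^ d * (d.factorial * (4 ^ k * 2 ^ d))) := by
          refine Nat.mul_le_mul_left _ ((Nat.pow_le_pow_left h₃ d).trans ?_)
          rw [mul_pow (2 * (a + 1))]
          refine Nat.mul_le_mul_left _ (h₁.trans (Nat.mul_le_mul_left _ ?_))
          rw [pow_add]
          exact Nat.mul_le_mul_right _ h₂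
      _ = _ := by ring

/-- With the last index in front, the pairs at or behind position i in the list are those with index
j ≤ i, which is the order condition of the problem. -/
theorem ordSep_iff {E : ℕ → ℕ → Prop} {W : Finset ℕ} (g : ℕ → ℕ × ℕ) (m : ℕ) :
    OrdSep E W ((List.range m).reverse.map g) ↔
      ∀ i < m, ∀ j ≤ i, ¬ Path E W (g i).1 (g j).2 := by
  induction m with
  | zero => simp [OrdSep]
  | succ m ih =>
    rw [List.range_succ, List.reverse_append, List.reverse_singleton, List.singleton_append,
      List.map_cons, OrdSep, ih]
    constructor
    · rintro ⟨h₁, h₂⟩ i hi j hj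
      rcases Nat.lt_succ_iff_lt_or_eq.1 hi with hi | rfl
      · exact h₂ i hi j hj
      · refine h₁ (g j) ?_
        rcases hj.lt_or_eq with hj | rfl
        · exact List.mem_cons_of_mem _ (List.mem_map.2 ⟨j, by simpa using hj, rfl⟩)
        · exact List.mem_cons_self
    · refine fun h => ⟨fun f hf => ?_, fun i hi => h i (by omega)⟩
      rcases List.mem_cons.1 hf with rfl | hf
      · exact h m (by omega) m le_rfl
      · obtain ⟨j, hj, rfl⟩ := List.mem_map.1 hf
        rw [List.mem_reverse, List.mem_range] at hj
        exact h m (by omega) j hj.le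

/-! ### From the encoded instance to the initial state and back -/

section

variable {n l : ℕ}

open Classical in
/-- The adjacency matrix of a digraph. -/
noncomputable def rowsOf (G : Digraph (Fin n)) : List (List Bool) :=
  List.ofFn fun u : Fin n => List.ofFn fun v : Fin n => decide (G.Adj u v)

/-- The vertex names in a sequence. -/
def names (X : Fin l → Fin n) : List ℕ := (List.ofFn X).map Fin.val

theorem enc_ofVertices (L : List (Fin n)) : Enc.enc (L.map Fin.val) = Data.ofVertices L := by
  -- `Data.ofVertices` maps over the list after coercing it monadically to a list of numbers; this
  -- form is identified with the plain map of `Fin.val`.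
  have h : (do let a ← L; pure (a : ℕ)) = L.map Fin.val := by
    induction L with
    | nil => rfl
    | cons a L ih =>
      rw [List.map_cons, ← ih]
      rfl
  rw [Data.ofVertices, h]
  rfl

theorem enc_input (G : Digraph (Fin n)) (X Y : Fin l → Fin n) (k : ℕ) :
    Enc.enc (rowsOf G, names X, names Y, k) = encodeInput G X Y k := by
  have h : Enc.enc (rowsOf G) = Data.ofDigraph G := by
    change Data.ofList ((rowsOf G).map fun r => Data.ofList (r.map Data.ofBool)) = _
    rw [rowsOf, Data.ofDigraph, List.map_ofFn]
    congr 2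
    funext u
    rw [Function.comp_apply, List.map_ofFn]
    rfl
  change Data.cons (Enc.enc (rowsOf G)) (.cons (Enc.enc (names X))
    (.cons (Enc.enc (names Y)) (Enc.enc k))) = _
  rw [h, names, names, enc_ofVertices, enc_ofVertices]
  rfl

theorem adj_rowsOf {G : Digraph (Fin n)} {u v : ℕ} :
    adj (rowsOf G) u v = true ↔ ∃ (hu : u < n) (hv : v < n), G.Adj ⟨u, hu⟩ ⟨v, hv⟩ := by
  unfold adj rowsOf
  by_cases hu : u < n
  · by_cases hv : v < n
    · simp [hu, hv]
    · simp [hu, hv]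
  · simp [hu]

/-- Arcs of the matrix only join names below `n`, so it does not matter which larger numbers belong
to `W`. -/
theorem hasPathAvoiding_iff {G : Digraph (Fin n)} {R : Finset (Fin n)} {W : Finset ℕ}
    (hW : ∀ v : Fin n, (v : ℕ) ∈ W ↔ v ∉ R) {a b : Fin n} (ha : a ∉ R) :
    HasPathAvoiding G R a b ↔ Path (fun u v => adj (rowsOf G) u v = true) W a b := by
  rw [HasPathAvoiding, and_iff_right ha]
  constructor
  · intro h
    refine Relation.ReflTransGen.lift Fin.val ?_ _ _ h
    intro u v h
    exact ⟨adj_rowsOf.2 ⟨u.2, v.2, h.1⟩, (hW u).2 h.2.1, (hW v).2 h.2.2⟩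
  · intro h
    have key : ∀ w : ℕ, Path (fun u v => adj (rowsOf G) u v = true) W a w → ∃ hw : w < n,
        Relation.ReflTransGen (fun u v => G.Adj u v ∧ u ∉ R ∧ v ∉ R) a ⟨w, hw⟩ := by
      intro w hw
      induction hw with
      | refl => exact ⟨a.2, .refl⟩
      | tail _ h ih =>
        obtain ⟨hu, ih⟩ := ih
        obtain ⟨hu, hv, hE⟩ := adj_rowsOf.1 h.1
        exact ⟨hv, ih.tail ⟨hE, (hW ⟨_, hu⟩).1 h.2.1, (hW ⟨_, hv⟩).1 h.2.2⟩⟩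
    exact (key b h).2

theorem length_rowsOf (G : Digraph (Fin n)) : (rowsOf G).length = n := by
  rw [rowsOf, List.length_ofFn]

theorem sz_rowsOf_le (G : Digraph (Fin n)) : sz (rowsOf G) ≤ n * (n * 4 + 1 + 1) + 1 := by
  have h := sz_list_le (l := rowsOf G) (s := n * 4 + 1) fun r hr => by
    obtain ⟨u, rfl⟩ := (List.mem_ofFn' _ _).1 hr
    refine (sz_list_le (s := 3) fun b _ => sz_bool b).trans ?_
    rw [List.length_ofFn]
  rwa [length_rowsOf] at h

theorem mem_names {X : Fin l → Fin n} {v : ℕ} : v ∈ names X ↔ ∃ i, (X i : ℕ) = v := by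
  simp [names, List.mem_ofFn']

theorem nodup_names {X : Fin l → Fin n} (hX : Function.Injective X) : (names X).Nodup :=
  (List.nodup_ofFn.2 hX).map Fin.val_injective

theorem length_names (X : Fin l → Fin n) : (names X).length = l := by
  rw [names, List.length_map, List.length_ofFn]

theorem getD_names (X : Fin l → Fin n) (i : Fin l) : ((names X)[(i : ℕ)]?).getD 0 = X i := by
  simp [names]

variable {G : Digraph (Fin n)} {X Y : Fin l → Fin n} {k : ℕ}

theorem mem_deletable_initial {v : ℕ} : v ∈ (initial (rowsOf G, names X, names Y, k)).1.2.1 ↔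
    v < n ∧ ∀ i, (X i : ℕ) ≠ v ∧ (Y i : ℕ) ≠ v := by
  simp only [initial, List.mem_filter, indices_eq, length_rowsOf, List.mem_reverse,
    List.mem_range, Bool.not_eq_true', List.any_eq_false, List.mem_append, beq_iff_eq, mem_names]
  refine and_congr_right fun _ => ⟨fun h i => ⟨h _ (.inl ⟨i, rfl⟩), h _ (.inr ⟨i, rfl⟩)⟩, ?_⟩
  rintro h w (⟨i, rfl⟩ | ⟨i, rfl⟩)
  · exact (h i).1
  · exact (h i).2

theorem mem_undeletable_initial {v : ℕ} : v ∈ (initial (rowsOf G, names X, names Y, k)).1.2.2 ↔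
    (∃ i, (X i : ℕ) = v) ∨ ∃ i, (Y i : ℕ) = v := by
  simp only [initial, List.mem_append, mem_names]

theorem pairs_initial : (initial (rowsOf G, names X, names Y, k)).2.2.2 =
    (List.range l).reverse.map fun i => (((names X)[i]?).getD 0, ((names Y)[i]?).getD 0) := by
  simp only [initial, indices_eq, length_names]

theorem budget_initial : (initial (rowsOf G, names X, names Y, k)).2.2.1 = min k n := by
  simp only [initial, length_rowsOf]
  omega

theorem valid_initial (hX : Function.Injective X) (hY : Function.Injective Y)
    (hXY : ∀ i j, X i ≠ Y j) :
    (initial (rowsOf G, names X, names Y, k)).Valid (rowsOf G) n := by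
  have hU : (names X ++ names Y).Nodup := by
    refine List.nodup_append.2 ⟨nodup_names hX, nodup_names hY, fun a ha b hb hab => ?_⟩
    obtain ⟨i, rfl⟩ := mem_names.1 ha
    obtain ⟨j, rfl⟩ := mem_names.1 hb
    exact hXY i j (Fin.ext hab)
  refine ⟨rfl, ?_, ?_, ?_, ?_, ?_⟩
  · change (_ ++ _ ++ []).Nodup
    rw [List.append_nil]
    refine List.nodup_append.2 ⟨?_, hU, fun a ha b hb hab => ?_⟩
    · refine List.Nodup.filter _ ?_
      rw [indices_eq, List.nodup_reverse]
      exact List.nodup_range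
    · have ha := (mem_deletable_initial.1 ha).2
      rcases mem_undeletable_initial.1 hb with ⟨i, rfl⟩ | ⟨i, rfl⟩
      · exact (ha i).1 hab.symm
      · exact (ha i).2 hab.symm
  · intro v hv
    change v ∈ _ ++ _ ++ [] at hv
    rw [List.append_nil] at hv
    rcases List.mem_append.1 hv with hv | hv
    · exact (mem_deletable_initial.1 hv).1
    · rcases mem_undeletable_initial.1 hv with ⟨i, rfl⟩ | ⟨i, rfl⟩
      · exact (X i).2
      · exact (Y i).2
  · rw [budget_initial]
    exact min_le_right _ _
  · intro e he
    rw [pairs_initial] at he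
    obtain ⟨i, hi, rfl⟩ := List.mem_map.1 he
    rw [List.mem_reverse, List.mem_range] at hi
    rw [getD_names X ⟨i, hi⟩, getD_names Y ⟨i, hi⟩, mem_undeletable_initial,
      mem_undeletable_initial]
    exact ⟨.inl ⟨_, rfl⟩, .inr ⟨_, rfl⟩⟩
  · rw [pairs_initial, List.length_map, List.length_reverse, List.length_range]
    simpa using Fintype.card_le_of_injective X hX

/-- The solutions of the initial state are the solutions of the problem. -/
theorem isSolution_initial_iff (R : Finset (Fin n)) :
    (initial (rowsOf G, names X, names Y, k)).IsSolution (R.map Fin.valEmbedding) ↔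
      R.card ≤ k ∧ OrderlySeparates G X Y R := by
  set s := initial (rowsOf G, names X, names Y, k) with hs
  have hDmem : ∀ v : ℕ, v ∈ s.1.D ↔ v < n ∧ ∀ i, (X i : ℕ) ≠ v ∧ (Y i : ℕ) ≠ v := fun v =>
    List.mem_toFinset.trans mem_deletable_initial
  have hUmem : ∀ v : ℕ, v ∈ s.1.U ↔ (∃ i, (X i : ℕ) = v) ∨ ∃ i, (Y i : ℕ) = v := fun v =>
    List.mem_toFinset.trans mem_undeletable_initial
  have hmap : ∀ v : Fin n, (v : ℕ) ∈ R.map Fin.valEmbedding ↔ v ∈ R := fun v =>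
    Finset.mem_map' Fin.valEmbedding
  have hsub : R.map Fin.valEmbedding ⊆ s.1.D ↔ ∀ i, X i ∉ R ∧ Y i ∉ R := by
    constructor
    · intro h i
      exact ⟨fun hi => (((hDmem _).1 (h ((hmap _).2 hi))).2 i).1 rfl,
        fun hi => (((hDmem _).1 (h ((hmap _).2 hi))).2 i).2 rfl⟩
    · intro h v hv
      obtain ⟨w, hw, rfl⟩ := Finset.mem_map.1 hv
      exact (hDmem _).2 ⟨w.2, fun i => ⟨fun hi => (h i).1 (by rw [Fin.ext hi]; exact hw),
        fun hi => (h i).2 (by rw [Fin.ext hi]; exact hw)⟩⟩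
  -- Capping the budget excludes no solution, as a set of vertices has at most `n` elements.
  have hcard : (R.map Fin.valEmbedding).card ≤ s.2.2.1 ↔ R.card ≤ k := by
    have : R.card ≤ n := by simpa using Finset.card_le_univ R
    rw [hs, budget_initial, Finset.card_map, le_min_iff]
    tauto
  unfold State.IsSolution OrderlySeparates
  rw [hsub, hcard, and_left_comm]
  refine and_congr_right fun _ => and_congr_right fun hR => ?_
  have hW : ∀ v : Fin n, (v : ℕ) ∈ s.1.U ∪ (s.1.D \ R.map Fin.valEmbedding) ↔ v ∉ R := fun v => by
    rw [Finset.mem_union, Finset.mem_sdiff, hmap, hDmem, hUmem]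
    constructor
    · rintro ((⟨i, hi⟩ | ⟨i, hi⟩) | h)
      · rw [← Fin.ext hi]
        exact (hR i).1
      · rw [← Fin.ext hi]
        exact (hR i).2
      · exact h.2
    · intro hv
      by_cases h : (∃ i, (X i : ℕ) = v) ∨ ∃ i, (Y i : ℕ) = v
      · exact .inl h
      · push Not at h
        exact .inr ⟨⟨v.2, fun i => ⟨h.1 i, h.2 i⟩⟩, hv⟩
  rw [hs, pairs_initial, ordSep_iff, ← hs]
  have harc : s.1.Arc = fun u v => adj (rowsOf G) u v = true := rfl
  rw [harc]
  constructor
  · intro h i j hij hp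
    have := h i i.2 j hij
    simp only [getD_names] at this
    exact this ((hasPathAvoiding_iff hW (hR i).1).1 hp)
  · intro h i hi j hj hp
    have hj' : j < l := hj.trans_lt hi
    simp only [getD_names X ⟨i, hi⟩, getD_names Y ⟨j, hj'⟩] at hp
    exact h ⟨i, hi⟩ ⟨j, hj'⟩ hj ((hasPathAvoiding_iff hW (hR _).1).2 hp)

theorem exists_answer {r : Option (List ℕ)}
    (hr : (initial (rowsOf G, names X, names Y, k)).Correct r) :
    ∃ ans : Option (List (Fin n)), encodeOutput ans = Enc.enc r ∧ IsCorrectAnswer G X Y k ans := by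
  cases r with
  | none =>
    exact ⟨none, rfl, fun ⟨R, hR⟩ => hr _ ((isSolution_initial_iff R).2 hR)⟩
  | some L =>
    obtain ⟨Q, hL, hQ, hsol⟩ := hr
    have hLQ : L = Q := hL.trans (List.append_nil Q)
    subst hLQ
    have hlt : ∀ v ∈ L, v < n := fun v hv =>
      (mem_deletable_initial.1 (List.mem_toFinset.1 (hsol.1 (List.mem_toFinset.2 hv)))).1
    obtain ⟨L', rfl⟩ : ∃ L' : List (Fin n), L'.map Fin.val = L :=
      ⟨L.pmap Fin.mk hlt, by rw [List.map_pmap]; simp⟩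
    have hnd : L'.Nodup := List.Nodup.of_map _ hQ
    have hset : (L'.map Fin.val).toFinset = L'.toFinset.map Fin.valEmbedding := by
      ext v
      simp
    rw [hset, isSolution_initial_iff, List.toFinset_card_of_nodup hnd] at hsol
    refine ⟨some L', ?_, hnd, hsol⟩
    change Data.cons .nil (Data.ofVertices L') = .cons .nil (Enc.enc (L'.map Fin.val))
    rw [enc_ofVertices]

end

end OrdMC

/-! ### The algorithm and its running time -/

theorem mainTheorem4 :
    ∃ (P : OrdMC.Program) (p : Polynomial ℕ),
      ∀ (n l k : ℕ) (G : Digraph (Fin n)) (X Y : Fin l → Fin n),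
        OrdMC.IsDAG G → Function.Injective X → Function.Injective Y → (∀ i j, X i ≠ Y j) →
          ∃ (ans : Option (List (Fin n))) (t : ℕ),
            OrdMC.HaltsWith P (OrdMC.encodeInput G X Y k) (OrdMC.encodeOutput ans) t ∧
              OrdMC.IsCorrectAnswer G X Y k ans ∧ t ≤ 4 ^ k * p.eval n := by
  open OrdMC in
  obtain ⟨P₀, e₀, q, hsearch⟩ := PolyTime.exists_search PolyTime.step
  obtain ⟨P, p₁, hP⟩ := exists_program PolyTime.initial P₀ e₀
  obtain ⟨p₂, hp₂⟩ := exists_polynomial_four_pow p₁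
  -- Polynomials in n for the sizes of the matrix (`r`), of a list of distinct vertices (`v`) and of
  -- a search state (`b`).
  set r : Polynomial ℕ := Polynomial.X * (Polynomial.X * 4 + 1 + 1) + 1 with hr
  set v : Polynomial ℕ := Polynomial.X * (2 * Polynomial.X + 1 + 1) + 1 with hv
  set b : Polynomial ℕ := r + 3 * v + (2 * Polynomial.X + 1) +
    (Polynomial.X * (4 * Polynomial.X + 3 + 1) + 1) + 5 with hb
  refine ⟨P, p₂.comp (r + 2 * v + 4) + (2 * Polynomial.X + 1) * q.comp b,
    fun n l k G X Y _ hX hY hXY => ?_⟩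
  have hvalid := valid_initial (G := G) (k := k) hX hY hXY
  set s := initial (rowsOf G, names X, names Y, k) with hs
  have hDlen : s.1.2.1.length ≤ n :=
    (sz_vertices_le hvalid.nodup_D fun v hv => (mem_deletable_initial.1 hv).1).1
  -- At most n deletable vertices and at most n pairs give depth 2n. The search starts with the
  -- trivial lower bound 0, so its exponent is twice the budget.
  obtain ⟨ans, N, hrun, hN, hcorrect⟩ := State.Valid.exists_search (2 * n) (c := 0) hvalid
    (by have := hvalid.pairs_length; omega) fun _ _ _ _ => Nat.zero_le _
  obtain ⟨t, ht, heval⟩ := hsearch _ _ _ _ hrun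
  obtain ⟨t', ht', hhalt⟩ := hP (rowsOf G, names X, names Y, k) _ t heval
  obtain ⟨ans', hans, hcorrect'⟩ := exists_answer hcorrect
  refine ⟨ans', t', ?_, hcorrect', ?_⟩
  · rw [hans, ← enc_input]
    exact hhalt
  · have hrows := sz_rowsOf_le G
    have hre : r.eval n = n * (n * 4 + 1 + 1) + 1 := by simp [hr]
    have hve : v.eval n = n * (2 * n + 1 + 1) + 1 := by simp [hv]
    have hbe : b.eval n = stateBound (r.eval n) n := by simp [hb, hve, stateBound]
    have h₁ : p₁.eval (sz (rowsOf G, names X, names Y, k)) ≤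
        4 ^ k * p₂.eval (r.eval n + 2 * v.eval n + 4) := by
      refine (polyEval_mono p₁ ?_).trans (hp₂ _ k)
      have hX' := (sz_vertices_le (nodup_names hX) fun v hv => by
        obtain ⟨i, rfl⟩ := mem_names.1 hv
        exact (X i).2).2
      have hY' := (sz_vertices_le (nodup_names hY) fun v hv => by
        obtain ⟨i, rfl⟩ := mem_names.1 hv
        exact (Y i).2).2
      simp only [sz_prod, sz_nat]
      omega
    have h₂ : q.eval (stateBound (sz (rowsOf G)) n) ≤ q.eval (b.eval n) := by
      refine polyEval_mono q ?_
      rw [hbe, hre]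
      unfold stateBound
      omega
    have h₃ : 2 ^ (2 * s.2.2.1 - 0) ≤ 4 ^ k := by
      rw [Nat.sub_zero, pow_mul, hs, budget_initial]
      exact Nat.pow_le_pow_right (by norm_num) (min_le_left _ _)
    simp only [Polynomial.eval_add, Polynomial.eval_mul, Polynomial.eval_comp, Polynomial.eval_X,
      Polynomial.eval_one, Polynomial.eval_ofNat]
    calc t' ≤ 4 ^ k * p₂.eval (r.eval n + 2 * v.eval n + 4) +
          (2 * n + 1) * 4 ^ k * q.eval (b.eval n) := by
          refine ht'.trans (Nat.add_le_add h₁ (ht.trans (Nat.mul_le_mul ?_ h₂)))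
          exact hN.trans (Nat.mul_le_mul_left _ h₃)
      _ = _ := by ring
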